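/- **Classification of the meromorphic solutions.** Let $K,b,c,s_1,s_2,s_3\in\mathbb C$ with $c\neq 0$, and consider $$K=u'u'''-\tfrac12 u''^2+30\,b\,u'^2-\tfrac{30}{c^2}\left(u^4-4s_1u^3+6s_2u^2-4s_3u+3s_1^4-6s_1^2s_2+4s_1s_3\right).\qquad(\ast)$$ $\wp(z,g_2,g_3)$ is the Weierstrass function of the period lattice with invariants $g_2,g_3$; for $g_2^3=27g_3^2$ it denotes its degenerate form $\wp(z,3d^2,-d^3)=-d+\frac{3d}2\coth^2\!\big(\sqrt{3d/2}\,z\big)$ $(d\ne0)$, $\wp(z,0,0)=z^{-2}$. The elliptic order of an elliptic function is its number of poles, with multiplicity, in a fundamental parallelogram of its period lattice. The nonconstant meromorphic functions $u$ on $\mathbb C$ that satisfy $(\ast)$ are exactly the following, $z_0\in\mathbb C$ being arbitrary, where in (1) and (2) $c$ may also be replaced by $-c$ throughout. 1. $u=s_1+bc+c\,\wp(z-z_0,g_2,g_3)$ with $g_2=20(s_1^2-s_2-b^2c^2)/c^2$, $g_3=10(s_3-3s_1s_2+2s_1^3+2bcs_2-2bcs_1^2+4b^3c^3)/c^3$,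 under the constraint $$c^2K=10\left(-128b^4c^4-88b^2c^2(s_2-s_1^2)-5(s_2-s_1^2)^2+18bc(-2s_1^3+3s_2s_1-s_3)\right).$$ 2. $u=s_1+bc+c\left(k^2\tanh^2k(z-z_0)-\frac23k^2\right)$, $k\ne0$, with $k^4=15(s_1^2-s_2-b^2c^2)/c^2$, under the constraints $s_3=\frac1{135}(3s_1+3bc+ck^2)(45s_1^2-15s_1c(3b+k^2)-4c^2k^4+30bc^2k^2-90b^2c^2)$, $K=-\frac29c^2(3b+k^2)^2(45b^2-30bk^2+k^4)$. 3. $$u=s_1-c(e_2-e_3)\frac{(\wp_0+b)^2+g_2/4-3b^2}{\wp_0^2-b\wp_0-g_2/4+b^2},\qquad \wp_0=\wp(z-z_0,g_2,g_3),$$ with $g_2=2(e_1^2+e_2^2+e_3^2)=\frac{10(s_1^2-s_2+2b^2c^2)}{3c^2}$, $g_3=4e_1e_2e_3=\frac{2(5(s_1^2-s_2)+4b^2c^2)b}{3c^2}$, $e_1=-b$, $e_1+e_2+e_3=0$, $(e_2-e_3)^2=\frac{11b^2c^2+10(s_1^2-s_2)}{3c^2}$, under $\Delta:=g_2^3-27g_3^2\neq0$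 and the two constraints $$2s_1^3-3s_2s_1+s_3=0,\qquad c^2K=-\tfrac{16}3\left(8b^2c^2+5(s_2-s_1^2)\right)\left(11b^2c^2-10(s_2-s_1^2)\right).\qquad(\ast\ast)$$ 4. $$u=s_1-\frac{4cc_1k}{3b}\,\frac{(1-\tanh^2k(z-z_0))\tanh k(z-z_0)}{(1+\tanh^2k(z-z_0))^2},\qquad k^2=\tfrac{3b}2,\quad c_1^2=-54b^3,$$ under the constraints $b\neq0$, $K=0$, $s_2=s_1^2+\frac{11}{10}b^2c^2$, $s_3=s_1(s_1^2+\frac{33}{10}b^2c^2)$. Moreover: * Family 1 is nonempty whenever its constraint holds. Its members satisfy $F_2\equiv cu'^2-4(u-s_1-bc)^3+20(s_1^2-s_2-b^2c^2)(u-s_1-bc)+10(s_3-3s_1s_2+2s_1^3+2bcs_2-2bcs_1^2+4b^3c^3)=0$, and are elliptic of order 2 when $g_2^3\ne27g_3^2$. Family 2 consists exactly of the members of family 1 with $g_2^3=27g_3^2$, $g_2\neq0$. * Family 3 is nonempty whenever $(\ast\ast)$ and $\Delta\ne0$ hold; its members are elliptic of order 4. In families 3 and 4 the roots of $x^3-3s_1x^2+3s_2x-s_3$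 are equispaced. * Let $\sigma_2=\frac13(5(s_2-s_1^2)+8b^2c^2)$, and consider, under $(\ast\ast)$ and with $g_2,g_3$ as in 3, the functions $u=s_1-\frac{d}{dz}\frac{c_1c}{\wp(z-z_1,g_2,g_3)-e_0}$ with $z_1\in\mathbb C$, $c_1\ne0$, $c_1^2=4(e_0+b)^2(2e_0-b)$, $\sigma_2=2c^2(e_0+b)^2$. Those with $\Delta\neq0$ are exactly family 3, those with $\Delta=0$ exactly family 4. Here $\Delta=\frac4{27c^6}(11b^2c^2+10(s_1^2-s_2))(8b^2c^2-5(s_1^2-s_2))^2$. * Let $F_4\equiv c^2\left(u'^2+12b((u-s_1)^2+2\sigma_2)\right)^2-16\left((u-s_1)^2+2\sigma_2\right)^3$. Families 3 and 4 together are exactly the nonconstant meromorphic $u$ with $F_4(u,u')=0$, under $(\ast\ast)$ and $\sigma_2\neq0$. The polynomial $F_4$ is irreducible when $\sigma_2\ne0$, and the curve $F_4=0$ has genus one when $\Delta\neq0$. -/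

import Mathlib

open Filter Polynomial

noncomputable section

namespace SwiftHohenberg

/-- The fixed complex coefficients `K, b, c, s₁, s₂, s₃` of the differential equation. -/
structure Coeffs where
  K : ℂ
  b : ℂ
  c : ℂ
  s₁ : ℂ
  s₂ : ℂ
  s₃ : ℂ

/-- The same coefficients with `c` replaced by `-c`. The differential equation is unchanged. -/
def Coeffs.flip (q : Coeffs) : Coeffs := { q with c := -q.c }

/-! Meromorphic functions on `ℂ` are functions `u : ℂ → ℂ` with `Meromorphic u`. The value at a pole
carries no information, so identities between meromorphic functions are required off a closed
discrete set, that is, along the filter `codiscrete ℂ`. -/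

/-- `u` is a meromorphic function on `ℂ` satisfying the third order equation
`K = u' u''' - u''² / 2 + 30 b u'²
  - (30 / c²) (u⁴ - 4 s₁ u³ + 6 s₂ u² - 4 s₃ u + 3 s₁⁴ - 6 s₁² s₂ + 4 s₁ s₃)`. -/
def IsMeromorphicSolution (q : Coeffs) (u : ℂ → ℂ) : Prop :=
  Meromorphic u ∧ ∀ᶠ z in codiscrete ℂ,
    q.K = deriv u z * iteratedDeriv 3 u z - (iteratedDeriv 2 u z) ^ 2 / 2
      + 30 * q.b * (deriv u z) ^ 2
      - 30 / q.c ^ 2 * ((u z) ^ 4 - 4 * q.s₁ * (u z) ^ 3 + 6 * q.s₂ * (u z) ^ 2 - 4 * q.s₃ * u z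
          + 3 * q.s₁ ^ 4 - 6 * q.s₁ ^ 2 * q.s₂ + 4 * q.s₁ * q.s₃)

/-- `u` is constant as a meromorphic function. -/
def IsConstant (u : ℂ → ℂ) : Prop := ∃ a : ℂ, u =ᶠ[codiscrete ℂ] fun _ => a

/-- `p` is the Weierstrass function `z ↦ ℘(z, g₂, g₃)` with invariants `g₂, g₃`: the `℘`-function of
a period lattice with these invariants, or, when `g₂³ = 27 g₃²`, its degenerate form
`℘(z, 3 d², -d³) = -d + (3 d / 2) coth² (κ z)` with `κ² = 3 d / 2 ≠ 0`, respectively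
`℘(z, 0, 0) = 1 / z²`. -/
def IsWeierstrassP (g₂ g₃ : ℂ) (p : ℂ → ℂ) : Prop :=
  (∃ L : PeriodPair, L.g₂ = g₂ ∧ L.g₃ = g₃ ∧ p = L.weierstrassP) ∨
  (∃ d κ : ℂ, κ ≠ 0 ∧ κ ^ 2 = 3 * d / 2 ∧ g₂ = 3 * d ^ 2 ∧ g₃ = -d ^ 3 ∧
    p = fun z => -d + 3 * d / 2 * (Complex.cosh (κ * z) / Complex.sinh (κ * z)) ^ 2) ∨
  (g₂ = 0 ∧ g₃ = 0 ∧ p = fun z => 1 / z ^ 2)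

/-- `u` is an elliptic function of elliptic order `n`: `L` is its lattice of all periods, and it has
`n` poles, counted with multiplicity, in a fundamental parallelogram of `L`. -/
def IsEllipticOfOrder (u : ℂ → ℂ) (n : ℕ) : Prop :=
  Meromorphic u ∧ ∃ L : PeriodPair,
    (∀ ω : ℂ, (fun z => u (z + ω)) =ᶠ[codiscrete ℂ] u ↔ ω ∈ L.lattice) ∧
    (∑ᶠ z ∈ ZSpan.fundamentalDomain L.basis, (-(meromorphicOrderAt u z).untop₀).toNat) = n

/-- The three fixed points, i.e. the roots of `x³ - 3 s₁ x² + 3 s₂ x - s₃`, are equispaced: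
they are `m - d, m, m + d`. -/
def Equispaced (q : Coeffs) : Prop :=
  ∃ m d : ℂ, ∀ x : ℂ, x ^ 3 - 3 * q.s₁ * x ^ 2 + 3 * q.s₂ * x - q.s₃
    = (x - (m - d)) * (x - m) * (x - (m + d))

/-- `F(u, u') = 0` for a polynomial `F` in the two variables `u` (inner) and `u'` (outer). -/
def SatisfiesFirstOrder (F : Polynomial (Polynomial ℂ)) (u : ℂ → ℂ) : Prop :=
  ∀ᶠ z in codiscrete ℂ, F.evalEval (u z) (deriv u z) = 0

/-- The plane curve `F = 0` (for irreducible `F`) has genus one: it is birational to a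
nonsingular Weierstrass cubic, i.e. the two function fields are isomorphic over `ℂ`. -/
def HasGenusOne (F : Polynomial (Polynomial ℂ)) : Prop :=
  ∃ W : WeierstrassCurve.Affine ℂ, W.IsElliptic ∧
    Nonempty (FractionRing (AdjoinRoot F) ≃ₐ[ℂ] W.FunctionField)

/-! ### Solutions with one Laurent series -/

/-- `g₂` of the first elliptic family. -/
def g₂One (q : Coeffs) : ℂ := 20 * (q.s₁ ^ 2 - q.s₂ - q.b ^ 2 * q.c ^ 2) / q.c ^ 2

/-- `g₃` of the first elliptic family. -/
def g₃One (q : Coeffs) : ℂ :=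
  10 * (q.s₃ - 3 * q.s₁ * q.s₂ + 2 * q.s₁ ^ 3 + 2 * q.b * q.c * q.s₂ - 2 * q.b * q.c * q.s₁ ^ 2
    + 4 * q.b ^ 3 * q.c ^ 3) / q.c ^ 3

/-- The discriminant `g₂³ - 27 g₃²` of the first elliptic family. -/
def discOne (q : Coeffs) : ℂ := g₂One q ^ 3 - 27 * g₃One q ^ 2

/-- The single constraint on the coefficients for the first elliptic family. -/
def ConstraintOne (q : Coeffs) : Prop :=
  q.c ^ 2 * q.K = 10 * (-128 * q.b ^ 4 * q.c ^ 4 - 88 * q.b ^ 2 * q.c ^ 2 * (q.s₂ - q.s₁ ^ 2)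
    - 5 * (q.s₂ - q.s₁ ^ 2) ^ 2
    + 18 * q.b * q.c * (-2 * q.s₁ ^ 3 + 3 * q.s₂ * q.s₁ - q.s₃))

/-- `F₂ = c u'² - 4 (u - s₁ - b c)³ + 20 (s₁² - s₂ - b² c²) (u - s₁ - b c)
  + 10 (s₃ - 3 s₁ s₂ + 2 s₁³ + 2 b c s₂ - 2 b c s₁² + 4 b³ c³)`. -/
def F₂ (q : Coeffs) : Polynomial (Polynomial ℂ) :=
  C (C q.c) * X ^ 2 - 4 * C ((X - C (q.s₁ + q.b * q.c)) ^ 3)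
    + C (C (20 * (q.s₁ ^ 2 - q.s₂ - q.b ^ 2 * q.c ^ 2)) * (X - C (q.s₁ + q.b * q.c)))
    + C (C (10 * (q.s₃ - 3 * q.s₁ * q.s₂ + 2 * q.s₁ ^ 3 + 2 * q.b * q.c * q.s₂
        - 2 * q.b * q.c * q.s₁ ^ 2 + 4 * q.b ^ 3 * q.c ^ 3)))

/-- `u = s₁ + b c + c ℘(z - z₀, g₂, g₃)`, under its constraint. -/
def IsEllipticOne (q : Coeffs) (u : ℂ → ℂ) : Prop :=
  ConstraintOne q ∧ ∃ (p : ℂ → ℂ) (z₀ : ℂ), IsWeierstrassP (g₂One q) (g₃One q) p ∧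
    u =ᶠ[codiscrete ℂ] fun z => q.s₁ + q.b * q.c + q.c * p (z - z₀)

/-- `u = s₁ + b c + c (k² tanh² k (z - z₀) - 2 k² / 3)` with `k ≠ 0`, under its constraints. -/
def IsTrigoOne (q : Coeffs) (u : ℂ → ℂ) : Prop :=
  ∃ k z₀ : ℂ, k ≠ 0 ∧
    k ^ 4 = 15 * (q.s₁ ^ 2 - q.s₂ - (q.b * q.c) ^ 2) / q.c ^ 2 ∧
    q.s₃ = 1 / 135 * (3 * q.s₁ + 3 * q.b * q.c + q.c * k ^ 2) *
      (45 * q.s₁ ^ 2 - 15 * q.s₁ * q.c * (3 * q.b + k ^ 2) - 4 * q.c ^ 2 * k ^ 4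
        + 30 * q.b * q.c ^ 2 * k ^ 2 - 90 * q.b ^ 2 * q.c ^ 2) ∧
    q.K = -(2 / 9) * q.c ^ 2 * (3 * q.b + k ^ 2) ^ 2
      * (45 * q.b ^ 2 - 30 * q.b * k ^ 2 + k ^ 4) ∧
    u =ᶠ[codiscrete ℂ] fun z =>
      q.s₁ + q.b * q.c + q.c * (k ^ 2 * Complex.tanh (k * (z - z₀)) ^ 2 - 2 / 3 * k ^ 2)

/-! ### Solutions with two Laurent series -/

/-- `σ₂ = (5 (s₂ - s₁²) + 8 b² c²) / 3`. -/
def σ₂ (q : Coeffs) : ℂ := 1 / 3 * (5 * (q.s₂ - q.s₁ ^ 2) + 8 * q.b ^ 2 * q.c ^ 2)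

/-- The two constraints on the coefficients for the second elliptic family. -/
def ConstraintTwo (q : Coeffs) : Prop :=
  2 * q.s₁ ^ 3 - 3 * q.s₂ * q.s₁ + q.s₃ = 0 ∧
  q.c ^ 2 * q.K = -(16 / 3) * (8 * q.b ^ 2 * q.c ^ 2 + 5 * (q.s₂ - q.s₁ ^ 2))
    * (11 * q.b ^ 2 * q.c ^ 2 - 10 * (q.s₂ - q.s₁ ^ 2))

/-- `F₄ = c² (u'² + 12 b ((u - s₁)² + 2 σ₂))² - 16 ((u - s₁)² + 2 σ₂)³`. -/
def F₄ (q : Coeffs) : Polynomial (Polynomial ℂ) :=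
  C (C (q.c ^ 2)) * (X ^ 2 + C (C (12 * q.b) * ((X - C q.s₁) ^ 2 + C (2 * σ₂ q)))) ^ 2
    - 16 * C ((X - C q.s₁) ^ 2 + C (2 * σ₂ q)) ^ 3

/-- `g₂` of the second elliptic family. -/
def g₂Two (q : Coeffs) : ℂ :=
  10 * (q.s₁ ^ 2 - q.s₂ + 2 * q.b ^ 2 * q.c ^ 2) / (3 * q.c ^ 2)

/-- `g₃` of the second elliptic family. -/
def g₃Two (q : Coeffs) : ℂ :=
  2 * (5 * (q.s₁ ^ 2 - q.s₂) + 4 * q.b ^ 2 * q.c ^ 2) * q.b / (3 * q.c ^ 2)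

/-- The discriminant `g₂³ - 27 g₃²` of the second elliptic family. -/
def discTwo (q : Coeffs) : ℂ := g₂Two q ^ 3 - 27 * g₃Two q ^ 2

/-- The even form of the second elliptic solution, under its constraints and `g₂³ - 27 g₃² ≠ 0`:
`u = s₁ - c (e₂ - e₃) ((℘₀ + b)² + g₂ / 4 - 3 b²) / (℘₀² - b ℘₀ - g₂ / 4 + b²)`,
where `℘₀ = ℘(z - z₀, g₂, g₃)` and `e₁ = -b, e₂, e₃` are the roots of `4 x³ - g₂ x - g₃`. -/
def IsEllipticTwo (q : Coeffs) (u : ℂ → ℂ) : Prop :=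
  ConstraintTwo q ∧ discTwo q ≠ 0 ∧
  ∃ (p : ℂ → ℂ) (z₀ e₁ e₂ e₃ : ℂ), IsWeierstrassP (g₂Two q) (g₃Two q) p ∧
    e₁ = -q.b ∧ e₁ + e₂ + e₃ = 0 ∧
    g₂Two q = 2 * (e₁ ^ 2 + e₂ ^ 2 + e₃ ^ 2) ∧ g₃Two q = 4 * e₁ * e₂ * e₃ ∧
    (e₂ - e₃) ^ 2 = (11 * q.b ^ 2 * q.c ^ 2 + 10 * (q.s₁ ^ 2 - q.s₂)) / (3 * q.c ^ 2) ∧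
    u =ᶠ[codiscrete ℂ] fun z =>
      q.s₁ - q.c * (e₂ - e₃) * ((p (z - z₀) + q.b) ^ 2 + g₂Two q / 4 - 3 * q.b ^ 2)
        / (p (z - z₀) ^ 2 - q.b * p (z - z₀) - g₂Two q / 4 + q.b ^ 2)

/-- The odd form `u = s₁ - d/dz (c₁ c / (℘(z - z₁, g₂, g₃) - e₀))`, with `c₁ ≠ 0`, under its
constraints. The value `g₂³ - 27 g₃² = 0` is allowed here. -/
def IsOddTwo (q : Coeffs) (u : ℂ → ℂ) : Prop :=
  ConstraintTwo q ∧
  ∃ (p : ℂ → ℂ) (z₁ e₀ c₁ : ℂ), IsWeierstrassP (g₂Two q) (g₃Two q) p ∧ c₁ ≠ 0 ∧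
    c₁ ^ 2 = 4 * (e₀ + q.b) ^ 2 * (2 * e₀ - q.b) ∧ σ₂ q = 2 * q.c ^ 2 * (e₀ + q.b) ^ 2 ∧
    u =ᶠ[codiscrete ℂ] fun z => q.s₁ - deriv (fun w => c₁ * q.c / (p (w - z₁) - e₀)) z

/-- The solution rational in `tanh`, under its constraints (`b ≠ 0`):
`u = s₁ - (4 c c₁ k / (3 b)) (1 - tanh²) tanh / (1 + tanh²)²` at `k (z - z₀)`. -/
def IsTrigoTwo (q : Coeffs) (u : ℂ → ℂ) : Prop :=
  q.b ≠ 0 ∧ q.K = 0 ∧ q.s₂ = q.s₁ ^ 2 + 11 / 10 * (q.b * q.c) ^ 2 ∧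
  q.s₃ = q.s₁ * (q.s₁ ^ 2 + 33 / 10 * (q.b * q.c) ^ 2) ∧
  ∃ k c₁ z₀ : ℂ, k ^ 2 = 3 * q.b / 2 ∧ c₁ ^ 2 = -54 * q.b ^ 3 ∧
    u =ᶠ[codiscrete ℂ] fun z =>
      q.s₁ - 4 * q.c * c₁ * k / (3 * q.b)
        * ((1 - Complex.tanh (k * (z - z₀)) ^ 2) * Complex.tanh (k * (z - z₀)))
        / (1 + Complex.tanh (k * (z - z₀)) ^ 2) ^ 2

end SwiftHohenberg

end

noncomputable section

namespace SwiftHohenberg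

open Topology

/-! ### Identities along the codiscrete filter -/

/-! Put y = (u - s₁)/c; the equation becomes `swift b S T y = k`. Its solutions have only double
poles, with leading coefficient ε = 1 or ε = -1 (`IsSol.lead_pole`). Linearisation at such a pole
has indicial polynomial m³ + 11m + 60 = (m + 3)(m² - 3m + 20), whose only integer root -3 comes from
translating the pole (`lead_swift_sub`). So each sign ε admits at most one Laurent series, and two
solutions with poles of the same sign are translates of each other (`translate_eq`). For a single
solution this means: differences of poles of equal sign are periods, y is even about every pole, and
the poles are uniformly separated.

The passage from local to global rests on a rescaling estimate: |y| ≤ A/R² at the centre of a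
pole-free disc of radius R ≤ 1, with A depending on the coefficients only (`norm_le_of_swift`). A
differential polynomial in y whose poles all cancel is therefore bounded away from the poles of y,
then everywhere by the maximum principle, and so is constant by Liouville (`DiffPoly.isConstant`).
By periodicity the cancellation has to be checked at one pole of each sign only.

If all poles have ε = 1, then y'' - 6y² + 12ay is constant for a suitable a, and y - b is a
Weierstrass function (`IsSol.isW_of_one_type`); ε = -1 is reduced to this by y ↦ -y, that is c ↦ -c.
If both signs occur, a multiple H of 2yy'' - 3y'² - 12by² has principal part (z - p)⁻² at every pole
p, so P = (H + y)/2 and Q = (H - y)/2 separate the signs. Up to an additive constant P is a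
Weierstrass function, and (P - u)(Q - v) is a nonzero constant κ; hence y = φ - κ/φ + r with φ = P -
u (`IsSol.exists_isW_of_two_types`). Substitution into the equation fixes all constants
(`IsSol.two_types`). The outcome `IsTwo`, y = v - σ/(2v) with v = p + b, is the common normal form
of families 3 and 4.

For existence, the Weierstrass equation is solved near 0, continued to the plane by the duplication
formula, and identified through its pole set, a discrete subgroup of rank 0, 1 or 2
(`exists_isWeierstrassP`). The even form is `IsTwo` translated by a half period, the odd form is
`IsTwo` translated by a point whose double is the half period with value -b. Finally m = v + σ/(2v)
satisfies m² = y² + 2σ and is rational in y and y', hence so is v. This gives both the description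
by `F₄` and the birational map from `F₄ = 0` to a cubic. -/

theorem eventually_codiscrete_iff {p : ℂ → Prop} :
    (∀ᶠ z in codiscrete ℂ, p z) ↔ ∀ z, ∀ᶠ w in 𝓝[≠] z, p w := by
  rw [Filter.Eventually, mem_codiscrete]
  refine forall_congr' fun z => ?_
  rw [disjoint_principal_right, compl_compl]; rfl

/-- Codiscrete sets are open. This is what allows identities along `codiscrete ℂ` to be
differentiated. -/
theorem eventually_nhds_of_codiscrete {p : ℂ → Prop} (h : ∀ᶠ z in codiscrete ℂ, p z) :
    ∀ᶠ z in codiscrete ℂ, ∀ᶠ w in 𝓝 z, p w := by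
  rw [Filter.Eventually, mem_codiscrete'] at h
  rw [Filter.Eventually, mem_codiscrete']
  have : {z | ∀ᶠ w in 𝓝 z, p w} = {z | p z} := by
    ext z
    exact ⟨fun h' => h'.self_of_nhds, fun h' => h.1.mem_nhds h'⟩
  rw [this]; exact h

theorem eventually_nhdsNE_of_codiscrete {p : ℂ → Prop} (h : ∀ᶠ z in codiscrete ℂ, p z) (z : ℂ) :
    ∀ᶠ w in 𝓝[≠] z, p w := eventually_codiscrete_iff.1 h z

instance : (codiscrete ℂ).NeBot := by
  rw [← frequently_true_iff_neBot]
  intro h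
  have := (eventually_nhdsNE_of_codiscrete h 0).exists
  simp at this

theorem eventually_add_right {p : ℂ → Prop} (h : ∀ᶠ z in codiscrete ℂ, p z) (a : ℂ) :
    ∀ᶠ z in codiscrete ℂ, p (z + a) := by
  rw [eventually_codiscrete_iff] at h ⊢
  intro z
  have h1 : Tendsto (fun w => w + a) (𝓝[≠] z) (𝓝[≠] (z + a)) := by
    refine tendsto_nhdsWithin_of_tendsto_nhds_of_eventually_within _ ?_ ?_
    · exact ((continuous_id.add continuous_const).tendsto z).mono_left nhdsWithin_le_nhds
    · filter_upwards [self_mem_nhdsWithin] with w hw using by simpa using hw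
  exact h1.eventually (h (z + a))

theorem eventually_sub_left {p : ℂ → Prop} (h : ∀ᶠ z in codiscrete ℂ, p z) (a : ℂ) :
    ∀ᶠ z in codiscrete ℂ, p (a - z) := by
  rw [eventually_codiscrete_iff] at h ⊢
  intro z
  have h1 : Tendsto (fun w => a - w) (𝓝[≠] z) (𝓝[≠] (a - z)) := by
    refine tendsto_nhdsWithin_of_tendsto_nhds_of_eventually_within _ ?_ ?_
    · exact ((continuous_const.sub continuous_id).tendsto z).mono_left nhdsWithin_le_nhds
    · filter_upwards [self_mem_nhdsWithin] with w hw using by simpa using hw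
  exact h1.eventually (h (a - z))

theorem eventually_codiscrete_analyticAt {f : ℂ → ℂ} (hf : Meromorphic f) :
    ∀ᶠ z in codiscrete ℂ, AnalyticAt ℂ f z :=
  eventually_codiscrete_iff.2 fun z => (hf z).eventually_analyticAt

theorem deriv_congr_codiscrete {f g : ℂ → ℂ} (h : f =ᶠ[codiscrete ℂ] g) :
    deriv f =ᶠ[codiscrete ℂ] deriv g := by
  filter_upwards [eventually_nhds_of_codiscrete h] with z hz
  exact EventuallyEq.deriv_eq hz

/-- The identity theorem: infinite order at one point propagates over the connected plane. -/
theorem eventually_eq_zero_of_frequently {f : ℂ → ℂ} (hf : Meromorphic f) {p : ℂ}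
    (h : ∃ᶠ z in 𝓝[≠] p, f z = 0) : f =ᶠ[codiscrete ℂ] fun _ => 0 := by
  refine eventually_codiscrete_iff.2 fun z => ?_
  have h1 : meromorphicOrderAt f p = ⊤ := by
    rw [meromorphicOrderAt_eq_top_iff]
    rcases (hf p).eventually_eq_zero_or_eventually_ne_zero with h' | h'
    · exact h'
    · exact absurd h' h
  by_contra h2
  have h3 : meromorphicOrderAt f z ≠ ⊤ := by rwa [Ne, meromorphicOrderAt_eq_top_iff]
  exact (hf.meromorphicOn (s := Set.univ)).meromorphicOrderAt_ne_top_of_isPreconnected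
    isPreconnected_univ (Set.mem_univ z) (Set.mem_univ p) h3 h1

theorem eq_of_eventually_nhdsNE {f g : ℂ → ℂ} (hf : Meromorphic f) (hg : Meromorphic g) {p : ℂ}
    (h : f =ᶠ[𝓝[≠] p] g) : f =ᶠ[codiscrete ℂ] g := by
  have := eventually_eq_zero_of_frequently (hf.sub hg) (p := p)
    (Eventually.frequently (by filter_upwards [h] with z hz; simp [hz]))
  filter_upwards [this] with z hz
  exact sub_eq_zero.1 hz

theorem eventually_ne_of_not_eq {f : ℂ → ℂ} (hf : Meromorphic f) {a : ℂ}
    (h : ¬ f =ᶠ[codiscrete ℂ] fun _ => a) : ∀ᶠ z in codiscrete ℂ, f z ≠ a := by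
  refine eventually_codiscrete_iff.2 fun z => ?_
  have hg : Meromorphic (fun z => f z - a) := hf.sub (.const a)
  rcases (hg z).eventually_eq_zero_or_eventually_ne_zero with h' | h'
  · refine absurd ?_ h
    have := eventually_eq_zero_of_frequently hg h'.frequently
    filter_upwards [this] with w hw using sub_eq_zero.1 hw
  · filter_upwards [h'] with w hw using sub_ne_zero.1 hw

theorem eventually_ne_of_not_isConstant {f : ℂ → ℂ} (hf : Meromorphic f) (h : ¬ IsConstant f)
    (a : ℂ) : ∀ᶠ z in codiscrete ℂ, f z ≠ a :=
  eventually_ne_of_not_eq hf fun h' => h ⟨a, h'⟩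

theorem isConstant_of_deriv {f : ℂ → ℂ} (hf : Meromorphic f)
    (h : deriv f =ᶠ[codiscrete ℂ] fun _ => 0) : IsConstant f := by
  obtain ⟨z, hz1, hz2⟩ := ((eventually_codiscrete_analyticAt hf).and
    (eventually_nhds_of_codiscrete h)).exists
  refine ⟨f z, eq_of_eventually_nhdsNE hf (.const _) (p := z) ?_⟩
  obtain ⟨r, hr, hball⟩ := Metric.eventually_nhds_iff_ball.1
    (hz2.and hz1.eventually_analyticAt)
  have hev : ∀ᶠ w in 𝓝 z, w ∈ Metric.ball z r := Metric.ball_mem_nhds z hr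
  filter_upwards [nhdsWithin_le_nhds hev] with w hw
  refine (convex_ball z r).is_const_of_fderivWithin_eq_zero (𝕜 := ℂ) (f := f) ?_ ?_ hw
    (Metric.mem_ball_self hr)
  · exact fun x hx => (hball x hx).2.differentiableAt.differentiableWithinAt
  · intro x hx
    rw [fderivWithin_of_isOpen Metric.isOpen_ball hx]
    have := (hball x hx).1
    ext
    simpa using this

theorem IsConstant.congr {f g : ℂ → ℂ} (h : IsConstant f) (hfg : f =ᶠ[codiscrete ℂ] g) :
    IsConstant g := by
  obtain ⟨a, ha⟩ := h
  exact ⟨a, hfg.symm.trans ha⟩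

/-- A nonconstant meromorphic function avoids the finitely many roots of a nonzero polynomial off a
discrete set. This licenses every comparison of coefficients below. -/
theorem eq_zero_of_eventually_eval {f : ℂ → ℂ} (hf : Meromorphic f) (h : ¬ IsConstant f)
    {P : ℂ[X]} (hP : ∀ᶠ z in codiscrete ℂ, P.eval (f z) = 0) : P = 0 := by
  by_contra h0
  have : ∀ᶠ z in codiscrete ℂ, ∀ a ∈ P.roots.toFinset, f z ≠ a := by
    rw [Filter.eventually_all_finset]
    exact fun a _ => eventually_ne_of_not_isConstant hf h a
  obtain ⟨z, h1, h2⟩ := (this.and hP).exists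
  exact h1 (f z) (by simp [h0, h2]) rfl

/-! ### Leading coefficients -/

/-- `f(z) = (z - p)ⁿ (a + O(z - p))` near `p`, with an analytic second factor. -/
def Lead (f : ℂ → ℂ) (p : ℂ) (n : ℤ) (a : ℂ) : Prop :=
  ∃ g : ℂ → ℂ, AnalyticAt ℂ g p ∧ g p = a ∧ ∀ᶠ z in 𝓝[≠] p, f z = (z - p) ^ n * g z

namespace Lead

variable {f g : ℂ → ℂ} {p : ℂ} {m n : ℤ} {a b : ℂ}

theorem congr (h : Lead f p n a) (hfg : f =ᶠ[𝓝[≠] p] g) : Lead g p n a := by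
  obtain ⟨k, h1, h2, h3⟩ := h
  exact ⟨k, h1, h2, by filter_upwards [h3, hfg] with z hz hz' using hz' ▸ hz⟩

theorem cast (h : Lead f p n a) (hn : n = m) (ha : a = b) : Lead f p m b := hn ▸ ha ▸ h

theorem of_analyticAt (h : AnalyticAt ℂ f p) : Lead f p 0 (f p) :=
  ⟨f, h, rfl, by simp⟩

theorem const (a p : ℂ) : Lead (fun _ => a) p 0 a := of_analyticAt analyticAt_const

theorem zpow (p : ℂ) (n : ℤ) : Lead (fun z => (z - p) ^ n) p n 1 :=
  ⟨fun _ => 1, analyticAt_const, rfl, by simp⟩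

theorem add (hf : Lead f p n a) (hg : Lead g p n b) : Lead (fun z => f z + g z) p n (a + b) := by
  obtain ⟨k, h1, h2, h3⟩ := hf
  obtain ⟨l, h4, h5, h6⟩ := hg
  refine ⟨fun z => k z + l z, h1.add h4, by simp [h2, h5], ?_⟩
  filter_upwards [h3, h6] with z hz hz'
  rw [hz, hz']; ring

theorem const_mul (c : ℂ) (hf : Lead f p n a) : Lead (fun z => c * f z) p n (c * a) := by
  obtain ⟨k, h1, h2, h3⟩ := hf
  refine ⟨fun z => c * k z, analyticAt_const.mul h1, by simp [h2], ?_⟩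
  filter_upwards [h3] with z hz
  rw [hz]; ring

theorem neg (hf : Lead f p n a) : Lead (fun z => -f z) p n (-a) := by
  simpa using hf.const_mul (-1)

theorem sub (hf : Lead f p n a) (hg : Lead g p n b) : Lead (fun z => f z - g z) p n (a - b) := by
  simpa [sub_eq_add_neg] using hf.add hg.neg

theorem mul (hf : Lead f p m a) (hg : Lead g p n b) :
    Lead (fun z => f z * g z) p (m + n) (a * b) := by
  obtain ⟨k, h1, h2, h3⟩ := hf
  obtain ⟨l, h4, h5, h6⟩ := hg
  refine ⟨fun z => k z * l z, h1.mul h4, by simp [h2, h5], ?_⟩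
  filter_upwards [h3, h6, self_mem_nhdsWithin] with z hz hz' h0
  rw [hz, hz', zpow_add₀ (sub_ne_zero.2 h0)]; ring

theorem pow (hf : Lead f p n a) (k : ℕ) : Lead (fun z => f z ^ k) p (k * n) (a ^ k) := by
  induction k with
  | zero => simpa using const 1 p
  | succ k ih =>
    refine ((ih.mul hf).cast (by push_cast; ring) (by ring)).congr (Eventually.of_forall ?_)
    intro z; simp [pow_succ]

theorem inv (hf : Lead f p n a) (ha : a ≠ 0) : Lead (fun z => (f z)⁻¹) p (-n) a⁻¹ := by
  obtain ⟨k, h1, h2, h3⟩ := hf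
  refine ⟨fun z => (k z)⁻¹, h1.fun_inv (h2 ▸ ha), by simp [h2], ?_⟩
  filter_upwards [h3] with z hz
  rw [hz, mul_inv, zpow_neg]

theorem deriv (hf : Lead f p n a) : Lead (deriv f) p (n - 1) (n * a) := by
  obtain ⟨k, h1, h2, h3⟩ := hf
  refine ⟨fun z => n * k z + (z - p) * _root_.deriv k z, ?_, by simp [h2], ?_⟩
  · exact (analyticAt_const.mul h1).add ((analyticAt_id.sub analyticAt_const).mul h1.deriv)
  · have h4 : ∀ᶠ z in 𝓝[≠] p, ∀ᶠ w in 𝓝 z, f w = (w - p) ^ n * k w := by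
      have := eventually_eventually_nhdsWithin.2 h3
      filter_upwards [this, self_mem_nhdsWithin] with z hz h0
      rwa [(isOpen_compl_singleton (x := p)).nhdsWithin_eq h0] at hz
    filter_upwards [h4, self_mem_nhdsWithin,
      nhdsWithin_le_nhds h1.eventually_analyticAt] with z hz h0 h5
    have h0' : z - p ≠ 0 := sub_ne_zero.2 h0
    rw [EventuallyEq.deriv_eq hz]
    have hd : HasDerivAt (fun w => (w - p) ^ n) (n * (z - p) ^ (n - 1) * 1) z :=
      HasDerivAt.comp (h₂ := fun x => x ^ n) (h := fun w => w - p) z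
        (hasDerivAt_zpow n (z - p) (Or.inl h0')) ((hasDerivAt_id' z).sub_const p)
    rw [(hd.fun_mul h5.differentiableAt.hasDerivAt).deriv]
    have : (z - p) ^ n = (z - p) ^ (n - 1) * (z - p) := by
      rw [← zpow_add_one₀ h0']; simp
    rw [this]; ring

/-- A zero coefficient is allowed in `Lead`, so `Lead f p m 0` serves as the bound `f = O((z -
p)^(m+1))`. Lower-order contributions to a sum are discarded in this way. -/
theorem weaken (hf : Lead f p n a) (h : m < n) : Lead f p m 0 := by
  obtain ⟨k, h1, h2, h3⟩ := hf
  obtain ⟨j, rfl⟩ : ∃ j : ℕ, n = m + j + 1 := ⟨(n - m - 1).toNat, by omega⟩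
  refine ⟨fun z => (z - p) ^ (j + 1) * k z,
    ((analyticAt_id.sub analyticAt_const).pow _).mul h1, by simp, ?_⟩
  filter_upwards [h3, self_mem_nhdsWithin] with z hz h0
  have h0' : z - p ≠ 0 := sub_ne_zero.2 h0
  rw [hz, ← mul_assoc]
  congr 1
  rw [add_assoc, zpow_add₀ h0']
  norm_cast

/-- The analytic factor vanishes at `p`, and its difference quotient `dslope` is again analytic. -/
theorem lift (hf : Lead f p n 0) : ∃ a, Lead f p (n + 1) a := by
  obtain ⟨k, h1, h2, h3⟩ := hf
  have h4 : AnalyticAt ℂ (dslope k p) p := by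
    obtain ⟨q, hq⟩ := h1
    exact ⟨q.fslope, hq.has_fpower_series_dslope_fslope⟩
  refine ⟨dslope k p p, dslope k p, h4, rfl, ?_⟩
  filter_upwards [h3, self_mem_nhdsWithin] with z hz h0
  have h0' : z - p ≠ 0 := sub_ne_zero.2 h0
  rw [hz, dslope_of_ne _ h0, slope_def_field, h2, zpow_add_one₀ h0']
  field_simp
  ring

theorem unique (hf : Lead f p n a) (hg : Lead f p n b) : a = b := by
  obtain ⟨k, h1, h2, h3⟩ := hf
  obtain ⟨l, h4, h5, h6⟩ := hg
  have : k =ᶠ[𝓝[≠] p] l := by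
    filter_upwards [h3, h6, self_mem_nhdsWithin] with z hz hz' h0
    have h0' : z - p ≠ 0 := sub_ne_zero.2 h0
    exact mul_left_cancel₀ (zpow_ne_zero n h0') (hz ▸ hz')
  have := (h1.continuousAt.eventuallyEq_nhds_iff_eventuallyEq_nhdsNE h4.continuousAt).1 this
  rw [← h2, ← h5]; exact this.self_of_nhds

theorem eq_zero_of_eventually (hf : Lead f p n a) (h : ∀ᶠ z in 𝓝[≠] p, f z = 0) : a = 0 := by
  refine hf.unique ?_
  exact ⟨fun _ => 0, analyticAt_const, rfl, by simpa using h⟩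

theorem exists_of_meromorphicAt (hf : MeromorphicAt f p) :
    (∀ᶠ z in 𝓝[≠] p, f z = 0) ∨ ∃ n a, a ≠ 0 ∧ Lead f p n a := by
  rcases eq_or_ne (meromorphicOrderAt f p) ⊤ with h | h
  · exact Or.inl (meromorphicOrderAt_eq_top_iff.1 h)
  · right
    obtain ⟨g, h1, h2, h3⟩ := (meromorphicOrderAt_ne_top_iff hf).1 h
    exact ⟨_, g p, h2, g, h1, rfl, h3⟩

theorem meromorphicAt (hf : Lead f p n a) : MeromorphicAt f p := by
  obtain ⟨g, h1, h2, h3⟩ := hf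
  exact MeromorphicAt.iff_eventuallyEq_zpow_smul_analyticAt.2 ⟨n, g, h1, by simpa using h3⟩

theorem order_eq (hf : Lead f p n a) (ha : a ≠ 0) : meromorphicOrderAt f p = n := by
  rw [meromorphicOrderAt_eq_int_iff hf.meromorphicAt]
  obtain ⟨g, h1, h2, h3⟩ := hf
  exact ⟨g, h1, h2 ▸ ha, by simpa using h3⟩

theorem order_nonneg (hf : Lead f p 0 a) : 0 ≤ meromorphicOrderAt f p := by
  obtain ⟨g, h1, h2, h3⟩ := hf
  rw [meromorphicOrderAt_congr (f₂ := g) (by filter_upwards [h3] with z hz; simpa using hz)]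
  exact h1.meromorphicOrderAt_nonneg

theorem comp_add (hf : Lead f (p + b) n a) : Lead (fun z => f (z + b)) p n a := by
  obtain ⟨g, h1, h2, h3⟩ := hf
  refine ⟨fun z => g (z + b), ?_, h2, ?_⟩
  · exact AnalyticAt.fun_comp (g := g) h1 (analyticAt_id.add analyticAt_const)
  · have h1 : Tendsto (fun w => w + b) (𝓝[≠] p) (𝓝[≠] (p + b)) := by
      refine tendsto_nhdsWithin_of_tendsto_nhds_of_eventually_within _ ?_ ?_
      · exact ((continuous_id.add continuous_const).tendsto p).mono_left nhdsWithin_le_nhds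
      · filter_upwards [self_mem_nhdsWithin] with w hw using by simpa using hw
    filter_upwards [h1.eventually h3] with z hz
    rw [hz]; ring_nf

theorem comp_sub_left (hf : Lead f (b - p) n a) :
    Lead (fun z => f (b - z)) p n ((-1) ^ n * a) := by
  obtain ⟨g, h1, h2, h3⟩ := hf
  refine ⟨fun z => (-1) ^ n * g (b - z), ?_, by simp [h2], ?_⟩
  · exact analyticAt_const.mul
      (AnalyticAt.fun_comp (g := g) h1 (analyticAt_const.sub analyticAt_id))
  · have h1 : Tendsto (fun w => b - w) (𝓝[≠] p) (𝓝[≠] (b - p)) := by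
      refine tendsto_nhdsWithin_of_tendsto_nhds_of_eventually_within _ ?_ ?_
      · exact ((continuous_const.sub continuous_id).tendsto p).mono_left nhdsWithin_le_nhds
      · filter_upwards [self_mem_nhdsWithin] with w hw using by simpa using hw
    filter_upwards [h1.eventually h3] with z hz
    rw [hz, show b - z - (b - p) = (-1) * (z - p) by ring, mul_zpow]; ring

/-- Reflection in `p` multiplies the coefficient of an odd power by -1, while evenness preserves it.
-/
theorem eq_zero_of_even (hf : Lead f p n a) (hn : Odd n)
    (he : ∀ᶠ z in 𝓝[≠] p, f (2 * p - z) = f z) : a = 0 := by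
  have h1 : Lead (fun z => f (2 * p - z)) p n ((-1) ^ n * a) :=
    comp_sub_left (by rwa [show 2 * p - p = p by ring])
  have h2 := (h1.congr he).unique hf
  rw [hn.neg_one_zpow] at h2
  linear_combination -(1 / 2) * h2

end Lead

/-! ### The normalised third order equation -/

/-- The right-hand side of the equation for `y = (u - s₁) / c`. -/
def swift (b S T : ℂ) (y : ℂ → ℂ) (z : ℂ) : ℂ :=
  deriv y z * deriv (deriv (deriv y)) z - deriv (deriv y) z ^ 2 / 2 + 30 * b * deriv y z ^ 2
    - 30 * (y z ^ 4 + 6 * S * y z ^ 2 - 4 * T * y z)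

/-- `y` is meromorphic and solves the normalised equation. -/
structure IsSol (k b S T : ℂ) (y : ℂ → ℂ) : Prop where
  mero : Meromorphic y
  ode : ∀ᶠ z in codiscrete ℂ, swift b S T y z = k

/-- All values are those of the normal form. -/
def IsNF (y : ℂ → ℂ) : Prop := ∀ z, MeromorphicNFAt y z

/-- Values in normal form are determined by the punctured germ. Periodicity and evenness can then be
stated pointwise, and failure of analyticity means a genuine pole. -/
theorem IsNF.eq {f g : ℂ → ℂ} (hf : IsNF f) (hg : IsNF g) (h : f =ᶠ[codiscrete ℂ] g) : f = g := by
  ext z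
  exact (((hf z).eventuallyEq_nhdsNE_iff_eventuallyEq_nhds (hg z)).1
    (eventually_nhdsNE_of_codiscrete h z)).self_of_nhds

theorem exists_isNF {f : ℂ → ℂ} (hf : Meromorphic f) : ∃ g, IsNF g ∧ f =ᶠ[codiscrete ℂ] g := by
  refine ⟨toMeromorphicNFOn f Set.univ, fun z => ?_, ?_⟩
  · exact meromorphicNFOn_toMeromorphicNFOn f Set.univ (Set.mem_univ z)
  · exact eventually_codiscrete_iff.2 fun z =>
      (hf.meromorphicOn.toMeromorphicNFOn_eq_self_on_nhdsNE (Set.mem_univ z)).symm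

theorem IsNF.comp_add {f : ℂ → ℂ} (hf : IsNF f) (a : ℂ) : IsNF fun z => f (z + a) := by
  intro z
  exact MeromorphicNFAt.comp_analyticAt (f := f) (g := fun z => z + a) (hf (z + a))
    (analyticAt_id.add analyticAt_const)

theorem IsNF.comp_sub_left {f : ℂ → ℂ} (hf : IsNF f) (a : ℂ) : IsNF fun z => f (a - z) := by
  intro z
  exact MeromorphicNFAt.comp_analyticAt (f := f) (g := fun z => a - z) (hf (a - z))
    (analyticAt_const.sub analyticAt_id)

theorem swift_congr {b S T : ℂ} {f g : ℂ → ℂ} {z : ℂ} (h : f =ᶠ[𝓝 z] g) :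
    swift b S T f z = swift b S T g z := by
  unfold swift
  rw [h.deriv.deriv.deriv_eq, h.deriv.deriv_eq, h.deriv_eq, h.eq_of_nhds]

theorem Meromorphic.comp_add {f : ℂ → ℂ} (hf : Meromorphic f) (a : ℂ) :
    Meromorphic fun z => f (z + a) := by simpa using hf

theorem Meromorphic.comp_sub_left {f : ℂ → ℂ} (hf : Meromorphic f) (a : ℂ) :
    Meromorphic fun z => f (a - z) := fun z =>
  MeromorphicAt.comp_analyticAt (f := f) (g := fun z => a - z) (hf (a - z))
    (analyticAt_const.sub analyticAt_id)

theorem deriv_fun_comp_add (f : ℂ → ℂ) (a : ℂ) :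
    deriv (fun z => f (z + a)) = fun z => deriv f (z + a) := by
  ext z; exact deriv_comp_add_const f a z

theorem deriv_fun_comp_sub_left (f : ℂ → ℂ) (a : ℂ) :
    deriv (fun z => f (a - z)) = fun z => -deriv f (a - z) := by
  ext z; exact deriv_comp_const_sub f a z

theorem deriv_fun_neg (f : ℂ → ℂ) : deriv (fun z => -f z) = fun z => -deriv f z := by
  ext z; exact deriv.fun_neg

namespace IsSol

variable {k b S T : ℂ} {y : ℂ → ℂ}

theorem congr (h : IsSol k b S T y) {w : ℂ → ℂ} (hw : y =ᶠ[codiscrete ℂ] w) :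
    IsSol k b S T w := by
  refine ⟨h.mero.congr_codiscrete hw, ?_⟩
  filter_upwards [h.ode, eventually_nhds_of_codiscrete hw] with z h1 h2
  rw [← swift_congr h2, h1]

theorem comp_add (h : IsSol k b S T y) (a : ℂ) : IsSol k b S T fun z => y (z + a) := by
  refine ⟨Meromorphic.comp_add h.mero a, ?_⟩
  filter_upwards [eventually_add_right h.ode a] with z hz
  rw [← hz]
  simp only [swift, deriv_fun_comp_add]

theorem comp_sub_left (h : IsSol k b S T y) (a : ℂ) : IsSol k b S T fun z => y (a - z) := by
  refine ⟨Meromorphic.comp_sub_left h.mero a, ?_⟩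
  filter_upwards [eventually_sub_left h.ode a] with z hz
  rw [← hz]
  simp only [swift, deriv_fun_comp_sub_left, deriv_fun_neg]
  ring

theorem neg (h : IsSol k b S T y) : IsSol k b S (-T) fun z => -y z := by
  refine ⟨h.mero.neg, ?_⟩
  filter_upwards [h.ode] with z hz
  rw [← hz]
  simp only [swift, deriv_fun_neg]
  ring

theorem ode_at (h : IsSol k b S T y) {z : ℂ} (hz : AnalyticAt ℂ y z) : swift b S T y z = k := by
  have h1 : AnalyticAt ℂ (swift b S T y) z := by
    have h1 := hz.deriv
    have h2 := h1.deriv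
    have h3 := h2.deriv
    unfold swift
    fun_prop
  have h2 : swift b S T y =ᶠ[𝓝[≠] z] fun _ => k := eventually_nhdsNE_of_codiscrete h.ode z
  exact ((h1.continuousAt.eventuallyEq_nhds_iff_eventuallyEq_nhdsNE
    continuousAt_const).1 h2).self_of_nhds

end IsSol

/-! ### A bound away from the poles -/

/-- Under A s² ≤ 4M and 1 ≤ A ≤ M each term on the right of `hn` is at most a constant times M⁴/A.
The number A is the sum of these constants, so the right side is at most M⁴, which is less than
30M⁴. -/
theorem quartic_estimate {M s A B D E F d1 d2 d3 : ℝ} (hM1 : 1 ≤ M) (hs : 0 < s)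
    (hA1 : 1 ≤ A) (hAM : A ≤ M) (hsM : A * s ^ 2 ≤ 4 * M)
    (hB : 0 ≤ B) (hD : 0 ≤ D) (hE : 0 ≤ E) (hF : 0 ≤ F)
    (hA : A = 2048 + 1920 * B + 180 * D + 120 * E + F)
    (p1 : 0 ≤ d1) (p2 : 0 ≤ d2) (p3 : 0 ≤ d3)
    (e1 : d1 ≤ 4 * M * s) (e2 : d2 ≤ 8 * M * s ^ 2) (e3 : d3 ≤ 24 * M * s ^ 3)
    (hn : 30 * M ^ 4 ≤ d1 * d3 + d2 ^ 2 / 2 + 30 * B * d1 ^ 2 + 180 * D * M ^ 2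
      + 120 * E * M + F) : False := by
  have hApos : 0 < A := by linarith
  have hM0 : 0 < M := by linarith
  have f1 : d1 * d3 ≤ 96 * (M ^ 2 * s ^ 4) := by
    calc d1 * d3 ≤ (4 * M * s) * (24 * M * s ^ 3) := by gcongr
      _ = _ := by ring
  have f2 : d2 ^ 2 / 2 ≤ 32 * (M ^ 2 * s ^ 4) := by
    calc d2 ^ 2 / 2 ≤ (8 * M * s ^ 2) ^ 2 / 2 := by gcongr
      _ = _ := by ring
  have f3 : d1 ^ 2 ≤ 16 * (M ^ 2 * s ^ 2) := by
    calc d1 ^ 2 ≤ (4 * M * s) ^ 2 := by gcongr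
      _ = _ := by ring
  have g1 : A * (M ^ 2 * s ^ 4) ≤ 16 * M ^ 4 := by
    have h1 : (A * s ^ 2) ^ 2 ≤ (4 * M) ^ 2 := by gcongr
    have h2 : A * s ^ 4 ≤ A ^ 2 * s ^ 4 := by
      have : A ≤ A ^ 2 := by nlinarith
      gcongr
    have h3 : A * s ^ 4 ≤ 16 * M ^ 2 := by nlinarith
    calc A * (M ^ 2 * s ^ 4) = M ^ 2 * (A * s ^ 4) := by ring
      _ ≤ M ^ 2 * (16 * M ^ 2) := by gcongr
      _ = _ := by ring
  have g2 : A * (M ^ 2 * s ^ 2) ≤ 4 * M ^ 4 := by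
    calc A * (M ^ 2 * s ^ 2) = M ^ 2 * (A * s ^ 2) := by ring
      _ ≤ M ^ 2 * (4 * M) := by gcongr
      _ = 4 * M ^ 3 * 1 := by ring
      _ ≤ 4 * M ^ 3 * M := by gcongr
      _ = _ := by ring
  have g3 : A * M ^ 2 ≤ M ^ 4 := by
    calc A * M ^ 2 ≤ M * M ^ 2 := by gcongr
      _ = M ^ 3 * 1 := by ring
      _ ≤ M ^ 3 * M := by gcongr
      _ = _ := by ring
  have g4 : A * M ≤ M ^ 4 := by
    calc A * M = A * M * 1 := by ring
      _ ≤ A * M * M := by gcongr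
      _ = A * M ^ 2 := by ring
      _ ≤ _ := g3
  have g5 : A ≤ M ^ 4 := by
    calc A = A * 1 := by ring
      _ ≤ A * M := by gcongr
      _ ≤ _ := g4
  have hM4 : 0 < M ^ 4 := by positivity
  have hfin : A * (30 * M ^ 4) ≤ A * M ^ 4 := by
    calc A * (30 * M ^ 4) ≤ A * (96 * (M ^ 2 * s ^ 4) + 32 * (M ^ 2 * s ^ 4)
          + 30 * B * (16 * (M ^ 2 * s ^ 2)) + 180 * D * M ^ 2 + 120 * E * M + F) := by
          refine mul_le_mul_of_nonneg_left (hn.trans ?_) hApos.le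
          gcongr
      _ = 128 * (A * (M ^ 2 * s ^ 4)) + 480 * B * (A * (M ^ 2 * s ^ 2))
          + 180 * D * (A * M ^ 2) + 120 * E * (A * M) + F * A := by ring
      _ ≤ 128 * (16 * M ^ 4) + 480 * B * (4 * M ^ 4)
          + 180 * D * M ^ 4 + 120 * E * M ^ 4 + F * M ^ 4 := by gcongr
      _ = A * M ^ 4 := by rw [hA]; ring
  have : 0 < A * M ^ 4 := by positivity
  linarith

/-- A quantitative rescaling argument: at a maximum of |y| weighted by the squared distance to the
boundary, Cauchy's estimates make every term of the equation except 30y⁴ too small if the weighted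
maximum exceeds A. The exponent 2 matches the order of the poles. -/
theorem norm_le_of_swift {k b S T : ℂ} :
    ∃ A : ℝ, 0 < A ∧ ∀ (y : ℂ → ℂ) (z₀ : ℂ) (R : ℝ), 0 < R → R ≤ 1 →
      AnalyticOnNhd ℂ y (Metric.closedBall z₀ R) →
      (∀ z ∈ Metric.closedBall z₀ R, swift b S T y z = k) → ‖y z₀‖ * R ^ 2 ≤ A := by
  set A : ℝ := 2048 + 1920 * ‖b‖ + 180 * ‖S‖ + 120 * ‖T‖ + ‖k‖ with hA
  have hA1 : (2048 : ℝ) ≤ A := by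
    have := norm_nonneg b; have := norm_nonneg S; have := norm_nonneg T; have := norm_nonneg k
    linarith
  refine ⟨A, by linarith, fun y z₀ R hR hR1 hy hode => ?_⟩
  by_contra! hlt
  have hcont : ContinuousOn (fun z => ‖y z‖ * (R - ‖z - z₀‖) ^ 2) (Metric.closedBall z₀ R) := by
    have := hy.continuousOn
    fun_prop
  obtain ⟨z₁, hz₁, hmax⟩ := (isCompact_closedBall z₀ R).exists_isMaxOn
    ⟨z₀, Metric.mem_closedBall_self hR.le⟩ hcont
  have h0 := hmax (Metric.mem_closedBall_self hR.le)
  simp only [sub_self, norm_zero, sub_zero, Set.mem_ofPred_eq] at h0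
  have hd : ‖z₁ - z₀‖ ≤ R := by simpa [dist_eq_norm] using hz₁
  set M : ℝ := ‖y z₁‖
  -- On the disc of radius ρ about `z₁` the distance to the outer boundary is at least ρ, against 2ρ
  -- at `z₁`. Maximality then gives |y| ≤ 4M there.
  set ρ : ℝ := (R - ‖z₁ - z₀‖) / 2 with hρ
  have h1 : A < 4 * M * ρ ^ 2 := by rw [hρ]; linarith
  have hM0 : 0 ≤ M := norm_nonneg _
  have hρ0 : 0 < ρ := by
    rcases lt_or_eq_of_le (show 0 ≤ ρ by rw [hρ]; linarith) with h | h
    · exact h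
    · rw [← h] at h1; norm_num at h1; linarith
  have hρ1 : ρ ≤ 1 / 2 := by
    rw [hρ]; have := norm_nonneg (z₁ - z₀); linarith
  have hsub : Metric.closedBall z₁ ρ ⊆ Metric.closedBall z₀ R := by
    intro z hz
    rw [Metric.mem_closedBall, dist_eq_norm] at hz ⊢
    calc ‖z - z₀‖ = ‖(z - z₁) + (z₁ - z₀)‖ := by ring_nf
      _ ≤ ‖z - z₁‖ + ‖z₁ - z₀‖ := norm_add_le _ _
      _ ≤ R := by rw [hρ] at hz; linarith
  have hbound : ∀ z ∈ Metric.sphere z₁ ρ, ‖y z‖ ≤ 4 * M := by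
    intro z hz
    have h2 := hmax (hsub (Metric.sphere_subset_closedBall hz))
    simp only [Set.mem_ofPred_eq] at h2
    have h3 : ‖z - z₀‖ ≤ ρ + ‖z₁ - z₀‖ := by
      calc ‖z - z₀‖ = ‖(z - z₁) + (z₁ - z₀)‖ := by ring_nf
        _ ≤ ‖z - z₁‖ + ‖z₁ - z₀‖ := norm_add_le _ _
        _ = _ := by rw [← dist_eq_norm, Metric.mem_sphere.1 hz]
    have h4 : ρ ≤ R - ‖z - z₀‖ := by rw [hρ] at h3 ⊢; linarith
    have h5 : ‖y z‖ * ρ ^ 2 ≤ ‖y z‖ * (R - ‖z - z₀‖) ^ 2 := by gcongr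
    have h6 : (R - ‖z₁ - z₀‖) = 2 * ρ := by rw [hρ]; ring
    rw [h6] at h2
    have : ‖y z‖ * ρ ^ 2 ≤ (4 * M) * ρ ^ 2 := by nlinarith
    exact le_of_mul_le_mul_right this (by positivity)
  have hdc : DiffContOnCl ℂ y (Metric.ball z₁ ρ) := by
    apply DifferentiableOn.diffContOnCl
    rw [closure_ball _ hρ0.ne']
    exact fun z hz => (hy z (hsub hz)).differentiableAt.differentiableWithinAt
  have e1 := Complex.norm_iteratedDeriv_le_of_forall_mem_sphere_norm_le 1 hρ0 hdc hbound
  have e2 := Complex.norm_iteratedDeriv_le_of_forall_mem_sphere_norm_le 2 hρ0 hdc hbound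
  have e3 := Complex.norm_iteratedDeriv_le_of_forall_mem_sphere_norm_le 3 hρ0 hdc hbound
  simp only [iteratedDeriv_succ, iteratedDeriv_zero, Nat.factorial] at e1 e2 e3
  norm_num at e1 e2 e3
  have key := hode z₁ hz₁
  unfold swift at key
  generalize deriv (deriv (deriv y)) z₁ = d3 at *
  generalize deriv (deriv y) z₁ = d2 at *
  generalize deriv y z₁ = d1 at *
  set s : ℝ := 1 / ρ with hs
  have hs0 : 0 < s := by positivity
  have e1' : ‖d1‖ ≤ 4 * M * s := by rw [hs]; convert e1 using 1; ring
  have e2' : ‖d2‖ ≤ 8 * M * s ^ 2 := by rw [hs]; convert e2 using 1; field_simp; ring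
  have e3' : ‖d3‖ ≤ 24 * M * s ^ 3 := by rw [hs]; convert e3 using 1; field_simp; ring
  have hsM : A * s ^ 2 ≤ 4 * M := by
    have : s ^ 2 * ρ ^ 2 = 1 := by rw [hs]; field_simp
    nlinarith [sq_nonneg s]
  -- Here R ≤ 1 enters: ρ ≤ 1/2 turns A s² ≤ 4M into A ≤ M.
  have hs2 : 2 ≤ s := by rw [hs, le_div_iff₀ hρ0]; linarith
  have hMA : A ≤ M := by
    have : A * 4 ≤ A * s ^ 2 := mul_le_mul_of_nonneg_left (by nlinarith) (by linarith)
    linarith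
  have hid : 30 * y z₁ ^ 4 = d1 * d3 - d2 ^ 2 / 2 + 30 * b * d1 ^ 2 - 180 * S * y z₁ ^ 2
      + 120 * T * y z₁ - k := by linear_combination -key
  have hn : 30 * M ^ 4 ≤ ‖d1‖ * ‖d3‖ + ‖d2‖ ^ 2 / 2 + 30 * ‖b‖ * ‖d1‖ ^ 2 + 180 * ‖S‖ * M ^ 2
      + 120 * ‖T‖ * M + ‖k‖ := by
    have h1 : 30 * M ^ 4 = ‖30 * y z₁ ^ 4‖ := by rw [norm_mul, norm_pow]; norm_num [M]
    rw [h1, hid]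
    refine (norm_sub_le _ _).trans (add_le_add ?_ le_rfl)
    refine (norm_add_le _ _).trans (add_le_add ?_ (by rw [norm_mul, norm_mul]; norm_num [M]))
    refine (norm_sub_le _ _).trans (add_le_add ?_
      (by rw [norm_mul, norm_mul, norm_pow]; norm_num [M]))
    refine (norm_add_le _ _).trans (add_le_add ?_ (by rw [norm_mul, norm_mul, norm_pow]; norm_num))
    refine (norm_sub_le _ _).trans (add_le_add (by rw [norm_mul])
      (by rw [norm_div, norm_pow]; norm_num))
  exact quartic_estimate (by linarith) hs0 (by linarith) hMA hsM (norm_nonneg b) (norm_nonneg S)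
    (norm_nonneg T) (norm_nonneg k) hA (norm_nonneg _) (norm_nonneg _) (norm_nonneg _) e1' e2' e3' hn

/-! ### Poles -/

/-- The terms y'y''' - y''²/2 have order 2n - 4 and y⁴ has order 4n. They balance only for n = -2,
where 30a² = 30a⁴. For n < -2 the quartic term stands alone; for n = -1 the derivative terms stand
alone with coefficient 4a². -/
theorem IsSol.lead_pole {k b S T : ℂ} {y : ℂ → ℂ} (h : IsSol k b S T y) {p : ℂ} {n : ℤ} {a : ℂ}
    (hL : Lead y p n a) (ha : a ≠ 0) (hn : n < 0) : n = -2 ∧ (a = 1 ∨ a = -1) := by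
  have h1 := hL.deriv
  have h2 := h1.deriv
  have h3 := h2.deriv
  have hE := ((h1.mul h3).cast (m := 2 * n - 4) (by ring) rfl).sub
    (((h2.pow 2).const_mul (1 / 2)).cast (m := 2 * n - 4) (by push_cast; ring) rfl)
  have hD := (h1.pow 2).const_mul (30 * b)
  have hQ := (hL.pow 4).const_mul (-30)
  have hq := (hL.pow 2).const_mul (-180 * S)
  have hl := hL.const_mul (120 * T)
  have hk := Lead.const (-k) p
  push_cast at hE hD hQ hq
  -- All other terms have order above N, so the coefficients of order N of the two dominant groups
  -- must cancel.
  have hsum : ∀ (N : ℤ) (c₁ c₂ : ℂ), N ≤ -5 → N < 2 * (n - 1) → N < 2 * n → N < n →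
      Lead (fun z => deriv y z * deriv (deriv (deriv y)) z - 1 / 2 * deriv (deriv y) z ^ 2) p N c₁ →
      Lead (fun z => -30 * y z ^ 4) p N c₂ → c₁ + c₂ = 0 := by
    intro N c₁ c₂ hN hN1 hN2 hN3 t1 t2
    have := (((((t1.add t2).add (hD.weaken hN1)).add (hq.weaken hN2)).add (hl.weaken hN3)).add
      (hk.weaken (by omega : N < 0))).eq_zero_of_eventually ?_
    · simpa using this
    · filter_upwards [eventually_nhdsNE_of_codiscrete h.ode p] with z hz
      rw [← hz, swift]; ring
  rcases lt_trichotomy n (-2) with h' | h' | h'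
  · have := hsum (4 * n) 0 _ (by omega) (by omega) (by omega) (by omega)
      (hE.weaken (by omega)) hQ
    simp [ha] at this
  · refine ⟨h', ?_⟩
    subst h'
    have := hsum (-8) _ _ (by omega) (by omega) (by omega) (by omega)
      (hE.cast (by norm_num) rfl) (hQ.cast (by norm_num) rfl)
    norm_num at this
    have h5 : a ^ 2 * ((a - 1) * (a + 1)) = 0 := by linear_combination -(1 / 30) * this
    rcases mul_eq_zero.1 ((mul_eq_zero.1 h5).resolve_left (pow_ne_zero 2 ha)) with h6 | h6
    · exact Or.inl (sub_eq_zero.1 h6)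
    · exact Or.inr (eq_neg_of_add_eq_zero_left h6)
  · obtain rfl : n = -1 := by omega
    have := hsum (-6) _ _ (by omega) (by omega) (by omega) (by omega)
      (hE.cast (by norm_num) rfl) (hQ.weaken (by norm_num))
    norm_num at this
    have h5 : a ^ 2 = 0 := by linear_combination (1 / 4) * this
    exact absurd h5 (pow_ne_zero 2 ha)

/-- Each product is polarised into sums and differences, for instance 2(y'y''' - w'w''') = (y' +
w')d''' + d'(y''' + w''') with d = y - w. So the difference of the two equations is exactly a linear
expression in d, whose leading part at the pole is the indicial polynomial. -/
theorem lead_swift_sub {b S T : ℂ} {y w : ℂ → ℂ} {p ε a : ℂ} {m : ℤ}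
    (hy : Lead y p (-2) ε) (hw : Lead w p (-2) ε) (hε : ε ^ 2 = 1)
    (hd : Lead (fun z => y z - w z) p m a) :
    Lead (fun z => swift b S T y z - swift b S T w z) p (m - 6)
      (-2 * ε * (m ^ 3 + 11 * m + 60) * a) := by
  have key : ∀ {f g : ℂ → ℂ} {m : ℤ} {a : ℂ}, MeromorphicAt f p → MeromorphicAt g p →
      Lead (fun z => f z - g z) p m a →
      Lead (fun z => deriv f z - deriv g z) p (m - 1) (m * a) := by
    intro f g m a hf hg h
    refine h.deriv.congr ?_
    filter_upwards [hf.eventually_analyticAt, hg.eventually_analyticAt] with z h1 h2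
    exact deriv_fun_sub h1.differentiableAt h2.differentiableAt
  have hym := hy.meromorphicAt
  have hwm := hw.meromorphicAt
  have d1 := key hym hwm hd
  have d2 := key hym.deriv hwm.deriv d1
  have d3 := key hym.deriv.deriv hwm.deriv.deriv d2
  have s0 := hy.add hw
  have s1 := hy.deriv.add hw.deriv
  have s2 := hy.deriv.deriv.add hw.deriv.deriv
  have s3 := hy.deriv.deriv.deriv.add hw.deriv.deriv.deriv
  have q := (hy.pow 2).add (hw.pow 2)
  have t1 := (s1.mul d3).const_mul (1 / 2)
  have t2 := (d1.mul s3).const_mul (1 / 2)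
  have t3 := (s2.mul d2).const_mul (-1 / 2)
  have t4 := ((hd.mul s0).mul q).const_mul (-30)
  have t5 := (((s1.mul d1).const_mul (30 * b)).weaken (m := m - 6) (by omega))
  have t6 := (((s0.mul hd).const_mul (-180 * S)).weaken (m := m - 6) (by omega))
  have t7 := ((hd.const_mul (120 * T)).weaken (m := m - 6) (by omega))
  have hN : m - 6 = m - 6 := rfl
  have := ((((((t1.cast (m := m - 6) (by omega) rfl).add (t2.cast (m := m - 6) (by omega) rfl)).add
    (t3.cast (m := m - 6) (by omega) rfl)).add
    (t4.cast (m := m - 6) (by push_cast; omega) rfl)).add t5).add t6).add t7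
  refine (this.cast rfl ?_).congr (Eventually.of_forall fun z => ?_)
  · push_cast
    linear_combination (-120 * ε * a) * hε
  · simp only [swift]; ring

/-- A nonzero difference would start at an exponent m ≥ -1, where the indicial polynomial m³ + 11m +
60 does not vanish. -/
theorem eventuallyEq_of_lead {k b S T : ℂ} {y w : ℂ → ℂ} {p ε : ℂ}
    (h1 : IsSol k b S T y) (h2 : IsSol k b S T w)
    (hy : Lead y p (-2) ε) (hw : Lead w p (-2) ε) (hε : ε ^ 2 = 1) : y =ᶠ[𝓝[≠] p] w := by
  have hd := hy.sub hw
  rw [sub_self] at hd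
  rcases Lead.exists_of_meromorphicAt hd.meromorphicAt with h | ⟨m, a, ha, hm⟩
  · filter_upwards [h] with z hz using sub_eq_zero.1 hz
  exfalso
  have hm1 : -1 ≤ m := by
    by_contra hlt
    rcases lt_or_eq_of_le (show m ≤ -2 by omega) with h' | rfl
    · exact ha (hm.unique (hd.weaken h'))
    · exact ha (hm.unique hd)
  have := (lead_swift_sub (b := b) (S := S) (T := T) hy hw hε hm).eq_zero_of_eventually (by
    filter_upwards [eventually_nhdsNE_of_codiscrete h1.ode p,
      eventually_nhdsNE_of_codiscrete h2.ode p] with z hz hz'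
    rw [hz, hz', sub_self])
  have hne : (m : ℂ) ^ 3 + 11 * m + 60 ≠ 0 := by
    have : m ^ 3 + 11 * m + 60 ≠ 0 := by nlinarith [sq_nonneg (m - 1), sq_nonneg m]
    exact_mod_cast this
  have hε0 : ε ≠ 0 := by rintro rfl; norm_num at hε
  simp [hne, hε0, ha] at this

theorem translate_eq {k b S T : ℂ} {y w : ℂ → ℂ} {p q ε : ℂ}
    (h1 : IsSol k b S T y) (h2 : IsSol k b S T w)
    (hy : Lead y p (-2) ε) (hw : Lead w q (-2) ε) (hε : ε ^ 2 = 1) :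
    (fun z => y (z + p)) =ᶠ[codiscrete ℂ] fun z => w (z + q) := by
  refine eq_of_eventually_nhdsNE (h1.comp_add p).mero (h2.comp_add q).mero (p := 0) ?_
  exact eventuallyEq_of_lead (h1.comp_add p) (h2.comp_add q)
    (Lead.comp_add (by simpa using hy)) (Lead.comp_add (by simpa using hw)) hε

/-! ### Consequences of uniqueness: periods, evenness and separation of the poles -/

section NF

variable {k b S T : ℂ} {y : ℂ → ℂ}

theorem IsNF.lead_neg (hn : IsNF y) {p : ℂ} (hp : ¬ AnalyticAt ℂ y p) :
    ∃ (n : ℤ) (a : ℂ), n < 0 ∧ a ≠ 0 ∧ Lead y p n a := by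
  have h1 : meromorphicOrderAt y p < 0 := by
    rw [← not_le, (hn p).meromorphicOrderAt_nonneg_iff_analyticAt]; exact hp
  rcases Lead.exists_of_meromorphicAt (hn p).meromorphicAt with h | ⟨n, a, ha, h⟩
  · rw [← meromorphicOrderAt_eq_top_iff] at h
    rw [h] at h1; simp at h1
  · rw [h.order_eq ha] at h1
    exact ⟨n, a, by exact_mod_cast h1, ha, h⟩

theorem Lead.not_analyticAt {p a : ℂ} {n : ℤ} (h : Lead y p n a) (hn : n < 0) (ha : a ≠ 0) :
    ¬ AnalyticAt ℂ y p := by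
  intro h'
  have := h'.meromorphicOrderAt_nonneg
  rw [h.order_eq ha] at this
  have : (0 : ℤ) ≤ n := by exact_mod_cast this
  omega

theorem IsSol.lead_of_not_analyticAt (h : IsSol k b S T y) (hn : IsNF y) {p : ℂ}
    (hp : ¬ AnalyticAt ℂ y p) : Lead y p (-2) 1 ∨ Lead y p (-2) (-1) := by
  obtain ⟨n, a, hn, ha, hL⟩ := hn.lead_neg hp
  obtain ⟨rfl, rfl | rfl⟩ := h.lead_pole hL ha hn
  · exact Or.inl hL
  · exact Or.inr hL

theorem IsSol.periodic (h : IsSol k b S T y) (hn : IsNF y) {p q ε : ℂ} (hε : ε ^ 2 = 1)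
    (hp : Lead y p (-2) ε) (hq : Lead y q (-2) ε) (z : ℂ) : y (z + (p - q)) = y z := by
  have := (hn.comp_add p).eq (hn.comp_add q) (translate_eq h h hp hq hε)
  have := congrFun this (z - q)
  simpa [sub_add_eq_add_sub, add_sub_assoc] using this

theorem IsSol.even (h : IsSol k b S T y) (hn : IsNF y) {p ε : ℂ} (hε : ε ^ 2 = 1)
    (hp : Lead y p (-2) ε) (z : ℂ) : y (2 * p - z) = y z := by
  have h1 : Lead (fun z => y (2 * p - z)) p (-2) ε := by
    have : Lead y (2 * p - p) (-2) ε := by rwa [show 2 * p - p = p by ring]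
    exact (Lead.comp_sub_left this).cast rfl (by norm_num)
  have := eq_of_eventually_nhdsNE (h.comp_sub_left (2 * p)).mero h.mero
    (eventuallyEq_of_lead (h.comp_sub_left (2 * p)) h h1 hp hε)
  exact congrFun ((hn.comp_sub_left (2 * p)).eq hn this) z

/-- Poles of the same sign differ by periods, so one isolating radius serves for the whole class.
There are only two classes. -/
theorem IsSol.separated (h : IsSol k b S T y) (hn : IsNF y) :
    ∃ δ > 0, ∀ p, ¬ AnalyticAt ℂ y p → ∀ w, w ≠ p → dist w p < δ → AnalyticAt ℂ y w := by
  have key : ∀ ε : ℂ, ε ^ 2 = 1 → ∃ δ > 0, ∀ p, Lead y p (-2) ε → ∀ w, w ≠ p → dist w p < δ →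
      AnalyticAt ℂ y w := by
    intro ε hε
    by_cases hex : ∃ q, Lead y q (-2) ε
    · obtain ⟨q, hq⟩ := hex
      have h1 := (hn q).meromorphicAt.eventually_analyticAt
      rw [eventually_nhdsWithin_iff, Metric.eventually_nhds_iff] at h1
      obtain ⟨δ, hδ, h2⟩ := h1
      refine ⟨δ, hδ, fun p hp w hw hd => ?_⟩
      have h3 : AnalyticAt ℂ y (w + (q - p)) := by
        refine h2 ?_ ?_
        · rw [dist_eq_norm] at hd ⊢; convert hd using 2; ring
        · intro h4; exact hw (by rw [Set.mem_singleton_iff] at h4; linear_combination h4)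
      have h4 : AnalyticAt ℂ (fun z => y (z + (q - p))) w :=
        AnalyticAt.fun_comp (g := y) h3 (analyticAt_id.add analyticAt_const)
      have h5 : (fun z => y (z + (q - p))) = y := funext (h.periodic hn hε hq hp)
      rwa [h5] at h4
    · exact ⟨1, one_pos, fun p hp => absurd ⟨p, hp⟩ hex⟩
  obtain ⟨δ₁, h1, h1'⟩ := key 1 (by norm_num)
  obtain ⟨δ₂, h2, h2'⟩ := key (-1) (by norm_num)
  refine ⟨min δ₁ δ₂, lt_min h1 h2, fun p hp w hw hd => ?_⟩
  rcases h.lead_of_not_analyticAt hn hp with h3 | h3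
  · exact h1' p h3 w hw (hd.trans_le (min_le_left _ _))
  · exact h2' p h3 w hw (hd.trans_le (min_le_right _ _))

end NF

/-! ### Differential polynomials without poles are constant -/

/-- `A` marks the regular points. A circle of radius δ/2 about a singular point stays δ/2 away from
all singular points, so the bound holds on it and the maximum principle carries it inside.
Liouville's theorem concludes. -/
theorem isConstant_of_bounded {A : ℂ → Prop} {f : ℂ → ℂ} (hm : Meromorphic f) {δ C : ℝ}
    (hδ : 0 < δ) (hsep : ∀ p, ¬ A p → ∀ w, w ≠ p → dist w p < δ → A w)
    (hC : ∀ z, (∀ w, dist w z < δ / 2 → A w) → AnalyticAt ℂ f z ∧ ‖f z‖ ≤ C)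
    (h0 : ∀ p, 0 ≤ meromorphicOrderAt f p) : IsConstant f := by
  obtain ⟨F, hF, hfF⟩ := exists_isNF hm
  have hFa : ∀ z, AnalyticAt ℂ F z := by
    intro z
    rw [← (hF z).meromorphicOrderAt_nonneg_iff_analyticAt,
      ← meromorphicOrderAt_congr (eventually_nhdsNE_of_codiscrete hfF z)]
    exact h0 z
  have hC' : ∀ z, (∀ w, dist w z < δ / 2 → A w) → ‖F z‖ ≤ C := by
    intro z hz
    have h2 := ((hC z hz).1.continuousAt.eventuallyEq_nhds_iff_eventuallyEq_nhdsNE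
      (hFa z).continuousAt).1 (eventually_nhdsNE_of_codiscrete hfF z)
    rw [← h2.eq_of_nhds]
    exact (hC z hz).2
  have hbd : ∀ z, ‖F z‖ ≤ C := by
    intro z
    by_cases hz : ∀ w, dist w z < δ / 2 → A w
    · exact hC' z hz
    · push Not at hz
      obtain ⟨w, hw, hwa⟩ := hz
      refine Complex.norm_le_of_forall_mem_frontier_norm_le (U := Metric.ball w (δ / 2))
        Metric.isBounded_ball ?_ ?_ (subset_closure ?_)
      · exact Differentiable.diffContOnCl fun x => (hFa x).differentiableAt
      · intro x hx
        rw [frontier_ball _ (by linarith : δ / 2 ≠ 0)] at hx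
        refine hC' x fun v hv => hsep w hwa v ?_ ?_
        · rintro rfl
          rw [Metric.mem_sphere, dist_comm] at hx; linarith
        · have := dist_triangle v x w
          rw [Metric.mem_sphere] at hx
          linarith
      · rwa [Metric.mem_ball, dist_comm]
  refine ⟨F 0, hfF.trans (Eventually.of_forall fun z => ?_)⟩
  refine Differentiable.apply_eq_apply_of_bounded (fun x => (hFa x).differentiableAt) ?_ z 0
  rw [isBounded_iff_forall_norm_le]
  exact ⟨C, by rintro _ ⟨x, rfl⟩; exact hbd x⟩

/-- Differential polynomials in `y` with constant coefficients. -/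
inductive DiffPoly (y : ℂ → ℂ) : (ℂ → ℂ) → Prop
  | const (a : ℂ) : DiffPoly y fun _ => a
  | self : DiffPoly y y
  | add {f g : ℂ → ℂ} : DiffPoly y f → DiffPoly y g → DiffPoly y fun z => f z + g z
  | mul {f g : ℂ → ℂ} : DiffPoly y f → DiffPoly y g → DiffPoly y fun z => f z * g z
  | deriv {f : ℂ → ℂ} : DiffPoly y f → DiffPoly y (deriv f)

namespace DiffPoly

variable {k b S T : ℂ} {y f g : ℂ → ℂ}

theorem const_mul (c : ℂ) (h : DiffPoly y f) : DiffPoly y fun z => c * f z := (const c).mul h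

theorem sub (hf : DiffPoly y f) (hg : DiffPoly y g) : DiffPoly y fun z => f z - g z := by
  simpa [sub_eq_add_neg] using hf.add (hg.const_mul (-1))

theorem pow (hf : DiffPoly y f) (n : ℕ) : DiffPoly y fun z => f z ^ n := by
  induction n with
  | zero => simpa using const 1
  | succ n ih => simpa [pow_succ] using ih.mul hf

theorem meromorphic (h : DiffPoly y f) (hy : Meromorphic y) : Meromorphic f := by
  induction h with
  | const a => exact .const a
  | self => exact hy
  | add _ _ h1 h2 => exact h1.add h2
  | mul _ _ h1 h2 => exact h1.mul h2
  | deriv _ h1 => exact h1.deriv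

theorem analyticAt (h : DiffPoly y f) {z : ℂ} (hy : AnalyticAt ℂ y z) : AnalyticAt ℂ f z := by
  induction h with
  | const a => exact analyticAt_const
  | self => exact hy
  | add _ _ h1 h2 => exact h1.add h2
  | mul _ _ h1 h2 => exact h1.mul h2
  | deriv _ h1 => exact h1.deriv

theorem periodic (h : DiffPoly y f) {ω : ℂ} (hy : ∀ z, y (z + ω) = y z) (z : ℂ) :
    f (z + ω) = f z := by
  induction h generalizing z with
  | const a => rfl
  | self => exact hy z
  | add _ _ h1 h2 => simp [h1, h2]
  | mul _ _ h1 h2 => simp [h1, h2]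
  | @deriv f _ h1 =>
    have := congrFun (deriv_fun_comp_add f ω) z
    rw [← this]; congr 1; exact funext h1

/-- Induction on the construction of the differential polynomial. A derivative costs half of the
pole-free radius, by Cauchy's estimate, which is why δ is quantified inside. -/
theorem bounded (h : IsSol k b S T y) (hf : DiffPoly y f) : ∀ δ > 0, ∃ C : ℝ, ∀ z,
    (∀ w, dist w z < δ → AnalyticAt ℂ y w) → ‖f z‖ ≤ C := by
  induction hf with
  | const a => exact fun δ _ => ⟨‖a‖, fun z _ => le_rfl⟩
  | self =>
    intro δ hδ
    obtain ⟨A, hA, hb⟩ := norm_le_of_swift (k := k) (b := b) (S := S) (T := T)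
    set R : ℝ := min (δ / 2) 1
    have hR : 0 < R := lt_min (by linarith) one_pos
    refine ⟨A / R ^ 2, fun z hz => ?_⟩
    rw [le_div_iff₀ (by positivity)]
    have hsub : ∀ w ∈ Metric.closedBall z R, AnalyticAt ℂ y w := fun w hw =>
      hz w (lt_of_le_of_lt (Metric.mem_closedBall.1 hw)
        (lt_of_le_of_lt (min_le_left _ _) (by linarith)))
    exact hb y z R hR (min_le_right _ _) hsub fun w hw => h.ode_at (hsub w hw)
  | add _ _ h1 h2 =>
    intro δ hδ
    obtain ⟨C₁, hC₁⟩ := h1 δ hδ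
    obtain ⟨C₂, hC₂⟩ := h2 δ hδ
    exact ⟨C₁ + C₂, fun z hz => (norm_add_le _ _).trans (add_le_add (hC₁ z hz) (hC₂ z hz))⟩
  | mul _ _ h1 h2 =>
    intro δ hδ
    obtain ⟨C₁, hC₁⟩ := h1 δ hδ
    obtain ⟨C₂, hC₂⟩ := h2 δ hδ
    refine ⟨C₁ * C₂, fun z hz => ?_⟩
    rw [norm_mul]
    exact mul_le_mul (hC₁ z hz) (hC₂ z hz) (norm_nonneg _) ((norm_nonneg _).trans (hC₁ z hz))
  | @deriv f hf h1 =>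
    intro δ hδ
    obtain ⟨C, hC⟩ := h1 (δ / 2) (by linarith)
    refine ⟨C / (δ / 2), fun z hz => ?_⟩
    refine Complex.norm_deriv_le_of_forall_mem_sphere_norm_le (by linarith) ?_ ?_
    · apply DifferentiableOn.diffContOnCl
      rw [closure_ball _ (by linarith)]
      intro w hw
      refine (hf.analyticAt (hz w ?_)).differentiableAt.differentiableWithinAt
      have := Metric.mem_closedBall.1 hw
      linarith
    · intro w hw
      refine hC w fun x hx => hz x ?_
      have := dist_triangle x w z
      rw [Metric.mem_sphere] at hw
      linarith

theorem isConstant (h : IsSol k b S T y) (hn : IsNF y) (hf : DiffPoly y f)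
    (hp : ∀ p, ¬ AnalyticAt ℂ y p → ∃ a, Lead f p 0 a) : IsConstant f := by
  obtain ⟨δ, hδ, hsep⟩ := h.separated hn
  obtain ⟨C, hC⟩ := bounded h hf (δ / 2) (by linarith)
  refine isConstant_of_bounded (hf.meromorphic h.mero) hδ hsep (C := C)
    (fun z hz => ⟨hf.analyticAt (hz z (by simpa using hδ)), hC z hz⟩) fun z => ?_
  by_cases hz : AnalyticAt ℂ y z
  · exact (hf.analyticAt hz).meromorphicOrderAt_nonneg
  · obtain ⟨a, ha⟩ := hp z hz
    exact ha.order_nonneg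

end DiffPoly

theorem IsSol.exists_not_analyticAt {k b S T : ℂ} {y : ℂ → ℂ} (h : IsSol k b S T y) (hn : IsNF y)
    (hc : ¬ IsConstant y) : ∃ p, ¬ AnalyticAt ℂ y p := by
  by_contra! h'
  exact hc (DiffPoly.isConstant h hn .self fun p hp => absurd (h' p) hp)

/-! ### Laurent expansion at a pole -/

theorem Lead.hasDerivAt_zpow_sub {p z : ℂ} (hz : z ≠ p) (n : ℤ) :
    HasDerivAt (fun w => (w - p) ^ n) (n * (z - p) ^ (n - 1)) z := by
  have := HasDerivAt.comp (h₂ := fun x => x ^ n) (h := fun w => w - p) z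
    (hasDerivAt_zpow n (z - p) (Or.inl (sub_ne_zero.2 hz))) ((hasDerivAt_id' z).sub_const p)
  rwa [mul_one] at this

/-- The first terms of the Laurent expansion at a pole. -/
def laurentHead (b g ε p : ℂ) (z : ℂ) : ℂ := ε * (z - p) ^ (-2 : ℤ) + ε * b - ε * g * (z - p) ^ 2

theorem deriv_laurentHead {b g ε p z : ℂ} (hz : z ≠ p) :
    deriv (laurentHead b g ε p) z = -2 * ε * (z - p) ^ (-3 : ℤ) - 2 * ε * g * (z - p) := by
  have h1 := ((Lead.hasDerivAt_zpow_sub hz (-2)).const_mul ε).add_const (ε * b)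
  have h2 := (((hasDerivAt_id' z).sub_const p).pow 2).const_mul (ε * g)
  refine ((h1.sub h2).congr_deriv ?_).deriv
  push_cast; norm_num; ring

theorem deriv_deriv_laurentHead {b g ε p z : ℂ} (hz : z ≠ p) :
    deriv (deriv (laurentHead b g ε p)) z = 6 * ε * (z - p) ^ (-4 : ℤ) - 2 * ε * g := by
  have h0 : deriv (laurentHead b g ε p) =ᶠ[𝓝 z]
      fun z => -2 * ε * (z - p) ^ (-3 : ℤ) - 2 * ε * g * (z - p) := by
    filter_upwards [isOpen_ne.mem_nhds hz] with w hw using deriv_laurentHead hw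
  rw [h0.deriv_eq]
  have h1 := (Lead.hasDerivAt_zpow_sub hz (-3)).const_mul (-2 * ε)
  have h2 := ((hasDerivAt_id' z).sub_const p).const_mul (2 * ε * g)
  refine ((h1.sub h2).congr_deriv ?_).deriv
  push_cast; norm_num; ring

theorem deriv_deriv_deriv_laurentHead {b g ε p z : ℂ} (hz : z ≠ p) :
    deriv (deriv (deriv (laurentHead b g ε p))) z = -24 * ε * (z - p) ^ (-5 : ℤ) := by
  have h0 : deriv (deriv (laurentHead b g ε p)) =ᶠ[𝓝 z]
      fun z => 6 * ε * (z - p) ^ (-4 : ℤ) - 2 * ε * g := by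
    filter_upwards [isOpen_ne.mem_nhds hz] with w hw using deriv_deriv_laurentHead hw
  rw [h0.deriv_eq]
  have h1 := ((Lead.hasDerivAt_zpow_sub hz (-4)).const_mul (6 * ε)).sub_const (2 * ε * g)
  refine (h1.congr_deriv ?_).deriv
  push_cast; norm_num; ring

theorem lead_sq (p : ℂ) : Lead (fun z => (z - p) ^ 2) p 2 1 := by
  simpa using Lead.zpow p 2

theorem lead_laurentHead (b g ε p : ℂ) : Lead (laurentHead b g ε p) p (-2) ε := by
  have h1 := (Lead.zpow p (-2)).const_mul ε
  have h2 := (Lead.const (ε * b) p).weaken (show (-2 : ℤ) < 0 by norm_num)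
  have h3 := ((lead_sq p).const_mul (ε * g)).weaken (show (-2 : ℤ) < 2 by norm_num)
  exact ((h1.add h2).sub h3).cast rfl (by ring)

/-- The leading coefficient ε, the constant term εb and the coefficient -ε(b² + S) remove the orders
-8, -6 and -4 in turn. The parameter T first appears at order -2. -/
theorem lead_swift_laurentHead {b S T ε p : ℂ} (hε : ε = 1 ∨ ε = -1) :
    ∃ a, Lead (swift b S T (laurentHead b (b ^ 2 + S) ε p)) p (-2) a := by
  set g := b ^ 2 + S with hg
  set h := b ^ 2 - 2 * g with hh
  refine ⟨_, fun z => 240 * b * g - 30 * (-4 * b * g + 4 * b * h + 12 * S * b - 4 * T * ε)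
    + (z - p) ^ 2 * (-2 * g ^ 2 - 30 * (2 * g ^ 2 - 8 * b ^ 2 * g + h ^ 2 + 6 * S * h
      - 4 * T * ε * b))
    + (z - p) ^ 4 * (120 * b * g ^ 2 - 30 * (4 * b * g ^ 2 - 4 * b * g * h - 12 * S * b * g
      + 4 * T * ε * g))
    + (z - p) ^ 6 * (-30 * (2 * h * g ^ 2 + 4 * b ^ 2 * g ^ 2 + 6 * S * g ^ 2))
    + (z - p) ^ 8 * (120 * b * g ^ 3) - 30 * g ^ 4 * (z - p) ^ 10, by fun_prop, rfl, ?_⟩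
  filter_upwards [self_mem_nhdsWithin] with z hz
  have hz' : z - p ≠ 0 := sub_ne_zero.2 hz
  rw [swift, deriv_deriv_deriv_laurentHead hz, deriv_deriv_laurentHead hz, deriv_laurentHead hz,
    laurentHead]
  generalize z - p = Z at hz'
  simp only [zpow_neg, zpow_ofNat]
  rcases hε with rfl | rfl
  · field_simp
    rw [hh, hg]; ring
  · field_simp
    rw [hh, hg]; ring

theorem IsSol.lead_sub_laurentHead {k b S T : ℂ} {y : ℂ → ℂ} (h : IsSol k b S T y) {p ε : ℂ}
    (hε : ε = 1 ∨ ε = -1) (hL : Lead y p (-2) ε) :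
    ∃ a, Lead (fun z => y z - laurentHead b (b ^ 2 + S) ε p z) p 4 a := by
  have hε2 : ε ^ 2 = 1 := by rcases hε with rfl | rfl <;> norm_num
  have hε0 : ε ≠ 0 := by rintro rfl; norm_num at hε2
  have hw := lead_laurentHead b (b ^ 2 + S) ε p
  obtain ⟨ρ, hρ⟩ := lead_swift_laurentHead (b := b) (S := S) (T := T) (p := p) hε
  have hres : Lead (fun z => swift b S T y z - swift b S T (laurentHead b (b ^ 2 + S) ε p) z)
      p (-2) (0 - ρ) := by
    refine (((Lead.const k p).weaken (by norm_num : (-2 : ℤ) < 0)).sub hρ).congr ?_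
    filter_upwards [eventually_nhdsNE_of_codiscrete h.ode p] with z hz
    rw [hz]
  -- A term of exponent m in the difference acts at order m - 6. For m < 4 this is below the order
  -- -2 of the residue, so the coefficient must vanish.
  have step : ∀ m : ℤ, -1 ≤ m → m < 4 → ∀ a,
      Lead (fun z => y z - laurentHead b (b ^ 2 + S) ε p z) p m a →
      ∃ a, Lead (fun z => y z - laurentHead b (b ^ 2 + S) ε p z) p (m + 1) a := by
    intro m hm hm4 a ha
    have h1 := (lead_swift_sub (b := b) (S := S) (T := T) hL hw hε2 ha).unique
      (hres.weaken (by omega))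
    have hne : (m : ℂ) ^ 3 + 11 * m + 60 ≠ 0 := by
      have : m ^ 3 + 11 * m + 60 ≠ 0 := by nlinarith [sq_nonneg (m - 1), sq_nonneg m]
      exact_mod_cast this
    have : a = 0 := by simpa [hne, hε0] using h1
    subst this
    exact ha.lift
  have h0 := (hL.sub hw).cast rfl (sub_self ε)
  obtain ⟨a, ha⟩ := h0.lift
  obtain ⟨a, ha⟩ := step (-1) (by norm_num) (by norm_num) a (by simpa using ha)
  obtain ⟨a, ha⟩ := step 0 (by norm_num) (by norm_num) a (by simpa using ha)
  obtain ⟨a, ha⟩ := step 1 (by norm_num) (by norm_num) a (by simpa using ha)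
  obtain ⟨a, ha⟩ := step 2 (by norm_num) (by norm_num) a (by simpa using ha)
  obtain ⟨a, ha⟩ := step 3 (by norm_num) (by norm_num) a (by simpa using ha)
  exact ⟨a, by simpa using ha⟩

/-! ### Holomorphy up to a removable singularity -/

/-- `f` is holomorphic at `p` up to its value there. -/
def Hol (f : ℂ → ℂ) (p : ℂ) : Prop := ∃ a, Lead f p 0 a

namespace Hol

variable {f g : ℂ → ℂ} {p : ℂ}

theorem const (a p : ℂ) : Hol (fun _ => a) p := ⟨a, .const a p⟩

theorem add (hf : Hol f p) (hg : Hol g p) : Hol (fun z => f z + g z) p := by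
  obtain ⟨a, ha⟩ := hf
  obtain ⟨b, hb⟩ := hg
  exact ⟨_, ha.add hb⟩

theorem sub (hf : Hol f p) (hg : Hol g p) : Hol (fun z => f z - g z) p := by
  obtain ⟨a, ha⟩ := hf
  obtain ⟨b, hb⟩ := hg
  exact ⟨_, ha.sub hb⟩

theorem mul (hf : Hol f p) (hg : Hol g p) : Hol (fun z => f z * g z) p := by
  obtain ⟨a, ha⟩ := hf
  obtain ⟨b, hb⟩ := hg
  exact ⟨_, (ha.mul hb).cast (by norm_num) rfl⟩

theorem const_mul (c : ℂ) (hf : Hol f p) : Hol (fun z => c * f z) p := (const c p).mul hf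

theorem pow (hf : Hol f p) (n : ℕ) : Hol (fun z => f z ^ n) p := by
  obtain ⟨a, ha⟩ := hf
  exact ⟨_, (ha.pow n).cast (by simp) rfl⟩

theorem deriv (hf : Hol f p) : Hol (deriv f) p := by
  obtain ⟨a, ha⟩ := hf
  have := ha.deriv
  simp only [Int.cast_zero, zero_mul] at this
  obtain ⟨c, hc⟩ := this.lift
  exact ⟨c, by simpa using hc⟩

theorem congr (hf : Hol f p) (h : f =ᶠ[𝓝[≠] p] g) : Hol g p := by
  obtain ⟨a, ha⟩ := hf
  exact ⟨a, ha.congr h⟩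

theorem of_lead {n : ℤ} {a : ℂ} (h : Lead f p n a) (hn : 0 ≤ n) : Hol f p := by
  rcases hn.lt_or_eq with h' | h'
  · exact ⟨0, h.weaken h'⟩
  · exact ⟨a, h' ▸ h⟩

theorem comp_add {ω : ℂ} (hf : Hol f (p + ω)) : Hol (fun z => f (z + ω)) p := by
  obtain ⟨a, ha⟩ := hf
  exact ⟨a, ha.comp_add⟩

end Hol

/-- The translation from one pole to another of the same sign is a period of y and therefore of
every differential polynomial in y. -/
theorem DiffPoly.hol_of_hol {k b S T : ℂ} {y f : ℂ → ℂ} (h : IsSol k b S T y) (hn : IsNF y)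
    (hf : DiffPoly y f) {p q ε : ℂ} (hε : ε ^ 2 = 1) (hp : Lead y p (-2) ε) (hq : Lead y q (-2) ε)
    (hh : Hol f p) : Hol f q := by
  have h1 : (fun z => f (z + (p - q))) = f :=
    funext (hf.periodic (h.periodic hn hε hp hq))
  rw [← h1]
  exact Hol.comp_add (by simpa using hh)

/-- A function even about `p` with principal part `(z - p)⁻²` satisfies an equation
`f'' - 6 f² + 12 a f = O(1)`. -/
theorem exists_hol_deriv_deriv {f : ℂ → ℂ} {p : ℂ} (hf : Hol (fun z => f z - (z - p) ^ (-2 : ℤ)) p)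
    (he : ∀ z, f (2 * p - z) = f z) :
    ∃ a, Hol (fun z => deriv (deriv f) z - 6 * f z ^ 2 + 12 * a * f z) p := by
  -- The number a is the constant term of f. Evenness removes the linear term, so f = (z - p)⁻² + a
  -- + O((z - p)²), and 12af compensates the cross term of 6f².
  obtain ⟨a, ha⟩ := hf
  have h0 : Lead (fun z => f z - (z - p) ^ (-2 : ℤ) - a) p 0 (a - a) := ha.sub (.const a p)
  rw [sub_self] at h0
  obtain ⟨c, hc⟩ := h0.lift
  have hc0 : c = 0 := hc.eq_zero_of_even (by norm_num) <| Eventually.of_forall fun z => by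
    simp only [he]
    rw [show 2 * p - z - p = -(z - p) by ring, Even.neg_zpow (by decide)]
  subst hc0
  obtain ⟨c, hc⟩ := hc.lift
  norm_num at hc
  refine ⟨a, ?_⟩
  have hr : Hol (fun z => f z - (z - p) ^ (-2 : ℤ)) p := ⟨a, ha⟩
  have h1 : Hol (fun z => (z - p) ^ (-2 : ℤ) * (f z - (z - p) ^ (-2 : ℤ) - a)) p :=
    ⟨_, ((Lead.zpow p (-2)).mul hc).cast (by norm_num) rfl⟩
  refine (((hr.deriv.deriv.sub (h1.const_mul 12)).sub ((hr.pow 2).const_mul 6)).add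
    (hr.const_mul (12 * a))).congr ?_
  have hfm : MeromorphicAt f p := by
    have := (ha.meromorphicAt).add (Lead.zpow p (-2)).meromorphicAt
    refine this.congr (Eventually.of_forall fun z => ?_)
    simp
  have hd : ∀ᶠ z in 𝓝[≠] p, deriv (fun z => f z - (z - p) ^ (-2 : ℤ)) z
      = deriv f z + 2 * (z - p) ^ (-3 : ℤ) := by
    filter_upwards [hfm.eventually_analyticAt, self_mem_nhdsWithin] with z hz h0
    rw [((hz.differentiableAt.hasDerivAt).fun_sub (Lead.hasDerivAt_zpow_sub h0 (-2))).deriv]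
    norm_num
  have hd2 : ∀ᶠ z in 𝓝[≠] p, deriv (deriv (fun z => f z - (z - p) ^ (-2 : ℤ))) z
      = deriv (deriv f) z - 6 * (z - p) ^ (-4 : ℤ) := by
    have hd' := eventually_eventually_nhdsWithin.2 hd
    filter_upwards [hfm.deriv.eventually_analyticAt, self_mem_nhdsWithin, hd'] with z hz h0 h1
    rw [(isOpen_compl_singleton (x := p)).nhdsWithin_eq h0] at h1
    rw [EventuallyEq.deriv_eq h1, ((hz.differentiableAt.hasDerivAt).fun_add
      ((Lead.hasDerivAt_zpow_sub h0 (-3)).const_mul 2)).deriv]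
    norm_num; ring
  filter_upwards [hd2, self_mem_nhdsWithin] with z h2 h0
  rw [h2]
  have hz' : z - p ≠ 0 := sub_ne_zero.2 h0
  have : (z - p) ^ (-4 : ℤ) = ((z - p) ^ (-2 : ℤ)) ^ 2 := by
    rw [← zpow_natCast, ← zpow_mul]; norm_num
  rw [this]; ring

/-- By evenness g - c vanishes to second order at p, which absorbs the double pole of f. -/
theorem hol_mul_sub {f g : ℂ → ℂ} {p c : ℂ} (hf : Hol (fun z => f z - (z - p) ^ (-2 : ℤ)) p)
    (hg : Lead g p 0 c) (he : ∀ z, g (2 * p - z) = g z) :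
    Hol (fun z => f z * (g z - c)) p := by
  have h0 : Lead (fun z => g z - c) p 0 (c - c) := hg.sub (.const c p)
  rw [sub_self] at h0
  obtain ⟨d, hd⟩ := h0.lift
  have hd0 : d = 0 := hd.eq_zero_of_even (by norm_num) <| Eventually.of_forall fun z => by
    simp only [he]
  subst hd0
  obtain ⟨d, hd⟩ := hd.lift
  norm_num at hd
  have h1 : Hol (fun z => (z - p) ^ (-2 : ℤ) * (g z - c)) p :=
    ⟨_, ((Lead.zpow p (-2)).mul hd).cast (by norm_num) rfl⟩
  refine ((hf.mul (Hol.of_lead hd (by norm_num))).add h1).congr (Eventually.of_forall fun z => ?_)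
  ring

/-- `2 y y'' - 3 y'² - 12 b y²` has only a double pole, with the same coefficient at all poles. -/
theorem IsSol.hol_quadratic {k b S T : ℂ} {y : ℂ → ℂ} (h : IsSol k b S T y) {p ε : ℂ}
    (hε : ε = 1 ∨ ε = -1) (hL : Lead y p (-2) ε) :
    Hol (fun z => 2 * y z * deriv (deriv y) z - 3 * deriv y z ^ 2 - 12 * b * y z ^ 2
      + 8 * (5 * S + 8 * b ^ 2) * (z - p) ^ (-2 : ℤ)) p := by
  obtain ⟨a, hd⟩ := h.lead_sub_laurentHead hε hL
  set g := b ^ 2 + S with hg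
  set w := laurentHead b g ε p with hw
  have hwL := lead_laurentHead b g ε p
  rw [← hw] at hwL
  have hd1 : Lead (fun z => deriv y z - deriv w z) p 3 (4 * a) := by
    refine (hd.deriv.cast (m := 3) (b := 4 * a) (by norm_num) (by norm_num)).congr ?_
    filter_upwards [hL.meromorphicAt.eventually_analyticAt,
      hwL.meromorphicAt.eventually_analyticAt] with z h1 h2
    exact deriv_fun_sub h1.differentiableAt h2.differentiableAt
  have hd2 : Lead (fun z => deriv (deriv y) z - deriv (deriv w) z) p 2 (12 * a) := by
    refine (hd1.deriv.cast (m := 2) (b := 12 * a) (by norm_num) (by push_cast; ring)).congr ?_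
    filter_upwards [hL.meromorphicAt.deriv.eventually_analyticAt,
      hwL.meromorphicAt.deriv.eventually_analyticAt] with z h1 h2
    exact deriv_fun_sub h1.differentiableAt h2.differentiableAt
  have t1 : Hol _ p := Hol.of_lead ((hwL.mul hd2).const_mul 2) (by norm_num)
  have t2 : Hol _ p := Hol.of_lead ((hd.mul hwL.deriv.deriv).const_mul 2) (by norm_num)
  have t3 : Hol _ p := Hol.of_lead ((hd.mul hd2).const_mul 2) (by norm_num)
  have t4 : Hol _ p := Hol.of_lead ((hwL.deriv.mul hd1).const_mul (-6)) (by norm_num)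
  have t5 : Hol _ p := Hol.of_lead ((hd1.pow 2).const_mul (-3)) (by norm_num)
  have t6 : Hol _ p := Hol.of_lead ((hwL.mul hd).const_mul (-24 * b)) (by norm_num)
  have t7 : Hol _ p := Hol.of_lead ((hd.pow 2).const_mul (-12 * b)) (by norm_num)
  have t8 : Hol _ p := Hol.of_lead (((lead_sq p).const_mul (4 * g ^ 2 - 12 * g ^ 2 + 24 * b ^ 2 * g)))
    (by norm_num)
  have t9 : Hol _ p := Hol.of_lead (((lead_sq p).pow 2).const_mul (-12 * b * g ^ 2)) (by norm_num)
  have t10 := Hol.const (-4 * b * g - 12 * b * (b ^ 2 - 2 * g)) p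
  refine (((((((((t1.add t2).add t3).add t4).add t5).add t6).add t7).add t8).add t9).add t10).congr ?_
  filter_upwards [self_mem_nhdsWithin] with z hz
  have hz' : z - p ≠ 0 := sub_ne_zero.2 hz
  -- The coefficients 2, -3 and -12b cancel the orders -6 and -4. The expression is quadratic, so ε
  -- enters only through ε² = 1, and both signs yield the same principal part.
  have key : 2 * w z * deriv (deriv w) z - 3 * deriv w z ^ 2 - 12 * b * w z ^ 2
      + 8 * (5 * S + 8 * b ^ 2) * (z - p) ^ (-2 : ℤ)
      = (4 * g ^ 2 - 12 * g ^ 2 + 24 * b ^ 2 * g) * (z - p) ^ 2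
        + -12 * b * g ^ 2 * ((z - p) ^ 2) ^ 2 + (-4 * b * g - 12 * b * (b ^ 2 - 2 * g)) := by
    rw [hw, deriv_deriv_laurentHead hz, deriv_laurentHead hz, laurentHead]
    generalize z - p = Z at hz'
    simp only [zpow_neg, zpow_ofNat]
    rcases hε with rfl | rfl
    · field_simp
      rw [hg]; ring
    · field_simp
      rw [hg]; ring
  linear_combination -key

/-! ### Solutions of the Weierstrass equation -/

/-- `p` is a nonconstant meromorphic solution of `p'² = 4 p³ - g₂ p - g₃`. -/
structure IsW (g₂ g₃ : ℂ) (p : ℂ → ℂ) : Prop where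
  mero : Meromorphic p
  nonconst : ¬ IsConstant p
  ode : ∀ᶠ z in codiscrete ℂ, deriv p z ^ 2 = 4 * p z ^ 3 - g₂ * p z - g₃

theorem deriv_ne_zero_of_not_isConstant {p : ℂ → ℂ} (hm : Meromorphic p) (hc : ¬ IsConstant p) :
    ∀ᶠ z in codiscrete ℂ, deriv p z ≠ 0 :=
  eventually_ne_of_not_eq hm.deriv fun h => hc (isConstant_of_deriv hm h)

namespace IsW

variable {g₂ g₃ : ℂ} {p : ℂ → ℂ}

theorem congr (h : IsW g₂ g₃ p) {w : ℂ → ℂ} (hw : p =ᶠ[codiscrete ℂ] w) : IsW g₂ g₃ w := by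
  refine ⟨h.mero.congr_codiscrete hw, fun hc => h.nonconst (hc.congr hw.symm), ?_⟩
  filter_upwards [h.ode, hw, deriv_congr_codiscrete hw] with z h1 h2 h3
  rw [← h2, ← h3, h1]

theorem comp_add (h : IsW g₂ g₃ p) (a : ℂ) : IsW g₂ g₃ fun z => p (z + a) := by
  refine ⟨Meromorphic.comp_add h.mero a, ?_, ?_⟩
  · rintro ⟨c, hc⟩
    refine h.nonconst ⟨c, ?_⟩
    filter_upwards [eventually_add_right hc (-a)] with z hz
    simpa using hz
  · filter_upwards [eventually_add_right h.ode a] with z hz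
    rw [deriv_fun_comp_add, hz]

theorem deriv_ne_zero (h : IsW g₂ g₃ p) : ∀ᶠ z in codiscrete ℂ, deriv p z ≠ 0 :=
  deriv_ne_zero_of_not_isConstant h.mero h.nonconst

/-- Differentiate the first order equation and divide by 2p', which is nonzero off a discrete set.
-/
theorem deriv_deriv (h : IsW g₂ g₃ p) :
    ∀ᶠ z in codiscrete ℂ, deriv (deriv p) z = 6 * p z ^ 2 - g₂ / 2 := by
  filter_upwards [eventually_codiscrete_analyticAt h.mero, eventually_nhds_of_codiscrete h.ode,
    h.deriv_ne_zero] with z ha ho hne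
  have h1 := (ha.deriv.differentiableAt.hasDerivAt).fun_pow 2
  have h2 := ha.differentiableAt.hasDerivAt
  have h3 := ((((h2.fun_pow 3).const_mul 4).fun_sub (h2.const_mul g₂)).sub_const g₃)
  have h4 := h1.deriv
  rw [EventuallyEq.deriv_eq ho, h3.deriv] at h4
  apply mul_left_cancel₀ hne
  norm_num at h4
  linear_combination -(1 / 2) * h4

theorem deriv_deriv_deriv (h : IsW g₂ g₃ p) :
    ∀ᶠ z in codiscrete ℂ, deriv (deriv (deriv p)) z = 12 * p z * deriv p z := by
  filter_upwards [eventually_codiscrete_analyticAt h.mero,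
    eventually_nhds_of_codiscrete h.deriv_deriv] with z ha ho
  have h2 := ha.differentiableAt.hasDerivAt
  rw [EventuallyEq.deriv_eq ho, (((h2.fun_pow 2).const_mul 6).sub_const (g₂ / 2)).deriv]
  norm_num; ring

/-- The first elliptic family. -/
theorem swift_add_const (h : IsW g₂ g₃ p) (b S T : ℂ) :
    ∀ᶠ z in codiscrete ℂ, swift b S T (fun z => p z + b) z
      = -(9 * g₂ + 180 * (b ^ 2 + S)) * p z ^ 2
        - (12 * g₃ + 30 * b * g₂ + 30 * (4 * b ^ 3 + 12 * S * b - 4 * T)) * p z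
        - (g₂ ^ 2 / 8 + 30 * b * g₃ + 30 * (b ^ 4 + 6 * S * b ^ 2 - 4 * T * b)) := by
  have hd : deriv (fun z => p z + b) = deriv p := by
    ext z; exact deriv_add_const b
  filter_upwards [h.ode, h.deriv_deriv, h.deriv_deriv_deriv] with z h1 h2 h3
  rw [swift, hd, h2, h3]
  linear_combination (12 * p z + 30 * b) * h1

theorem isSol_add_const (h : IsW g₂ g₃ p) {k b S T : ℂ} (h2 : g₂ = -20 * (S + b ^ 2))
    (h3 : g₃ = 10 * (T + 2 * b * S + 4 * b ^ 3))
    (hk : k = 10 * (-128 * b ^ 4 - 88 * b ^ 2 * S - 5 * S ^ 2 - 18 * b * T)) :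
    IsSol k b S T fun z => p z + b := by
  refine ⟨h.mero.add (.const b), ?_⟩
  filter_upwards [h.swift_add_const b S T] with z hz
  rw [hz, hk, h2, h3]; ring

/-- A Weierstrass function is itself a solution with b = 0. Hence existence of poles, periodicity,
evenness, separation and the boundedness estimate all apply to it. -/
theorem isSol (h : IsW g₂ g₃ p) : IsSol (-g₂ ^ 2 / 8) 0 (-g₂ / 20) (g₃ / 10) p := by
  have := h.isSol_add_const (k := -g₂ ^ 2 / 8) (b := 0) (S := -g₂ / 20) (T := g₃ / 10)
    (by ring) (by ring) (by ring)
  simpa using this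

end IsW

/-- Multiply by 2p' and integrate; the invariant g₃ is the constant of integration. -/
theorem isW_of_deriv_deriv {p : ℂ → ℂ} (hm : Meromorphic p) (hc : ¬ IsConstant p) {g₂ : ℂ}
    (h : ∀ᶠ z in codiscrete ℂ, deriv (deriv p) z = 6 * p z ^ 2 - g₂ / 2) :
    ∃ g₃, IsW g₂ g₃ p := by
  have hF : Meromorphic fun z => deriv p z ^ 2 - (4 * p z ^ 3 - g₂ * p z) := by
    have h1 : Meromorphic (deriv p) := hm.deriv
    exact (h1.pow (n := 2)).sub (((Meromorphic.const 4).mul (hm.pow (n := 3))).sub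
      ((Meromorphic.const g₂).mul hm))
  obtain ⟨g, hg⟩ := isConstant_of_deriv hF (by
    filter_upwards [eventually_codiscrete_analyticAt hm, h] with z ha h0
    have h2 := ha.differentiableAt.hasDerivAt
    have h1 := ha.deriv.differentiableAt.hasDerivAt
    rw [((h1.fun_pow 2).fun_sub (((h2.fun_pow 3).const_mul 4).fun_sub (h2.const_mul g₂))).deriv, h0]
    norm_num; ring)
  refine ⟨-g, hm, hc, ?_⟩
  filter_upwards [hg] with z hz
  linear_combination hz

theorem DiffPoly.isConstant_of_hol {k b S T : ℂ} {y f : ℂ → ℂ} (h : IsSol k b S T y) (hn : IsNF y)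
    (hf : DiffPoly y f) (h1 : ∀ p, Lead y p (-2) 1 → ∃ q, Lead y q (-2) 1 ∧ Hol f q)
    (h2 : ∀ p, Lead y p (-2) (-1) → ∃ q, Lead y q (-2) (-1) ∧ Hol f q) : IsConstant f := by
  refine hf.isConstant h hn fun p hp => ?_
  rcases h.lead_of_not_analyticAt hn hp with hL | hL
  · obtain ⟨q, hq, hh⟩ := h1 p hL
    exact hf.hol_of_hol h hn (by norm_num) hq hL hh
  · obtain ⟨q, hq, hh⟩ := h2 p hL
    exact hf.hol_of_hol h hn (by norm_num) hq hL hh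

theorem isConstant_add_const {f : ℂ → ℂ} {a : ℂ} (h : IsConstant fun z => f z + a) :
    IsConstant f := by
  obtain ⟨c, hc⟩ := h
  exact ⟨c - a, by filter_upwards [hc] with z hz; linear_combination hz⟩

theorem isConstant_sub_const {f : ℂ → ℂ} {a : ℂ} (h : IsConstant fun z => f z - a) :
    IsConstant f := by
  obtain ⟨c, hc⟩ := h
  exact ⟨c + a, by filter_upwards [hc] with z hz; linear_combination hz⟩

theorem quadratic_coeffs {f : ℂ → ℂ} (hm : Meromorphic f) (hc : ¬ IsConstant f) {a₀ a₁ a₂ : ℂ}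
    (h : ∀ᶠ z in codiscrete ℂ, a₂ * f z ^ 2 + a₁ * f z + a₀ = 0) : a₀ = 0 ∧ a₁ = 0 ∧ a₂ = 0 := by
  have h0 : (C a₂ * X ^ 2 + C a₁ * X + C a₀ : ℂ[X]) = 0 :=
    eq_zero_of_eventually_eval hm hc (by simpa using h)
  refine ⟨?_, ?_, ?_⟩
  · simpa [coeff_X, coeff_C, coeff_X_pow] using congrArg (fun P => coeff P 0) h0
  · simpa [coeff_X, coeff_C, coeff_X_pow] using congrArg (fun P => coeff P 1) h0
  · simpa [coeff_X, coeff_C, coeff_X_pow] using congrArg (fun P => coeff P 2) h0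

/-- Solutions all of whose poles have the same leading coefficient `1`. -/
theorem IsSol.isW_of_one_type {k b S T : ℂ} {y : ℂ → ℂ} (h : IsSol k b S T y) (hn : IsNF y)
    (hc : ¬ IsConstant y) (hp : ∀ p, ¬ Lead y p (-2) (-1)) :
    IsW (-20 * (S + b ^ 2)) (10 * (T + 2 * b * S + 4 * b ^ 3)) (fun z => y z - b) ∧
    k = 10 * (-128 * b ^ 4 - 88 * b ^ 2 * S - 5 * S ^ 2 - 18 * b * T) := by
  obtain ⟨p, hp'⟩ := h.exists_not_analyticAt hn hc
  have hL := (h.lead_of_not_analyticAt hn hp').resolve_right (hp p)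
  obtain ⟨a, ha⟩ := h.lead_sub_laurentHead (Or.inl rfl) hL
  have h1 : Hol (fun z => y z - (z - p) ^ (-2 : ℤ)) p := by
    refine (((Hol.of_lead ha (by norm_num)).add (Hol.const b p)).sub
      (Hol.of_lead ((lead_sq p).const_mul (b ^ 2 + S)) (by norm_num))).congr
      (Eventually.of_forall fun z => ?_)
    simp only [laurentHead]; ring
  obtain ⟨a₀, h2⟩ := exists_hol_deriv_deriv h1 (h.even hn (by norm_num) hL)
  have hD : DiffPoly y fun z => deriv (deriv y) z - 6 * y z ^ 2 + 12 * a₀ * y z :=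
    ((DiffPoly.self.deriv.deriv).sub ((DiffPoly.self.pow 2).const_mul 6)).add
      (DiffPoly.self.const_mul (12 * a₀))
  obtain ⟨γ, hγ⟩ := hD.isConstant_of_hol h hn (fun _ _ => ⟨p, hL, h2⟩)
    (fun q hq => absurd hq (hp q))
  have hw : Meromorphic fun z => y z - a₀ := h.mero.sub (.const a₀)
  have hwc : ¬ IsConstant fun z => y z - a₀ := fun h => hc (isConstant_sub_const h)
  have hder : deriv (fun z => y z - a₀) = deriv y := by ext z; exact deriv_sub_const a₀
  obtain ⟨g₃, hW⟩ := isW_of_deriv_deriv (g₂ := -2 * (γ - 6 * a₀ ^ 2)) hw hwc (by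
    filter_upwards [hγ] with z hz
    rw [hder]
    linear_combination hz)
  have hda : deriv (deriv (deriv (fun z => y z - a₀))) = deriv (deriv (deriv y)) := by rw [hder]
  set g₂ := -2 * (γ - 6 * a₀ ^ 2) with hg₂
  -- Inserting y = w + a₀ with w a Weierstrass function leaves a cubic in w. Its top coefficient
  -- gives a₀ = b, and the remaining ones give g₂, g₃ and the constraint on k.
  have hcub : ∀ᶠ z in codiscrete ℂ,
      (120 * b - 120 * a₀) * (y z - a₀) ^ 3
      + (-9 * g₂ - 30 * (6 * a₀ ^ 2 + 6 * S)) * (y z - a₀) ^ 2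
      + (-12 * g₃ - 30 * b * g₂ - 30 * (4 * a₀ ^ 3 + 12 * S * a₀ - 4 * T)) * (y z - a₀)
      + (-g₂ ^ 2 / 8 - 30 * b * g₃ - 30 * (a₀ ^ 4 + 6 * S * a₀ ^ 2 - 4 * T * a₀) - k) = 0 := by
    filter_upwards [hW.ode, hW.deriv_deriv, hW.deriv_deriv_deriv, h.ode] with z e1 e2 e3 e4
    rw [hder] at e1 e2
    rw [hda, hder] at e3
    rw [swift, e3, e2] at e4
    linear_combination e4 - (12 * (y z - a₀) + 30 * b) * e1
  have hpoly : (C (120 * b - 120 * a₀) * X ^ 3 + C (-9 * g₂ - 30 * (6 * a₀ ^ 2 + 6 * S)) * X ^ 2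
      + C (-12 * g₃ - 30 * b * g₂ - 30 * (4 * a₀ ^ 3 + 12 * S * a₀ - 4 * T)) * X
      + C (-g₂ ^ 2 / 8 - 30 * b * g₃ - 30 * (a₀ ^ 4 + 6 * S * a₀ ^ 2 - 4 * T * a₀) - k) : ℂ[X]) = 0 :=
    eq_zero_of_eventually_eval hw hwc (by
      filter_upwards [hcub] with z hz
      simpa only [eval_add, eval_mul, eval_C, eval_pow, eval_X] using hz)
  have c3 := congrArg (fun P => coeff P 3) hpoly
  have c2 := congrArg (fun P => coeff P 2) hpoly
  have c1 := congrArg (fun P => coeff P 1) hpoly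
  have c0 := congrArg (fun P => coeff P 0) hpoly
  simp only [coeff_add, coeff_C_mul, coeff_X_pow, coeff_X, coeff_C, coeff_zero] at c0 c1 c2 c3
  norm_num at c0 c1 c2 c3
  obtain rfl : a₀ = b := by linear_combination -(1 / 120) * c3
  have e2 : g₂ = -20 * (S + a₀ ^ 2) := by linear_combination -(1 / 9) * c2
  have e3 : g₃ = 10 * (T + 2 * a₀ * S + 4 * a₀ ^ 3) := by
    rw [e2] at c1; linear_combination -(1 / 12) * c1
  rw [e2, e3] at hW
  refine ⟨hW, ?_⟩
  rw [e2, e3] at c0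
  linear_combination -c0

/-! ### The second family -/

/-- Derivatives of `φ - κ / φ + r` for `φ = p - e`, `φ'² = 4 φ³ + 12 e φ² + 4 κ φ`. -/
theorem IsW.derivs_two {g₂ g₃ e κ r : ℂ} {p : ℂ → ℂ} (h : IsW g₂ g₃ p)
    (h₂ : g₂ = 12 * e ^ 2 - 4 * κ) (h₃ : g₃ = -8 * e ^ 3 + 4 * κ * e) :
    ∀ᶠ z in codiscrete ℂ, p z - e ≠ 0 ∧ ∃ D φ ψ : ℂ, φ = p z - e ∧ φ * ψ = κ ∧ ψ = κ / (p z - e) ∧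
      D ^ 2 = 4 * (φ + ψ) + 12 * e ∧
      deriv (fun z => p z - e - κ / (p z - e) + r) z = D * (φ + ψ) ∧
      deriv (deriv fun z => p z - e - κ / (p z - e) + r) z = (φ - ψ) * (6 * (φ + ψ) + 12 * e) ∧
      deriv (deriv (deriv fun z => p z - e - κ / (p z - e) + r)) z
        = D * ((φ + ψ) * (6 * (φ + ψ) + 12 * e) + 6 * (φ - ψ) ^ 2) := by
  have hne : ∀ᶠ z in codiscrete ℂ, p z - e ≠ 0 := by
    filter_upwards [eventually_ne_of_not_isConstant h.mero h.nonconst e] with z hz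
    exact sub_ne_zero.2 hz
  have d1 : ∀ᶠ z in codiscrete ℂ, deriv (fun z => p z - e - κ / (p z - e) + r) z
      = deriv p z * (1 + κ / (p z - e) ^ 2) := by
    filter_upwards [hne, eventually_codiscrete_analyticAt h.mero] with z h0 ha
    have h1 := ha.differentiableAt.hasDerivAt.sub_const e
    rw [((h1.fun_sub ((hasDerivAt_const z κ).fun_div h1 h0)).add_const r).deriv]
    field_simp; ring
  have d2 : ∀ᶠ z in codiscrete ℂ, deriv (deriv fun z => p z - e - κ / (p z - e) + r) z
      = 6 * (p z - e) ^ 2 - 6 * (κ / (p z - e)) ^ 2 + 12 * e * (p z - e - κ / (p z - e)) := by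
    filter_upwards [hne, eventually_codiscrete_analyticAt h.mero, eventually_nhds_of_codiscrete d1,
      h.ode, h.deriv_deriv] with z h0 ha hd e1 e2
    have h1 := ha.differentiableAt.hasDerivAt.sub_const e
    have h2 := ha.deriv.differentiableAt.hasDerivAt
    rw [EventuallyEq.deriv_eq hd, (h2.fun_mul (((hasDerivAt_const z κ).fun_div (h1.fun_pow 2)
      (pow_ne_zero 2 h0)).const_add 1)).deriv, e2, h₂]
    rw [h₂, h₃] at e1
    generalize deriv p z = D at *
    obtain ⟨φ, hφ⟩ : ∃ φ, φ = p z - e := ⟨_, rfl⟩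
    have hp : p z = φ + e := by rw [hφ]; ring
    rw [← hφ] at h0 ⊢
    rw [hp] at e1 ⊢
    field_simp
    push_cast
    linear_combination (-4 * φ * κ) * e1
  have d3 : ∀ᶠ z in codiscrete ℂ, deriv (deriv (deriv fun z => p z - e - κ / (p z - e) + r)) z
      = deriv p z * (12 * (p z - e) + 12 * κ ^ 2 / (p z - e) ^ 3
        + 12 * e * (1 + κ / (p z - e) ^ 2)) := by
    filter_upwards [hne, eventually_codiscrete_analyticAt h.mero,
      eventually_nhds_of_codiscrete d2] with z h0 ha hd
    have h1 := ha.differentiableAt.hasDerivAt.sub_const e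
    have h2 := (hasDerivAt_const z κ).fun_div h1 h0
    rw [EventuallyEq.deriv_eq hd, ((((h1.fun_pow 2).const_mul 6).fun_sub
      ((h2.fun_pow 2).const_mul 6)).fun_add ((h1.fun_sub h2).const_mul (12 * e))).deriv]
    generalize p z - e = φ at h0
    simp only [show (2 - 1 : ℕ) = 1 from rfl, pow_one]
    field_simp
    push_cast
    ring
  filter_upwards [hne, d1, d2, d3, h.ode] with z h0 e1 e2 e3 e4
  -- D is the logarithmic derivative φ'/φ. Thus φ' = Dφ and ψ' = -Dψ, and the involution φ ↔ ψ
  -- becomes visible.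
  refine ⟨h0, deriv p z / (p z - e), p z - e, κ / (p z - e), rfl, mul_div_cancel₀ κ h0, rfl,
    ?_, ?_, ?_, ?_⟩
  · rw [div_pow, e4, h₂, h₃]; field_simp; ring
  · rw [e1]; field_simp
  · rw [e2]; ring
  · rw [e3]; field_simp; ring

/-- The derivatives are polynomials in D, φ and ψ = κ/φ, and D occurs only squared. Replacing D² by
4(φ + ψ) + 12e leaves a Laurent polynomial in φ. -/
theorem IsW.swift_two {g₂ g₃ e κ r : ℂ} {p : ℂ → ℂ} (h : IsW g₂ g₃ p)
    (h₂ : g₂ = 12 * e ^ 2 - 4 * κ) (h₃ : g₃ = -8 * e ^ 3 + 4 * κ * e) (b S T : ℂ) :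
    ∀ᶠ z in codiscrete ℂ, swift b S T (fun z => p z - e - κ / (p z - e) + r) z
      = (120 * e + 120 * b) * (p z - e + κ / (p z - e)) ^ 3
        + (72 * e ^ 2 + 216 * κ + 360 * b * e - 180 * r ^ 2 - 180 * S)
          * (p z - e + κ / (p z - e)) ^ 2
        - 120 * r * (p z - e - κ / (p z - e)) ^ 3
        - 30 * (4 * r ^ 3 + 12 * S * r - 4 * T) * (p z - e - κ / (p z - e))
        + (288 * e ^ 2 * κ - 30 * (16 * κ ^ 2 - 24 * r ^ 2 * κ + r ^ 4 + 6 * S * (r ^ 2 - 4 * κ)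
          - 4 * T * r)) := by
  filter_upwards [h.derivs_two (r := r) h₂ h₃] with z hz
  obtain ⟨h0, D, φ, ψ, hφ, hφψ, hψ, hD, e1, e2, e3⟩ := hz
  rw [swift, e1, e2, e3, ← hψ, ← hφ, ← hφψ]
  linear_combination ((φ + ψ) * ((φ + ψ) * (6 * (φ + ψ) + 12 * e) + 6 * (φ - ψ) ^ 2)
    + 30 * b * (φ + ψ) ^ 2) * hD

theorem laurent_coeffs {f : ℂ → ℂ} (hm : Meromorphic f) (hc : ¬ IsConstant f)
    {κ a₀ a₂ a₃ d₁ d₃ : ℂ} (hκ : κ ≠ 0)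
    (h : ∀ᶠ z in codiscrete ℂ, a₃ * (f z + κ / f z) ^ 3 + a₂ * (f z + κ / f z) ^ 2
      + d₃ * (f z - κ / f z) ^ 3 + d₁ * (f z - κ / f z) + a₀ = 0) :
    a₃ = 0 ∧ d₃ = 0 ∧ a₂ = 0 ∧ d₁ = 0 ∧ a₀ = 0 := by
  -- This is the relation multiplied by f³.
  have hpoly : (C (a₃ + d₃) * X ^ 6 + C a₂ * X ^ 5 + C (3 * κ * a₃ - 3 * κ * d₃ + d₁) * X ^ 4
      + C (2 * κ * a₂ + a₀) * X ^ 3 + C (3 * κ ^ 2 * a₃ + 3 * κ ^ 2 * d₃ - κ * d₁) * X ^ 2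
      + C (a₂ * κ ^ 2) * X + C ((a₃ - d₃) * κ ^ 3) : ℂ[X]) = 0 := by
    refine eq_zero_of_eventually_eval hm hc ?_
    filter_upwards [h, eventually_ne_of_not_isConstant hm hc 0] with z hz h0
    simp only [eval_add, eval_mul, eval_C, eval_pow, eval_X]
    have : f z ^ 3 * (a₃ * (f z + κ / f z) ^ 3 + a₂ * (f z + κ / f z) ^ 2
      + d₃ * (f z - κ / f z) ^ 3 + d₁ * (f z - κ / f z) + a₀) = 0 := by rw [hz, mul_zero]
    rw [← this]
    field_simp
    ring
  have c6 := congrArg (fun P => coeff P 6) hpoly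
  have c5 := congrArg (fun P => coeff P 5) hpoly
  have c4 := congrArg (fun P => coeff P 4) hpoly
  have c3 := congrArg (fun P => coeff P 3) hpoly
  have c0 := congrArg (fun P => coeff P 0) hpoly
  simp only [coeff_add, coeff_C_mul, coeff_X_pow, coeff_X, coeff_C, coeff_zero] at c0 c3 c4 c5 c6
  norm_num [hκ] at c0 c3 c4 c5 c6
  have h1 : a₃ = 0 := by linear_combination (1 / 2) * c6 + (1 / 2) * c0
  have h2 : d₃ = 0 := by linear_combination (1 / 2) * c6 - (1 / 2) * c0
  subst h1 h2 c5
  refine ⟨rfl, rfl, rfl, by simpa using c4, by simpa using c3⟩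

theorem deriv_of_even {f : ℂ → ℂ} {a : ℂ} (h : ∀ z, f (a - z) = f z) (z : ℂ) :
    deriv f (a - z) = -deriv f z := by
  have h1 := congrFun (deriv_fun_comp_sub_left f a) z
  rw [funext h] at h1
  rw [h1]; ring

theorem deriv_deriv_of_even {f : ℂ → ℂ} {a : ℂ} (h : ∀ z, f (a - z) = f z) (z : ℂ) :
    deriv (deriv f) (a - z) = deriv (deriv f) z := by
  have h1 := congrFun (deriv_fun_comp_sub_left (deriv f) a) z
  rw [funext (deriv_of_even h)] at h1
  have h2 := congrFun (deriv_fun_neg (deriv f)) z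
  rw [h2] at h1
  linear_combination h1

/-- The second family: `y = (p + b) - σ / (2 (p + b))` with a Weierstrass function `p`. -/
def IsTwo (b σ : ℂ) (y : ℂ → ℂ) : Prop :=
  σ ≠ 0 ∧ ∃ p, IsW (12 * b ^ 2 - 2 * σ) (8 * b ^ 3 - 2 * σ * b) p ∧
    y =ᶠ[codiscrete ℂ] fun z => p z + b - σ / 2 / (p z + b)

/-- If 5S + 8b² = 0, then 2yy'' - 3y'² - 12by² has no poles and equals a constant g. In that case
(y'² + 12by² + g/3)/y³ is a first integral A, and leading terms give 4 = Aε at each pole, which is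
impossible for both signs. -/
theorem IsSol.sigma_ne_zero {k b S T : ℂ} {y : ℂ → ℂ} (h : IsSol k b S T y) (hn : IsNF y)
    {p q : ℂ} (hp : Lead y p (-2) 1) (hq : Lead y q (-2) (-1)) : 5 * S + 8 * b ^ 2 ≠ 0 := by
  intro h0
  have hnc : ¬ IsConstant y := by
    rintro ⟨a, ha⟩
    have h1 := ((Lead.const a p).weaken (by norm_num : (-2 : ℤ) < 0)).congr
      ((eventually_nhdsNE_of_codiscrete ha p).mono fun _ => Eq.symm)
    simpa using hp.unique h1
  have hG : DiffPoly y fun z =>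
      2 * y z * deriv (deriv y) z - 3 * deriv y z ^ 2 - 12 * b * y z ^ 2 :=
    (((DiffPoly.self.const_mul 2).mul DiffPoly.self.deriv.deriv).sub
      ((DiffPoly.self.deriv.pow 2).const_mul 3)).sub ((DiffPoly.self.pow 2).const_mul (12 * b))
  have h1 := h.hol_quadratic (Or.inl rfl) hp
  have h2 := h.hol_quadratic (Or.inr rfl) hq
  rw [h0] at h1 h2
  simp only [mul_zero, zero_mul, add_zero] at h1 h2
  obtain ⟨g, hg⟩ := hG.isConstant_of_hol h hn (fun _ _ => ⟨p, hp, h1⟩) (fun _ _ => ⟨q, hq, h2⟩)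
  have hne := eventually_ne_of_not_isConstant h.mero hnc 0
  have hm : Meromorphic fun z => (deriv y z ^ 2 + 12 * b * y z ^ 2 + g / 3) / y z ^ 3 := by
    have h1 : Meromorphic (deriv y) := h.mero.deriv
    exact (((h1.pow (n := 2)).add ((Meromorphic.const (12 * b)).mul (h.mero.pow (n := 2)))).add
      (.const (g / 3))).div (h.mero.pow (n := 3))
  obtain ⟨A, hA⟩ := isConstant_of_deriv hm (by
    filter_upwards [eventually_codiscrete_analyticAt h.mero, hg, hne] with z ha hz h0
    have d1 := ha.differentiableAt.hasDerivAt
    have d2 := ha.deriv.differentiableAt.hasDerivAt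
    rw [((((d2.fun_pow 2).fun_add ((d1.fun_pow 2).const_mul (12 * b))).add_const (g / 3)).fun_div
      (d1.fun_pow 3) (pow_ne_zero 3 h0)).deriv]
    simp only [show (2 - 1 : ℕ) = 1 from rfl, pow_one, show (3 - 1 : ℕ) = 2 from rfl]
    push_cast
    field_simp
    linear_combination deriv y z * hz)
  have key : ∀ x ε : ℂ, Lead y x (-2) ε → ε ^ 2 = 1 → 4 - A * ε = 0 := by
    intro x ε hx hε
    have t1 := (hx.deriv.pow 2).cast (m := -6) (b := 4 * ε ^ 2) (by norm_num) (by push_cast; ring)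
    have t2 := ((hx.pow 2).const_mul (12 * b)).weaken (m := -6) (by norm_num)
    have t3 := (Lead.const (g / 3) x).weaken (m := -6) (by norm_num)
    have t4 := ((hx.pow 3).const_mul (-A)).cast (m := -6) (b := -A * ε) (by norm_num)
      (by rw [pow_succ, hε]; ring)
    have := (((t1.add t2).add t3).add t4).eq_zero_of_eventually (by
      filter_upwards [eventually_nhdsNE_of_codiscrete hA x,
        eventually_nhdsNE_of_codiscrete hne x] with z e1 e2
      rw [div_eq_iff (pow_ne_zero 3 e2)] at e1
      linear_combination e1)
    rw [hε] at this
    linear_combination this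
  have k1 := key p 1 hp (by norm_num)
  have k2 := key q (-1) hq (by norm_num)
  have : (8 : ℂ) = 0 := by linear_combination k1 + k2
  norm_num at this

/-- Solutions with poles of both kinds are rational in a function `φ` with
`φ'² = 4 φ³ + 12 e φ² + 4 κ φ`. -/
theorem IsSol.exists_isW_of_two_types {k b S T : ℂ} {y : ℂ → ℂ} (h : IsSol k b S T y)
    (hn : IsNF y) {p q : ℂ} (hp : Lead y p (-2) 1) (hq : Lead y q (-2) (-1)) :
    ∃ e κ r w, κ ≠ 0 ∧ IsW (12 * e ^ 2 - 4 * κ) (-8 * e ^ 3 + 4 * κ * e) w ∧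
      y =ᶠ[codiscrete ℂ] fun z => w z - e - κ / (w z - e) + r := by
  have hσ := h.sigma_ne_zero hn hp hq
  -- This scaling makes the principal part of H equal to (z - x)⁻² at each pole x, whatever its
  -- sign.
  set c : ℂ := -1 / (8 * (5 * S + 8 * b ^ 2)) with hc
  have hc1 : c * (8 * (5 * S + 8 * b ^ 2)) = -1 := by rw [hc]; field_simp
  obtain ⟨H, hH⟩ : ∃ H : ℂ → ℂ, H = fun z => c * (2 * y z * deriv (deriv y) z - 3 * deriv y z ^ 2
    - 12 * b * y z ^ 2) := ⟨_, rfl⟩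
  have hHD : DiffPoly y H := by
    rw [hH]
    exact ((((DiffPoly.self.const_mul 2).mul DiffPoly.self.deriv.deriv).sub
      ((DiffPoly.self.deriv.pow 2).const_mul 3)).sub
        ((DiffPoly.self.pow 2).const_mul (12 * b))).const_mul c
  have hHp : ∀ x ε : ℂ, (ε = 1 ∨ ε = -1) → Lead y x (-2) ε →
      Hol (fun z => H z - (z - x) ^ (-2 : ℤ)) x := by
    intro x ε hε hx
    refine ((h.hol_quadratic hε hx).const_mul c).congr (Eventually.of_forall fun z => ?_)
    simp only [hH]
    linear_combination (z - x) ^ (-2 : ℤ) * hc1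
  have hye : ∀ x ε : ℂ, (ε = 1 ∨ ε = -1) → Lead y x (-2) ε →
      Hol (fun z => y z - ε * (z - x) ^ (-2 : ℤ)) x := by
    intro x ε hε hx
    obtain ⟨a, ha⟩ := h.lead_sub_laurentHead hε hx
    refine (((Hol.of_lead ha (by norm_num)).add (Hol.const (ε * b) x)).sub
      (Hol.of_lead ((lead_sq x).const_mul (ε * (b ^ 2 + S))) (by norm_num))).congr
      (Eventually.of_forall fun z => ?_)
    simp only [laurentHead]; ring
  have heven : ∀ x ε : ℂ, (ε = 1 ∨ ε = -1) → Lead y x (-2) ε → ∀ z, y (2 * x - z) = y z := by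
    intro x ε hε hx
    exact h.even hn (by rcases hε with rfl | rfl <;> norm_num) hx
  have hHe : ∀ x ε : ℂ, (ε = 1 ∨ ε = -1) → Lead y x (-2) ε → ∀ z, H (2 * x - z) = H z := by
    intro x ε hε hx z
    simp only [hH]
    rw [deriv_deriv_of_even (heven x ε hε hx), deriv_of_even (heven x ε hε hx),
      heven x ε hε hx]
    ring
  -- The principal parts of H and y add or cancel: P keeps the poles with ε = 1, Q those with ε =
  -- -1.
  obtain ⟨P, hP⟩ : ∃ P : ℂ → ℂ, P = fun z => 1 / 2 * (H z + y z) := ⟨_, rfl⟩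
  obtain ⟨Q, hQ⟩ : ∃ Q : ℂ → ℂ, Q = fun z => 1 / 2 * (H z - y z) := ⟨_, rfl⟩
  have hPD : DiffPoly y P := by rw [hP]; exact (hHD.add .self).const_mul (1 / 2)
  have hQD : DiffPoly y Q := by rw [hQ]; exact (hHD.sub .self).const_mul (1 / 2)
  have hPp : Hol (fun z => P z - (z - p) ^ (-2 : ℤ)) p := by
    refine (((hHp p 1 (Or.inl rfl) hp).add (hye p 1 (Or.inl rfl) hp)).const_mul (1 / 2)).congr
      (Eventually.of_forall fun z => ?_)
    simp only [hP]; ring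
  have hQp : Hol Q p := by
    refine (((hHp p 1 (Or.inl rfl) hp).sub (hye p 1 (Or.inl rfl) hp)).const_mul (1 / 2)).congr
      (Eventually.of_forall fun z => ?_)
    simp only [hQ]; ring
  have hQq : Hol (fun z => Q z - (z - q) ^ (-2 : ℤ)) q := by
    refine (((hHp q (-1) (Or.inr rfl) hq).sub (hye q (-1) (Or.inr rfl) hq)).const_mul (1 / 2)).congr
      (Eventually.of_forall fun z => ?_)
    simp only [hQ]; ring
  have hPq : Hol P q := by
    refine (((hHp q (-1) (Or.inr rfl) hq).add (hye q (-1) (Or.inr rfl) hq)).const_mul (1 / 2)).congr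
      (Eventually.of_forall fun z => ?_)
    simp only [hP]; ring
  have hPe : ∀ x ε : ℂ, (ε = 1 ∨ ε = -1) → Lead y x (-2) ε → ∀ z, P (2 * x - z) = P z := by
    intro x ε hε hx z
    simp only [hP]; rw [hHe x ε hε hx, heven x ε hε hx]
  have hQe : ∀ x ε : ℂ, (ε = 1 ∨ ε = -1) → Lead y x (-2) ε → ∀ z, Q (2 * x - z) = Q z := by
    intro x ε hε hx z
    simp only [hQ]; rw [hHe x ε hε hx, heven x ε hε hx]
  -- the equation for `P`
  obtain ⟨a₀, hPa⟩ := exists_hol_deriv_deriv hPp (hPe p 1 (Or.inl rfl) hp)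
  have hD1 : DiffPoly y fun z => deriv (deriv P) z - 6 * P z ^ 2 + 12 * a₀ * P z :=
    (hPD.deriv.deriv.sub ((hPD.pow 2).const_mul 6)).add (hPD.const_mul (12 * a₀))
  obtain ⟨γ, hγ⟩ := hD1.isConstant_of_hol h hn (fun _ _ => ⟨p, hp, hPa⟩) (fun _ _ => ⟨q, hq,
    (hPq.deriv.deriv.sub ((hPq.pow 2).const_mul 6)).add (hPq.const_mul (12 * a₀))⟩)
  -- the relation between `P` and `Q`
  obtain ⟨v, hv⟩ := hQp
  obtain ⟨u, hu⟩ := hPq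
  have hD2 : DiffPoly y fun z => (P z - u) * (Q z - v) :=
    (hPD.sub (.const u)).mul (hQD.sub (.const v))
  -- At p the double pole of P meets a double zero of Q - v, and at q the roles are exchanged, so
  -- the product has no poles.
  obtain ⟨κ, hκ⟩ := hD2.isConstant_of_hol h hn
    (fun _ _ => ⟨p, hp, by
      refine ((hol_mul_sub hPp hv (hQe p 1 (Or.inl rfl) hp)).sub
        ((Hol.const u p).mul (Hol.sub ⟨v, hv⟩ (.const v p)))).congr
        (Eventually.of_forall fun z => ?_)
      ring⟩)
    (fun _ _ => ⟨q, hq, by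
      refine ((hol_mul_sub hQq hu (hPe q (-1) (Or.inr rfl) hq)).sub
        ((Hol.const v q).mul (Hol.sub ⟨u, hu⟩ (.const u q)))).congr
        (Eventually.of_forall fun z => ?_)
      ring⟩)
  have hPm : Meromorphic P := hPD.meromorphic h.mero
  have hQm : Meromorphic Q := hQD.meromorphic h.mero
  have hPL : Lead P p (-2) 1 := by
    obtain ⟨a, ha⟩ := hPp
    refine (((Lead.zpow p (-2)).add (ha.weaken (m := -2) (by norm_num))).cast rfl
      (add_zero 1)).congr (Eventually.of_forall fun z => ?_)
    ring
  have hQL : Lead Q q (-2) 1 := by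
    obtain ⟨a, ha⟩ := hQq
    refine (((Lead.zpow q (-2)).add (ha.weaken (m := -2) (by norm_num))).cast rfl
      (add_zero 1)).congr (Eventually.of_forall fun z => ?_)
    ring
  have hnc : ∀ (f : ℂ → ℂ) (x : ℂ), Lead f x (-2) 1 → ¬ IsConstant f := by
    rintro f x hx ⟨a, ha⟩
    have h1 := ((Lead.const a x).weaken (by norm_num : (-2 : ℤ) < 0)).congr
      ((eventually_nhdsNE_of_codiscrete ha x).mono fun _ => Eq.symm)
    simpa using hx.unique h1
  have hPne := eventually_ne_of_not_isConstant hPm (hnc P p hPL) u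
  have hQne := eventually_ne_of_not_isConstant hQm (hnc Q q hQL) v
  have hκ0 : κ ≠ 0 := by
    rintro rfl
    obtain ⟨z, e1, e2, e3⟩ := (hκ.and (hPne.and hQne)).exists
    exact (mul_ne_zero (sub_ne_zero.2 e2) (sub_ne_zero.2 e3)) e1
  -- integrate
  set e : ℂ := u - a₀ with he
  have hder : deriv (fun z => P z - a₀) = deriv P := by ext z; exact deriv_sub_const a₀
  obtain ⟨g₃, hW⟩ := isW_of_deriv_deriv (p := fun z => P z - a₀) (g₂ := 12 * a₀ ^ 2 - 2 * γ)
    (hPm.sub (.const a₀)) (fun h => hnc P p hPL (isConstant_sub_const h)) (by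
      filter_upwards [hγ] with z hz
      rw [hder]
      linear_combination hz)
  -- expand at `q`
  have hφ : Lead (fun z => P z - u) q 2 κ := by
    have h1 : Lead (fun z => Q z - v) q (-2) 1 :=
      (hQL.sub ((Lead.const v q).weaken (m := -2) (by norm_num))).cast rfl (sub_zero 1)
    refine (((Lead.const κ q).mul (h1.inv one_ne_zero)).cast (by norm_num) (by norm_num)).congr ?_
    filter_upwards [eventually_nhdsNE_of_codiscrete hκ q,
      eventually_nhdsNE_of_codiscrete hQne q] with z e1 e2
    have e3 := sub_ne_zero.2 e2
    rw [← e1]; field_simp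
  have hφ1 : Lead (deriv P) q 1 (2 * κ) := by
    have := hφ.deriv
    have hd : deriv (fun z => P z - u) = deriv P := by ext z; exact deriv_sub_const u
    rw [hd] at this
    exact this.cast (by norm_num) (by norm_num)
  have hφ2 : Lead (deriv (deriv P)) q 0 (2 * κ) := hφ1.deriv.cast (by norm_num) (by norm_num)
  -- At q the function P - u and its derivative vanish and the second derivative is 2κ. The second
  -- order equation, and below it the first order one, then express both invariants through e and κ.
  have eq1 : 2 * κ = 6 * e ^ 2 - (12 * a₀ ^ 2 - 2 * γ) / 2 := by
    have t1 := ((hφ2.sub ((hφ.pow 2).const_mul 6 |>.weaken (m := 0) (by norm_num))).sub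
      (hφ.const_mul (12 * e) |>.weaken (m := 0) (by norm_num))).sub
      (Lead.const (6 * e ^ 2 - (12 * a₀ ^ 2 - 2 * γ) / 2) q)
    have := t1.eq_zero_of_eventually (by
      filter_upwards [eventually_nhdsNE_of_codiscrete hγ q] with z hz
      rw [he]
      linear_combination hz)
    linear_combination this
  have eq2 : g₃ = 4 * e ^ 3 - (12 * a₀ ^ 2 - 2 * γ) * e := by
    have t1 := ((((hφ1.pow 2).weaken (m := 0) (by norm_num)).sub
      ((hφ.pow 3).const_mul 4 |>.weaken (m := 0) (by norm_num))).sub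
      ((hφ.pow 2).const_mul (12 * e) |>.weaken (m := 0) (by norm_num))).sub
      (hφ.const_mul (12 * e ^ 2 - (12 * a₀ ^ 2 - 2 * γ)) |>.weaken (m := 0) (by norm_num)) |>.sub
      (Lead.const (4 * e ^ 3 - (12 * a₀ ^ 2 - 2 * γ) * e - g₃) q)
    have := t1.eq_zero_of_eventually (by
      filter_upwards [eventually_nhdsNE_of_codiscrete hW.ode q] with z hz
      rw [hder] at hz
      rw [he]
      linear_combination hz)
    linear_combination this
  have e2' : 12 * a₀ ^ 2 - 2 * γ = 12 * e ^ 2 - 4 * κ := by linear_combination 2 * eq1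
  rw [eq2, e2'] at hW
  refine ⟨e, κ, u - v, fun z => P z - a₀, hκ0, ?_, ?_⟩
  · convert hW using 1; ring
  · filter_upwards [hκ, hPne] with z e1 e2
    have e3 := sub_ne_zero.2 e2
    have e4 : P z - a₀ - e = P z - u := by rw [he]; ring
    rw [e4, ← e1]
    field_simp
    simp only [hP, hQ]; ring

theorem IsSol.two_types {k b S T : ℂ} {y : ℂ → ℂ} (h : IsSol k b S T y)
    (hn : IsNF y) {p q : ℂ} (hp : Lead y p (-2) 1) (hq : Lead y q (-2) (-1)) :
    T = 0 ∧ k = -(16 / 3) * (8 * b ^ 2 + 5 * S) * (11 * b ^ 2 - 10 * S) ∧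
      IsTwo b ((5 * S + 8 * b ^ 2) / 3) y := by
  have hσ := h.sigma_ne_zero hn hp hq
  obtain ⟨e, κ, r, w, hκ, hw, hy⟩ := h.exists_isW_of_two_types hn hp hq
  have hsw := hw.swift_two (r := r) rfl rfl b S T
  have hφm : Meromorphic fun z => w z - e := hw.mero.sub (.const e)
  have hφc : ¬ IsConstant fun z => w z - e := fun h => hw.nonconst (isConstant_sub_const h)
  have hall : ∀ᶠ z in codiscrete ℂ,
      (120 * e + 120 * b) * (w z - e + κ / (w z - e)) ^ 3
        + (72 * e ^ 2 + 216 * κ + 360 * b * e - 180 * r ^ 2 - 180 * S)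
          * (w z - e + κ / (w z - e)) ^ 2
        + (-120 * r) * (w z - e - κ / (w z - e)) ^ 3
        + (-30 * (4 * r ^ 3 + 12 * S * r - 4 * T)) * (w z - e - κ / (w z - e))
        + (288 * e ^ 2 * κ - 30 * (16 * κ ^ 2 - 24 * r ^ 2 * κ + r ^ 4 + 6 * S * (r ^ 2 - 4 * κ)
          - 4 * T * r) - k) = 0 := by
    filter_upwards [h.ode, hsw, eventually_nhds_of_codiscrete hy] with z e1 e2 e3
    rw [swift_congr e3, e2] at e1
    linear_combination e1
  -- The five coefficients give, in this order, e = -b, r = 0, the value of κ, T = 0 and the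
  -- constraint on k.
  obtain ⟨c3, d3, c2, d1, c0⟩ := laurent_coeffs hφm hφc hκ hall
  have hr : r = 0 := by linear_combination -(1 / 120) * d3
  have he : e = -b := by linear_combination (1 / 120) * c3
  subst hr he
  have hT : T = 0 := by linear_combination (1 / 120) * d1
  subst hT
  have hκ2 : κ = (5 * S + 8 * b ^ 2) / 3 / 2 := by linear_combination (1 / 216) * c2
  refine ⟨rfl, ?_, ?_, w, ?_, ?_⟩
  · rw [hκ2] at c0; linear_combination -c0
  · exact div_ne_zero hσ (by norm_num)
  · convert hw using 1 <;> rw [hκ2] <;> ring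
  · filter_upwards [hy] with z hz
    rw [hz, hκ2]; simp

theorem IsTwo.isSol {b S : ℂ} {y : ℂ → ℂ} (h : IsTwo b ((5 * S + 8 * b ^ 2) / 3) y) :
    IsSol (-(16 / 3) * (8 * b ^ 2 + 5 * S) * (11 * b ^ 2 - 10 * S)) b S 0 y := by
  obtain ⟨-, w, hw, hy⟩ := h
  refine IsSol.congr (y := fun z => w z + b - (5 * S + 8 * b ^ 2) / 3 / 2 / (w z + b)) ?_ hy.symm
  have hwb : Meromorphic fun z => w z + b := hw.mero.add (.const b)
  refine ⟨hwb.sub ((Meromorphic.const _).div hwb), ?_⟩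
  have := hw.swift_two (e := -b) (κ := (5 * S + 8 * b ^ 2) / 3 / 2) (r := 0) (by ring) (by ring)
    b S 0
  simp only [sub_neg_eq_add, add_zero] at this
  filter_upwards [this] with z hz
  rw [hz]; ring

theorem IsTwo.not_isConstant {b σ : ℂ} {y : ℂ → ℂ} (h : IsTwo b σ y) : ¬ IsConstant y := by
  obtain ⟨hσ, w, hw, hy⟩ := h
  rintro ⟨a, ha⟩
  have h1 := laurent_coeffs (f := fun z => w z + b) (hw.mero.add (.const b))
    (fun h => hw.nonconst (isConstant_add_const h)) (κ := σ / 2) (a₀ := -a) (a₂ := 0) (a₃ := 0)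
    (d₁ := 1) (d₃ := 0) (div_ne_zero hσ two_ne_zero) (by
      filter_upwards [ha, hy] with z e1 e2
      rw [e2] at e1
      linear_combination e1)
  exact one_ne_zero h1.2.2.2.1

/-- The nonconstant solutions of the normalised equation. -/
theorem IsSol.classification {k b S T : ℂ} {y : ℂ → ℂ} (h : IsSol k b S T y)
    (hc : ¬ IsConstant y) :
    (IsW (-20 * (S + b ^ 2)) (10 * (T + 2 * b * S + 4 * b ^ 3)) (fun z => y z - b) ∧
      k = 10 * (-128 * b ^ 4 - 88 * b ^ 2 * S - 5 * S ^ 2 - 18 * b * T)) ∨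
    (IsW (-20 * (S + b ^ 2)) (10 * (-T + 2 * b * S + 4 * b ^ 3)) (fun z => -y z - b) ∧
      k = 10 * (-128 * b ^ 4 - 88 * b ^ 2 * S - 5 * S ^ 2 + 18 * b * T)) ∨
    (T = 0 ∧ k = -(16 / 3) * (8 * b ^ 2 + 5 * S) * (11 * b ^ 2 - 10 * S) ∧
      IsTwo b ((5 * S + 8 * b ^ 2) / 3) y) := by
  obtain ⟨Y, hY, hyY⟩ := exists_isNF h.mero
  have hS := h.congr hyY
  have hYc : ¬ IsConstant Y := fun h' => hc (h'.congr hyY.symm)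
  by_cases h1 : ∃ q, Lead Y q (-2) (-1)
  · by_cases h2 : ∃ p, Lead Y p (-2) 1
    · obtain ⟨q, hq⟩ := h1
      obtain ⟨p, hp⟩ := h2
      obtain ⟨e1, e2, e3, w, hw, he⟩ := hS.two_types hY hp hq
      exact Or.inr (Or.inr ⟨e1, e2, e3, w, hw, hyY.trans he⟩)
    · push Not at h2
      refine Or.inr (Or.inl ?_)
      -- Only ε = -1 occurs. The function -Y solves the equation with -T in place of T and has only
      -- poles with ε = 1.
      have hneg : IsNF fun z => -Y z := by
        intro z
        have := (meromorphicNFAt_mul_iff_right (f := Y) (g := fun _ => (-1 : ℂ)) (x := z)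
          analyticAt_const (by norm_num)).2 (hY z)
        have e : (fun z => -Y z) = (fun _ => (-1 : ℂ)) * Y := by funext z; simp
        rwa [e]
      obtain ⟨e1, e2⟩ := hS.neg.isW_of_one_type hneg
        (fun ⟨a, ha⟩ => hYc ⟨-a, by filter_upwards [ha] with z hz; linear_combination -hz⟩)
        (fun p hp => h2 p (by simpa using hp.neg))
      refine ⟨e1.congr ?_, by rw [e2]; ring⟩
      filter_upwards [hyY] with z hz
      rw [hz]
  · push Not at h1
    left
    obtain ⟨e1, e2⟩ := hS.isW_of_one_type hY hYc h1
    refine ⟨e1.congr ?_, e2⟩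
    filter_upwards [hyY] with z hz
    rw [hz]

/-! ### Existence of a global solution of the Weierstrass equation -/

/-- The function s is the local inverse of t(x) = ∫₀ˣ q^(-1/2), with the branch of the root that
equals 1 at 0. From t(s(z)) = z follows s'² = q(s). -/
theorem exists_inverse_integral {q : ℂ → ℂ} (hq : AnalyticAt ℂ q 0) (hq0 : q 0 = 1) :
    ∃ s : ℂ → ℂ, AnalyticAt ℂ s 0 ∧ s 0 = 0 ∧ deriv s 0 = 1 ∧
      ∀ᶠ z in 𝓝 0, deriv s z ^ 2 = q (s z) := by
  set h : ℂ → ℂ := fun x => Complex.exp (-(Complex.log (q x)) / 2) with hh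
  have hsl : q 0 ∈ Complex.slitPlane := by rw [hq0]; exact Complex.one_mem_slitPlane
  have hha : AnalyticAt ℂ h 0 := by
    have := hq.clog hsl
    fun_prop
  have h0 : h 0 = 1 := by simp [hh, hq0]
  have hsq : ∀ᶠ x in 𝓝 0, h x ^ 2 * q x = 1 := by
    filter_upwards [hq.continuousAt.eventually_ne (by rw [hq0]; exact one_ne_zero : q 0 ≠ 0)]
      with x hx
    rw [hh]
    simp only
    rw [← Complex.exp_nat_mul]
    nth_rewrite 2 [← Complex.exp_log hx]
    rw [← Complex.exp_add]
    convert Complex.exp_zero using 2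
    push_cast; ring
  obtain ⟨ρ, hρ, hball⟩ := Metric.eventually_nhds_iff_ball.1 hha.eventually_analyticAt
  obtain ⟨t, ht⟩ := DifferentiableOn.isExactOn_ball (c := 0) (r := ρ) (f := h)
    fun x hx => (hball x hx).differentiableAt.differentiableWithinAt
  have hta : AnalyticAt ℂ t 0 := by
    refine DifferentiableOn.analyticAt (s := Metric.ball 0 ρ)
      (fun x hx => (ht x hx).differentiableAt.differentiableWithinAt) (Metric.ball_mem_nhds 0 hρ)
  set T : ℂ → ℂ := fun x => t x - t 0 with hT
  have hTa : AnalyticAt ℂ T 0 := hta.sub analyticAt_const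
  have hT0 : T 0 = 0 := by simp [hT]
  have hTd : ∀ x ∈ Metric.ball (0 : ℂ) ρ, HasDerivAt T (h x) x := fun x hx =>
    (ht x hx).sub_const _
  have hT1 : HasStrictDerivAt T 1 0 := by
    have := hTa.hasStrictDerivAt
    rwa [(hTd 0 (Metric.mem_ball_self hρ)).deriv, h0] at this
  set s := hT1.localInverse T 1 0 one_ne_zero with hs
  have hs1 : HasStrictDerivAt s 1 0 := by
    have := hT1.to_localInverse one_ne_zero
    rwa [hT0, inv_one] at this
  have hs0 : s 0 = 0 := by
    have := HasStrictFDerivAt.localInverse_apply_image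
      (hT1.hasStrictFDerivAt_equiv one_ne_zero)
    rw [hT0] at this
    exact this
  have hTs : ∀ᶠ z in 𝓝 0, T (s z) = z := by
    have := hT1.eventually_right_inverse one_ne_zero
    rwa [hT0] at this
  have hsa : AnalyticAt ℂ s 0 := by
    have hc : ContDiffAt ℂ 1 T 0 := hTa.contDiffAt
    have h1 := hc.to_localInverse (f' := ContinuousLinearEquiv.unitsEquivAut ℂ (Units.mk0 1 one_ne_zero))
      (hT1.hasStrictFDerivAt_equiv one_ne_zero).hasFDerivAt one_ne_zero
    rw [hT0] at h1
    have h2 : ContDiffAt ℂ 1 s 0 := h1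
    obtain ⟨_, u, hu, -, hd⟩ := contDiffAt_one_iff.1 h2
    exact DifferentiableOn.analyticAt (s := u)
      (fun x hx => (hd x hx).differentiableAt.differentiableWithinAt) hu
  refine ⟨s, hsa, hs0, hs1.hasDerivAt.deriv, ?_⟩
  have e1 : ∀ᶠ z in 𝓝 0, s z ∈ Metric.ball (0 : ℂ) ρ := by
    refine hsa.continuousAt.eventually_mem ?_
    rw [hs0]; exact Metric.ball_mem_nhds 0 hρ
  have e2 : ∀ᶠ z in 𝓝 0, h (s z) ^ 2 * q (s z) = 1 := by
    have : Tendsto s (𝓝 0) (𝓝 0) := by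
      have := hsa.continuousAt.tendsto; rwa [hs0] at this
    exact this.eventually hsq
  filter_upwards [e1, e2, eventually_eventually_nhds.2 hTs, hsa.eventually_analyticAt]
    with z h1 h2 h3 h4
  have h5 := HasDerivAt.comp z (hTd (s z) h1) h4.differentiableAt.hasDerivAt
  have h6 : HasDerivAt (T ∘ s) 1 z := (hasDerivAt_id z).congr_of_eventuallyEq h3
  have h7 := h5.unique h6
  linear_combination -(deriv s z) ^ 2 * h2 + q (s z) * (h (s z) * deriv s z + 1) * h7

/-- A solution of the Weierstrass equation on a disc about `0`, with a pole at `0`. -/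
structure IsLocalW (g₂ g₃ : ℂ) (r : ℝ) (p : ℂ → ℂ) : Prop where
  mero : MeromorphicOn p (Metric.ball 0 r)
  lead : Lead p 0 (-2) 1
  ode : ∀ x ∈ Metric.ball (0 : ℂ) r, ∀ᶠ z in 𝓝[≠] x,
    deriv p z ^ 2 = 4 * p z ^ 3 - g₂ * p z - g₃

theorem eventually_nhds_of_nhdsNE {p : ℂ → Prop} {x : ℂ} (h : ∀ᶠ z in 𝓝[≠] x, p z) :
    ∀ᶠ z in 𝓝[≠] x, ∀ᶠ w in 𝓝 z, p w := by
  have h1 := eventually_eventually_nhdsWithin.2 h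
  filter_upwards [h1, self_mem_nhdsWithin] with z hz h0
  rwa [(isOpen_compl_singleton (x := x)).nhdsWithin_eq h0] at hz

/-- The substitution p = 1/s² turns the Weierstrass equation into s'² = 1 - (g₂/4)s⁴ - (g₃/4)s⁶,
which is regular at s = 0. -/
theorem exists_isLocalW (g₂ g₃ : ℂ) : ∃ r > 0, ∃ p, IsLocalW g₂ g₃ r p := by
  obtain ⟨s, hs, hs0, hs1, hode⟩ := exists_inverse_integral
    (q := fun x => 1 - g₂ / 4 * x ^ 4 - g₃ / 4 * x ^ 6) (by fun_prop) (by simp)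
  have hL : Lead s 0 1 1 := by
    have h1 := Lead.of_analyticAt hs
    rw [hs0] at h1
    obtain ⟨a, ha⟩ := h1.lift
    have h2 := ha.deriv
    have h3 := Lead.of_analyticAt hs.deriv
    norm_num at h2
    rw [hs1] at h3
    rwa [h2.unique h3] at ha
  have hne : ∀ᶠ z in 𝓝[≠] 0, s z ≠ 0 := by
    rcases hL.meromorphicAt.eventually_eq_zero_or_eventually_ne_zero with h | h
    · exact absurd (hL.eq_zero_of_eventually h) one_ne_zero
    · exact h
  have hp : ∀ᶠ z in 𝓝[≠] 0, AnalyticAt ℂ (fun z => (s z ^ 2)⁻¹) z ∧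
      deriv (fun z => (s z ^ 2)⁻¹) z ^ 2
        = 4 * ((s z ^ 2)⁻¹) ^ 3 - g₂ * (s z ^ 2)⁻¹ - g₃ := by
    filter_upwards [hne, nhdsWithin_le_nhds hode, nhdsWithin_le_nhds hs.eventually_analyticAt]
      with z h0 h1 h2
    refine ⟨(h2.fun_pow 2).fun_inv (pow_ne_zero 2 h0), ?_⟩
    rw [((h2.differentiableAt.hasDerivAt.fun_pow 2).fun_inv (pow_ne_zero 2 h0)).deriv]
    simp only [show (2 - 1 : ℕ) = 1 from rfl, pow_one]
    generalize deriv s z = D at *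
    generalize s z = x at *
    push_cast
    field_simp
    linear_combination 4 * h1
  have hp' := hp
  rw [eventually_nhdsWithin_iff, Metric.eventually_nhds_iff_ball] at hp
  obtain ⟨r, hr, hball⟩ := hp
  have hLp : Lead (fun z => (s z ^ 2)⁻¹) 0 (-2) 1 :=
    ((hL.pow 2).inv (by norm_num)).cast (by norm_num) (by norm_num)
  refine ⟨r, hr, fun z => (s z ^ 2)⁻¹, ?_, hLp, ?_⟩
  · intro x hx
    rcases eq_or_ne x 0 with rfl | h0
    · exact hLp.meromorphicAt
    · exact (hball x hx h0).1.meromorphicAt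
  · intro x hx
    rcases eq_or_ne x 0 with rfl | h0
    · filter_upwards [hp'] with z hz using hz.2
    · have : ∀ᶠ z in 𝓝 x, z ∈ Metric.ball (0 : ℂ) r ∧ z ≠ 0 :=
        Filter.inter_mem (Metric.isOpen_ball.mem_nhds hx) (isOpen_ne.mem_nhds h0)
      filter_upwards [nhdsWithin_le_nhds this] with z hz
      exact (hball z hz.1 hz.2).2

theorem Lead.comp_half {f : ℂ → ℂ} {n : ℤ} {a : ℂ} (hf : Lead f 0 n a) :
    Lead (fun z => f (z / 2)) 0 n (a / 2 ^ n) := by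
  obtain ⟨g, h1, h2, h3⟩ := hf
  refine ⟨fun z => g (z / 2) / 2 ^ n, ?_, by simp [h2], ?_⟩
  · have h1' : AnalyticAt ℂ g (0 / 2) := by simpa using h1
    exact (AnalyticAt.fun_comp (g := g) (f := fun z => z / 2) h1'
      (analyticAt_id.div_const)).div_const
  · have : Tendsto (fun w : ℂ => w / 2) (𝓝[≠] 0) (𝓝[≠] 0) := by
      refine tendsto_nhdsWithin_of_tendsto_nhds_of_eventually_within _ ?_ ?_
      · have := ((continuous_id.div_const (2 : ℂ)).tendsto (0 : ℂ))
        simp only [id, zero_div] at this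
        exact this.mono_left nhdsWithin_le_nhds
      · filter_upwards [self_mem_nhdsWithin] with w hw using by simpa using hw
    filter_upwards [this.eventually h3] with z hz
    rw [hz, sub_zero, sub_zero, div_zpow]; ring

/-- The duplication formula for the Weierstrass function. -/
def duplicate (g₂ g₃ : ℂ) (p : ℂ → ℂ) (z : ℂ) : ℂ :=
  (p (z / 2) ^ 4 + g₂ / 2 * p (z / 2) ^ 2 + 2 * g₃ * p (z / 2) + g₂ ^ 2 / 16)
    / (4 * p (z / 2) ^ 3 - g₂ * p (z / 2) - g₃)

namespace IsLocalW

variable {g₂ g₃ : ℂ} {r : ℝ} {p : ℂ → ℂ}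

theorem deriv_ne_zero (h : IsLocalW g₂ g₃ r p) {x : ℂ} (hx : x ∈ Metric.ball 0 r) :
    ∀ᶠ z in 𝓝[≠] x, deriv p z ≠ 0 := by
  have h0 : meromorphicOrderAt (deriv p) 0 ≠ ⊤ := by
    rw [h.lead.deriv.order_eq (by norm_num)]
    exact WithTop.coe_ne_top
  have h1 := h.mero.deriv.meromorphicOrderAt_ne_top_of_isPreconnected
    (convex_ball (0 : ℂ) r).isPreconnected
    (Metric.mem_ball_self (lt_of_le_of_lt dist_nonneg hx)) hx h0
  exact (meromorphicOrderAt_ne_top_iff_eventually_ne_zero (h.mero x hx).deriv).1 h1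

/-- The duplication formula expresses a solution at z through p(z/2), so the radius doubles. That it
solves the equation is an algebraic identity modulo the equation for p at z/2. -/
theorem duplicate (h : IsLocalW g₂ g₃ r p) :
    IsLocalW g₂ g₃ (2 * r) (duplicate g₂ g₃ p) := by
  have hmem : ∀ x ∈ Metric.ball (0 : ℂ) (2 * r), x / 2 ∈ Metric.ball (0 : ℂ) r := by
    intro x hx
    rw [mem_ball_zero_iff] at hx ⊢
    rw [norm_div, Complex.norm_ofNat]; linarith
  have hhalf : ∀ x : ℂ, Tendsto (fun w : ℂ => w / 2) (𝓝[≠] x) (𝓝[≠] (x / 2)) := by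
    intro x
    refine tendsto_nhdsWithin_of_tendsto_nhds_of_eventually_within _ ?_ ?_
    · exact ((continuous_id.div_const (2 : ℂ)).tendsto x).mono_left nhdsWithin_le_nhds
    · filter_upwards [self_mem_nhdsWithin] with w hw
      simp only [Set.mem_compl_iff, Set.mem_singleton_iff] at hw ⊢
      exact fun h' => hw (by linear_combination 2 * h')
  refine ⟨?_, ?_, ?_⟩
  · intro x hx
    have h1 : MeromorphicAt (fun z => p (z / 2)) x :=
      MeromorphicAt.comp_analyticAt (f := p) (g := fun z => z / 2) (h.mero _ (hmem x hx))
        analyticAt_id.div_const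
    have hk : ∀ a : ℂ, MeromorphicAt (fun _ : ℂ => a) x := fun a => MeromorphicAt.const a x
    exact (((((h1.fun_pow 4).fun_add ((hk (g₂ / 2)).fun_mul (h1.fun_pow 2))).fun_add
      ((hk (2 * g₃)).fun_mul h1)).fun_add (hk (g₂ ^ 2 / 16))).fun_div
      ((((hk 4).fun_mul (h1.fun_pow 3)).fun_sub ((hk g₂).fun_mul h1)).fun_sub (hk g₃)))
  · have hl := h.lead.comp_half
    have n1 := (((hl.pow 4).cast (m := -8) (b := 256) (by norm_num) (by norm_num)).add
      ((((hl.pow 2).const_mul (g₂ / 2)).weaken (m := -8) (by norm_num)))).add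
      ((hl.const_mul (2 * g₃)).weaken (m := -8) (by norm_num)) |>.add
      ((Lead.const (g₂ ^ 2 / 16) 0).weaken (m := -8) (by norm_num))
    have d1 := ((((hl.pow 3).const_mul 4).cast (m := -6) (b := 256) (by norm_num)
      (by norm_num)).sub ((hl.const_mul g₂).weaken (m := -6) (by norm_num))).sub
      ((Lead.const g₃ 0).weaken (m := -6) (by norm_num))
    refine ((n1.mul (d1.inv (by norm_num))).cast (by norm_num) (by norm_num)).congr ?_
    exact Eventually.of_forall fun z => (div_eq_mul_inv _ _).symm
  · intro x hx
    have hx' := hmem x hx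
    filter_upwards [(hhalf x).eventually ((h.mero _ hx').eventually_analyticAt),
      (hhalf x).eventually (h.ode _ hx'), (hhalf x).eventually (h.deriv_ne_zero hx')]
      with z ha ho hne
    have hC : 4 * p (z / 2) ^ 3 - g₂ * p (z / 2) - g₃ ≠ 0 := by
      rw [← ho]; exact pow_ne_zero 2 hne
    have hd : HasDerivAt (fun z => p (z / 2)) (deriv p (z / 2) * (1 / 2)) z :=
      HasDerivAt.comp (h₂ := p) (h := fun z => z / 2) z ha.differentiableAt.hasDerivAt
        ((hasDerivAt_id' z).div_const 2)
    have hN := (((hd.fun_pow 4).fun_add ((hd.fun_pow 2).const_mul (g₂ / 2))).fun_add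
      (hd.const_mul (2 * g₃))).add_const (g₂ ^ 2 / 16)
    have hD := (((hd.fun_pow 3).const_mul 4).fun_sub (hd.const_mul g₂)).sub_const g₃
    have hdd : deriv (SwiftHohenberg.duplicate g₂ g₃ p) z = _ := (hN.fun_div hD hC).deriv
    rw [hdd, SwiftHohenberg.duplicate]
    simp only [show (2 - 1 : ℕ) = 1 from rfl, pow_one, show (4 - 1 : ℕ) = 3 from rfl,
      show (3 - 1 : ℕ) = 2 from rfl]
    push_cast
    generalize deriv p (z / 2) = D at *
    generalize p (z / 2) = w at *
    obtain ⟨c, hc⟩ : ∃ c, c = 4 * w ^ 3 - g₂ * w - g₃ := ⟨_, rfl⟩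
    rw [← hc] at ho hC ⊢
    -- Here N/c is the duplicated function with c = p'(z/2)², and M is the derivative of N as a
    -- polynomial in w. Using D² = c reduces the equation to the polynomial identity `h3`.
    have e : ∀ M N M' C' : ℂ, M' = D / 2 * M → C' = D / 2 * (12 * w ^ 2 - g₂) →
        (M * c - N * (12 * w ^ 2 - g₂)) ^ 2 = 4 * (4 * N ^ 3 - g₂ * N * c ^ 2 - g₃ * c ^ 3) →
        ((M' * c - N * C') / c ^ 2) ^ 2 = 4 * (N / c) ^ 3 - g₂ * (N / c) - g₃ := by
      rintro M N _ _ rfl rfl h3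
      field_simp
      linear_combination (M * c - N * (12 * w ^ 2 - g₂)) ^ 2 * ho + c * h3
    refine e (4 * w ^ 3 + g₂ * w + 2 * g₃) _ _ _ (by ring) (by ring) ?_
    rw [hc]; ring

theorem mono {r' : ℝ} (h : IsLocalW g₂ g₃ r p) (hr : r' ≤ r) : IsLocalW g₂ g₃ r' p :=
  ⟨fun x hx => h.mero x (Metric.ball_subset_ball hr hx), h.lead,
    fun x hx => h.ode x (Metric.ball_subset_ball hr hx)⟩

/-- The difference d of two solutions satisfies d'(p' + f') = d(4(p² + pf + f²) - g₂). Leading terms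
at 0 force exponent -3, but d has exponent at least -1. -/
theorem unique {f : ℂ → ℂ} (hp : IsLocalW g₂ g₃ r p) (hf : IsLocalW g₂ g₃ r f) {x : ℂ}
    (hx : x ∈ Metric.ball 0 r) : p =ᶠ[𝓝[≠] x] f := by
  have h0 : (0 : ℂ) ∈ Metric.ball (0 : ℂ) r :=
    Metric.mem_ball_self (lt_of_le_of_lt dist_nonneg hx)
  have hzero : ∀ᶠ z in 𝓝[≠] 0, p z - f z = 0 := by
    have hd : Lead (fun z => p z - f z) 0 (-2) 0 := (hp.lead.sub hf.lead).cast rfl (sub_self 1)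
    rcases Lead.exists_of_meromorphicAt hd.meromorphicAt with h | ⟨m, a, ha, hm⟩
    · exact h
    exfalso
    obtain ⟨a', ha'⟩ := hd.lift
    have hm1 : -1 ≤ m := by
      by_contra! hlt
      exact ha (hm.unique (ha'.weaken (by linarith)))
    have h1 := hm.deriv.mul (hp.lead.deriv.add hf.lead.deriv)
    have h2 := hm.mul (((((hp.lead.pow 2).add ((hp.lead.mul hf.lead).cast (by norm_num) rfl)).add
      (hf.lead.pow 2)).const_mul 4).sub ((Lead.const g₂ 0).weaken (by norm_num)))
    have h3 : Lead (fun z => deriv (fun z => p z - f z) z * (deriv p z + deriv f z)) 0 (m - 4)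
        (a * 12) := by
      refine (h2.cast (by push_cast; ring) (by ring)).congr ?_
      filter_upwards [hp.ode 0 h0, hf.ode 0 h0, (hp.mero 0 h0).eventually_analyticAt,
        (hf.mero 0 h0).eventually_analyticAt] with z e1 e2 e3 e4
      rw [deriv_fun_sub e3.differentiableAt e4.differentiableAt]
      linear_combination e2 - e1
    have h4 := h3.unique (h1.cast (by push_cast; ring) rfl)
    have h5 : a * (12 + 4 * (m : ℂ)) = 0 := by push_cast at h4; linear_combination h4
    rcases mul_eq_zero.1 h5 with h | h
    · exact ha h
    · have h6 : (12 + 4 * m : ℤ) = 0 := by exact_mod_cast h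
      omega
  have hpf : MeromorphicOn (fun z => p z - f z) (Metric.ball 0 r) :=
    fun z hz => (hp.mero z hz).fun_sub (hf.mero z hz)
  have htop : meromorphicOrderAt (fun z => p z - f z) x = ⊤ := by
    by_contra hne
    exact hpf.meromorphicOrderAt_ne_top_of_isPreconnected (convex_ball (0 : ℂ) r).isPreconnected
      hx h0 hne (meromorphicOrderAt_eq_top_iff.2 hzero)
  filter_upwards [meromorphicOrderAt_eq_top_iff.1 htop] with z hz using sub_eq_zero.1 hz

theorem iterate (h : IsLocalW g₂ g₃ r p) (n : ℕ) : ∃ f, IsLocalW g₂ g₃ (2 ^ n * r) f := by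
  induction n with
  | zero => exact ⟨p, by simpa using h⟩
  | succ n ih =>
    obtain ⟨f, hf⟩ := ih
    exact ⟨_, hf.duplicate.mono (by rw [pow_succ]; linarith)⟩

end IsLocalW

theorem exists_isW (g₂ g₃ : ℂ) : ∃ p, IsW g₂ g₃ p ∧ Lead p 0 (-2) 1 := by
  obtain ⟨r, hr, f, hf⟩ := exists_isLocalW g₂ g₃
  have hg : ∀ k : ℕ, ∃ g, IsLocalW g₂ g₃ (k + 1) g := by
    intro k
    obtain ⟨n, hn⟩ := pow_unbounded_of_one_lt ((k + 1) / r) one_lt_two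
    obtain ⟨g, hg⟩ := hf.iterate n
    exact ⟨g, hg.mono ((div_le_iff₀ hr).1 hn.le)⟩
  choose g hg using hg
  -- The solution `g k` lives on the disc of radius k + 1. Near a point only finitely many indices k
  -- occur, and the corresponding solutions agree there by uniqueness.
  set P : ℂ → ℂ := fun z => g ⌈‖z‖⌉₊ z with hP
  have hloc : ∀ x : ℂ, P =ᶠ[𝓝[≠] x] g ⌈‖x‖⌉₊ := by
    intro x
    have hx : ∀ k : ℕ, k ≤ ⌈‖x‖⌉₊ + 1 → ‖x‖ < k + 1 →
        ∀ᶠ z in 𝓝[≠] x, g k z = g ⌈‖x‖⌉₊ z := by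
      intro k _ hk
      have h1 : (⌈‖x‖⌉₊ : ℝ) < ⌈‖x‖⌉₊ + 1 := lt_add_one _
      have h2 : ‖x‖ < ⌈‖x‖⌉₊ + 1 := (Nat.le_ceil _).trans_lt h1
      have hm : x ∈ Metric.ball (0 : ℂ) (min (k + 1) (⌈‖x‖⌉₊ + 1)) := by
        rw [mem_ball_zero_iff]; exact lt_min hk h2
      exact ((hg k).mono (min_le_left _ _)).unique ((hg _).mono (min_le_right _ _)) hm
    have hall : ∀ᶠ z in 𝓝[≠] x, ∀ k ∈ Set.Iic (⌈‖x‖⌉₊ + 1), ‖x‖ < k + 1 →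
        g k z = g ⌈‖x‖⌉₊ z := by
      refine (Filter.eventually_all_finite (Set.finite_Iic _)).2 fun k hk => ?_
      by_cases h : ‖x‖ < k + 1
      · filter_upwards [hx k hk h] with z hz _ using hz
      · exact Eventually.of_forall fun z h' => absurd h' h
    filter_upwards [hall, nhdsWithin_le_nhds (Metric.ball_mem_nhds x one_pos)] with z hz hzx
    rw [mem_ball_iff_norm] at hzx
    refine hz _ ?_ ?_
    · have : ‖z‖ ≤ ‖x‖ + 1 := by
        have := norm_add_le (z - x) x
        rw [sub_add_cancel] at this; linarith
      exact (Nat.ceil_mono this).trans_eq (Nat.ceil_add_one (norm_nonneg x))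
    · have := norm_sub_norm_le x z
      rw [norm_sub_rev] at this
      linarith [Nat.le_ceil ‖z‖]
  have hmem : ∀ x : ℂ, x ∈ Metric.ball (0 : ℂ) (⌈‖x‖⌉₊ + 1) := fun x => by
    rw [mem_ball_zero_iff]
    exact (Nat.le_ceil _).trans_lt (lt_add_one _)
  have hL : Lead P 0 (-2) 1 := (hg ⌈‖(0 : ℂ)‖⌉₊).lead.congr (hloc 0).symm
  refine ⟨P, ⟨fun x => ?_, ?_, ?_⟩, hL⟩
  · exact ((hg _).mero x (hmem x)).congr (hloc x).symm
  · rintro ⟨a, ha⟩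
    have h1 := eventually_nhdsNE_of_codiscrete ha 0
    exact one_ne_zero (hL.unique (((Lead.const a 0).weaken (by norm_num)).congr
      (h1.mono fun z hz => hz.symm)))
  · refine eventually_codiscrete_iff.2 fun x => ?_
    filter_upwards [eventually_nhds_of_nhdsNE (hloc x), (hg _).ode x (hmem x)] with z h1 h2
    rw [EventuallyEq.deriv_eq (f := g ⌈‖x‖⌉₊) h1, h1.self_of_nhds]
    exact h2

/-! ### Weierstrass functions with the same poles -/

namespace IsW

variable {g₂ g₃ : ℂ} {p : ℂ → ℂ}

/-- The first order equation gives 4a² = 4a³, which rules out the sign -1. -/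
theorem lead_pole (h : IsW g₂ g₃ p) {q : ℂ} {n : ℤ} {a : ℂ} (hL : Lead p q n a) (ha : a ≠ 0)
    (hn : n < 0) : Lead p q (-2) 1 := by
  obtain ⟨rfl, -⟩ := h.isSol.lead_pole hL ha hn
  have h1 := (hL.deriv.pow 2).cast (m := -6) (b := 4 * a ^ 2) (by norm_num) (by push_cast; ring)
  have h2 : Lead (fun z => deriv p z ^ 2) q (-6) (4 * a ^ 3) := by
    refine ((((((hL.pow 3).const_mul 4).sub ((hL.const_mul g₂).weaken (by norm_num))).sub
      ((Lead.const g₃ q).weaken (by norm_num))).cast (m := -6) (b := 4 * a ^ 3)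
      (by norm_num) (by ring))).congr ?_
    filter_upwards [eventually_nhdsNE_of_codiscrete h.ode q] with z hz using hz.symm
  have h3 := h1.unique h2
  have h4 : a ^ 2 * (1 - a) = 0 := by linear_combination h3 / 4
  rcases mul_eq_zero.1 h4 with h5 | h5
  · exact absurd (pow_eq_zero_iff two_ne_zero |>.1 h5) ha
  · exact hL.cast rfl (by linear_combination -h5)

theorem lead_of_not_analyticAt (h : IsW g₂ g₃ p) (hn : IsNF p) {q : ℂ}
    (hq : ¬ AnalyticAt ℂ p q) : Lead p q (-2) 1 := by
  obtain ⟨n, a, hn, ha, hL⟩ := hn.lead_neg hq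
  exact h.lead_pole hL ha hn

theorem not_analyticAt_iff (h : IsW g₂ g₃ p) (hn : IsNF p) {q : ℂ} :
    ¬ AnalyticAt ℂ p q ↔ Lead p q (-2) 1 :=
  ⟨h.lead_of_not_analyticAt hn, fun hL => hL.not_analyticAt (by norm_num) one_ne_zero⟩

theorem eq_translate {f : ℂ → ℂ} (h : IsW g₂ g₃ p) (h0 : Lead p 0 (-2) 1) (hf : IsW g₂ g₃ f) :
    ∃ z₀, f =ᶠ[codiscrete ℂ] fun z => p (z - z₀) := by
  obtain ⟨F, hF, hfF⟩ := exists_isNF hf.mero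
  have hFW := hf.congr hfF
  obtain ⟨q, hq⟩ := hFW.isSol.exists_not_analyticAt hF hFW.nonconst
  have hqL := (hFW.not_analyticAt_iff hF).1 hq
  have h1 := translate_eq hFW.isSol h.isSol hqL h0 (one_pow 2)
  refine ⟨q, hfF.trans ?_⟩
  filter_upwards [eventually_add_right h1 (-q)] with z hz
  simpa [sub_eq_add_neg] using hz

theorem coeffs_of_add_const {G₂ G₃ a : ℂ} {f : ℂ → ℂ} (h : IsW g₂ g₃ p) (hf : IsW G₂ G₃ f)
    (hfp : f =ᶠ[codiscrete ℂ] fun z => p z + a) : a = 0 ∧ G₂ = g₂ ∧ G₃ = g₃ := by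
  have h1 : ∀ᶠ z in codiscrete ℂ, 12 * a * p z ^ 2 + (12 * a ^ 2 - G₂ + g₂) * p z
      + (4 * a ^ 3 - G₂ * a - G₃ + g₃) = 0 := by
    filter_upwards [h.ode, hf.ode, hfp, deriv_congr_codiscrete hfp] with z e1 e2 e3 e4
    rw [e3, e4, deriv_add_const] at e2
    linear_combination e1 - e2
  obtain ⟨c0, c1, c2⟩ := quadratic_coeffs h.mero h.nonconst h1
  have ha : a = 0 := by linear_combination c2 / 12
  subst ha
  exact ⟨rfl, by linear_combination -c1, by linear_combination -c0⟩

/-- The double poles of f - p cancel, simple poles are excluded by evenness about each pole, and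
both functions are bounded away from the poles. So f - p is constant, and the two equations force
this constant to be 0. -/
theorem eq_of_poles {G₂ G₃ : ℂ} {f : ℂ → ℂ} (h : IsW g₂ g₃ p) (hf : IsW G₂ G₃ f)
    (hpf : ∀ q, Lead p q (-2) 1 ↔ Lead f q (-2) 1) :
    f =ᶠ[codiscrete ℂ] p ∧ G₂ = g₂ ∧ G₃ = g₃ := by
  wlog hn : IsNF p ∧ IsNF f generalizing p f
  · obtain ⟨P, hP, hpP⟩ := exists_isNF h.mero
    obtain ⟨F, hF, hfF⟩ := exists_isNF hf.mero
    have hc : ∀ {r s : ℂ → ℂ}, r =ᶠ[codiscrete ℂ] s → ∀ q, Lead r q (-2) 1 ↔ Lead s q (-2) 1 :=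
      fun hrs q => ⟨fun hL => hL.congr (eventually_nhdsNE_of_codiscrete hrs q),
        fun hL => hL.congr ((eventually_nhdsNE_of_codiscrete hrs q).mono fun _ e => e.symm)⟩
    obtain ⟨h1, h2⟩ := this (h.congr hpP) (hf.congr hfF)
      (fun q => (hc hpP q).symm.trans ((hpf q).trans (hc hfF q))) ⟨hP, hF⟩
    exact ⟨hfF.trans (h1.trans hpP.symm), h2⟩
  obtain ⟨hp, hn⟩ := hn
  obtain ⟨δ, hδ, hsep⟩ := h.isSol.separated hp
  obtain ⟨C₁, hC₁⟩ := DiffPoly.bounded h.isSol .self (δ / 2) (by linarith)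
  obtain ⟨C₂, hC₂⟩ := DiffPoly.bounded hf.isSol .self (δ / 2) (by linarith)
  have hA : ∀ q, AnalyticAt ℂ p q → AnalyticAt ℂ f q := by
    intro q hq
    by_contra hne
    exact (h.not_analyticAt_iff hp).2 ((hpf q).2 ((hf.not_analyticAt_iff hn).1 hne)) hq
  have hm : Meromorphic fun z => f z - p z := hf.mero.fun_sub h.mero
  obtain ⟨a, ha⟩ : IsConstant fun z => f z - p z := by
    refine isConstant_of_bounded (A := AnalyticAt ℂ p) hm hδ hsep (C := C₂ + C₁) ?_ ?_
    · intro z hz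
      have hz0 := hz z (by simpa using hδ)
      refine ⟨(hA z hz0).sub hz0, (norm_sub_le _ _).trans (add_le_add ?_ ?_)⟩
      · exact hC₂ z fun w hw => hA w (hz w hw)
      · exact hC₁ z hz
    · intro q
      by_cases hq : AnalyticAt ℂ p q
      · exact ((hA q hq).sub hq).meromorphicOrderAt_nonneg
      · have hL := (h.not_analyticAt_iff hp).1 hq
        have hL' := (hpf q).1 hL
        obtain ⟨a, ha⟩ := ((hL'.sub hL).cast rfl (sub_self 1)).lift
        have ha0 : a = 0 := ha.eq_zero_of_even (by decide) (Eventually.of_forall fun z => by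
          rw [h.isSol.even hp (one_pow 2) hL, hf.isSol.even hn (one_pow 2) hL'])
        subst ha0
        obtain ⟨a, ha⟩ := ha.lift
        exact (ha.cast (m := 0) (by norm_num) rfl).order_nonneg
  have hfp : f =ᶠ[codiscrete ℂ] fun z => p z + a := by
    filter_upwards [ha] with z hz; linear_combination hz
  obtain ⟨rfl, h2, h3⟩ := h.coeffs_of_add_const hf hfp
  exact ⟨by simpa using hfp, h2, h3⟩

end IsW

/-! ### The Weierstrass function of a lattice and its degenerate forms -/

theorem isW_weierstrassP (L : PeriodPair) : IsW L.g₂ L.g₃ L.weierstrassP := by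
  have hm := L.meromorphic_weierstrassP
  refine ⟨hm, ?_, ?_⟩
  · rintro ⟨a, ha⟩
    have h1 := L.order_weierstrassP 0 (zero_mem _)
    rw [meromorphicOrderAt_congr (eventually_nhdsNE_of_codiscrete ha 0)] at h1
    have h2 : 0 ≤ meromorphicOrderAt (fun _ : ℂ => a) 0 := analyticAt_const.meromorphicOrderAt_nonneg
    rw [h1] at h2
    exact absurd h2 (by decide)
  · refine eventually_codiscrete_iff.2 fun x => ?_
    have h1 : ∀ᶠ z in 𝓝[≠] x, z ∉ L.lattice := by
      rw [eventually_nhdsWithin_iff]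
      filter_upwards [L.compl_lattice_sdiff_singleton_mem_nhds x] with z hz hzx hzL
      exact hz ⟨hzL, hzx⟩
    filter_upwards [h1] with z hz
    rw [L.deriv_weierstrassP, L.derivWeierstrassP_sq z hz]

theorem lead_weierstrassP_iff (L : PeriodPair) (q : ℂ) :
    Lead L.weierstrassP q (-2) 1 ↔ q ∈ L.lattice := by
  constructor
  · intro h
    by_contra hq
    exact h.not_analyticAt (by norm_num) one_ne_zero (L.analyticOnNhd_weierstrassP q hq)
  · intro hq
    have h1 := L.order_weierstrassP q hq
    rcases Lead.exists_of_meromorphicAt (L.meromorphic_weierstrassP q) with h | ⟨n, a, ha, hL⟩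
    · rw [meromorphicOrderAt_eq_top_iff.2 h] at h1
      exact absurd h1 (by decide)
    · rw [hL.order_eq ha] at h1
      have h2 : n = -2 := WithTop.coe_injective h1
      exact (isW_weierstrassP L).lead_pole hL ha (by omega)

theorem isW_inv_sq : IsW 0 0 fun z => 1 / z ^ 2 := by
  have hm : Meromorphic fun z : ℂ => 1 / z ^ 2 := fun x => by fun_prop
  have h0 : ∀ᶠ z : ℂ in codiscrete ℂ, z ≠ 0 := eventually_codiscrete_iff.2 fun x => by
    rcases eq_or_ne x 0 with rfl | hx
    · exact self_mem_nhdsWithin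
    · exact nhdsWithin_le_nhds (isOpen_ne.mem_nhds hx)
  refine ⟨hm, ?_, ?_⟩
  · intro hc
    have h1 : Lead (fun z : ℂ => 1 / z ^ 2) 0 (-2) 1 :=
      (Lead.zpow 0 (-2)).congr (Eventually.of_forall fun z => by simp [zpow_neg])
    obtain ⟨a, ha⟩ := hc
    exact one_ne_zero (h1.unique (((Lead.const a 0).weaken (by norm_num)).congr
      ((eventually_nhdsNE_of_codiscrete ha 0).mono fun _ e => e.symm)))
  · filter_upwards [h0] with z hz
    have h1 : HasDerivAt (fun z : ℂ => 1 / z ^ 2) (-(2 * z) / (z ^ 2) ^ 2) z := by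
      have := ((hasDerivAt_id' z).fun_pow 2).fun_inv (pow_ne_zero 2 hz)
      simpa using this
    rw [h1.deriv]
    field_simp
    ring

theorem lead_inv_sq_iff (q : ℂ) : Lead (fun z => 1 / z ^ 2) q (-2) 1 ↔ q = 0 := by
  constructor
  · intro h
    by_contra hq
    refine h.not_analyticAt (by norm_num) one_ne_zero ?_
    have : q ^ 2 ≠ 0 := pow_ne_zero 2 hq
    fun_prop (disch := assumption)
  · rintro rfl
    exact (Lead.zpow 0 (-2)).congr (Eventually.of_forall fun z => by simp [zpow_neg])

/-- The degenerate form `-d + (3 d / 2) coth² (κ z)` of the Weierstrass function. -/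
def degenerateP (d κ : ℂ) (z : ℂ) : ℂ :=
  -d + 3 * d / 2 * (Complex.cosh (κ * z) / Complex.sinh (κ * z)) ^ 2

section degenerate

variable {d κ : ℂ}

theorem lead_sinh (κ : ℂ) : Lead (fun z => Complex.sinh (κ * z)) 0 1 κ := by
  have ha : AnalyticAt ℂ (fun z => Complex.sinh (κ * z)) 0 := by fun_prop
  have h1 := (Lead.of_analyticAt ha).cast (m := 0) (b := 0) rfl (by simp)
  obtain ⟨a, h2⟩ := h1.lift
  have h3 := h2.deriv.cast (m := 0) (b := a) (by norm_num) (by norm_num)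
  have h4 : HasDerivAt (fun z => Complex.sinh (κ * z)) κ 0 := by
    have := ((hasDerivAt_id' (0 : ℂ)).const_mul κ).csinh
    simpa using this
  have h5 := Lead.of_analyticAt ha.deriv
  rw [h4.deriv] at h5
  exact h2.cast (by norm_num) (h3.unique h5)

theorem degenerateP_add (z : ℂ) {w : ℂ} (hw : Complex.sinh (κ * w) = 0) :
    degenerateP d κ (z + w) = degenerateP d κ z := by
  have hc : Complex.cosh (κ * w) ^ 2 = 1 := by
    have := Complex.cosh_sq (κ * w); rw [hw] at this; simpa using this
  rw [degenerateP, degenerateP, mul_add, Complex.cosh_add, Complex.sinh_add, hw, mul_zero,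
    mul_zero, add_zero, add_zero, mul_div_mul_right]
  rintro h
  rw [h] at hc
  norm_num at hc

theorem lead_degenerateP (hκ : κ ≠ 0) (hd : κ ^ 2 = 3 * d / 2) :
    Lead (degenerateP d κ) 0 (-2) 1 := by
  have hc : Lead (fun z => Complex.cosh (κ * z)) 0 0 1 :=
    (Lead.of_analyticAt (by fun_prop)).cast rfl (by simp)
  have h1 := (((hc.mul ((lead_sinh κ).inv hκ)).pow 2).const_mul (3 * d / 2)).cast
    (m := -2) (b := 1) (by norm_num) (by rw [← hd]; field_simp)
  refine ((((Lead.const (-d) 0).weaken (m := -2) (by norm_num)).add h1).cast rfl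
    (zero_add 1)).congr (Eventually.of_forall fun z => ?_)
  simp only [degenerateP, div_eq_mul_inv]

theorem meromorphic_degenerateP : Meromorphic (degenerateP d κ) := by
  intro x
  unfold degenerateP
  have h1 : AnalyticAt ℂ (fun z => Complex.cosh (κ * z)) x := by fun_prop
  have h2 : AnalyticAt ℂ (fun z => Complex.sinh (κ * z)) x := by fun_prop
  exact (MeromorphicAt.const _ x).fun_add ((MeromorphicAt.const _ x).fun_mul
    ((h1.meromorphicAt.fun_div h2.meromorphicAt).fun_pow 2))

theorem eventually_sinh_ne_zero (hκ : κ ≠ 0) :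
    ∀ᶠ z in codiscrete ℂ, Complex.sinh (κ * z) ≠ 0 := by
  have hm : Meromorphic fun z => Complex.sinh (κ * z) := fun x =>
    (by fun_prop : AnalyticAt ℂ (fun z => Complex.sinh (κ * z)) x).meromorphicAt
  refine eventually_ne_of_not_eq hm fun h => hκ ?_
  exact (lead_sinh κ).eq_zero_of_eventually (eventually_nhdsNE_of_codiscrete h 0)

theorem hasDerivAt_degenerateP {z : ℂ} (hz : Complex.sinh (κ * z) ≠ 0) :
    HasDerivAt (degenerateP d κ)
      (-3 * d * κ * (Complex.cosh (κ * z) / Complex.sinh (κ * z))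
        * ((Complex.cosh (κ * z) / Complex.sinh (κ * z)) ^ 2 - 1)) z := by
  have h0 := (hasDerivAt_id' z).const_mul κ
  have h1 := (((h0.ccosh.fun_div h0.csinh hz).fun_pow 2).const_mul (3 * d / 2)).const_add (-d)
  refine h1.congr_deriv ?_
  simp only [show (2 - 1 : ℕ) = 1 from rfl, pow_one]
  push_cast
  have h2 := Complex.cosh_sq (κ * z)
  generalize Complex.cosh (κ * z) = C at *
  generalize Complex.sinh (κ * z) = s at *
  field_simp
  ring

theorem isW_degenerateP (hκ : κ ≠ 0) (hd : κ ^ 2 = 3 * d / 2) :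
    IsW (3 * d ^ 2) (-d ^ 3) (degenerateP d κ) := by
  refine ⟨meromorphic_degenerateP, ?_, ?_⟩
  · rintro ⟨a, ha⟩
    exact one_ne_zero ((lead_degenerateP hκ hd).unique
      (((Lead.const a 0).weaken (by norm_num)).congr
        ((eventually_nhdsNE_of_codiscrete ha 0).mono fun _ e => e.symm)))
  · filter_upwards [eventually_sinh_ne_zero hκ] with z hz
    rw [(hasDerivAt_degenerateP hz).deriv, degenerateP]
    linear_combination (9 * d ^ 2 * (Complex.cosh (κ * z) / Complex.sinh (κ * z)) ^ 2
      * ((Complex.cosh (κ * z) / Complex.sinh (κ * z)) ^ 2 - 1) ^ 2) * hd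

theorem lead_degenerateP_iff (hκ : κ ≠ 0) (hd : κ ^ 2 = 3 * d / 2) (q : ℂ) :
    Lead (degenerateP d κ) q (-2) 1 ↔ Complex.sinh (κ * q) = 0 := by
  constructor
  · intro h
    by_contra hq
    refine h.not_analyticAt (by norm_num) one_ne_zero ?_
    have h1 : AnalyticAt ℂ (fun z => Complex.cosh (κ * z)) q := by fun_prop
    have h2 : AnalyticAt ℂ (fun z => Complex.sinh (κ * z)) q := by fun_prop
    exact analyticAt_const.fun_add (analyticAt_const.fun_mul ((h1.fun_div h2 hq).fun_pow 2))
  · intro hq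
    have h1 : Lead (fun z => degenerateP d κ (z + -q)) q (-2) 1 :=
      Lead.comp_add (by simpa using lead_degenerateP hκ hd)
    refine h1.congr (Eventually.of_forall fun z => ?_)
    exact degenerateP_add z (by simpa [Complex.sinh_neg] using hq)

theorem sinh_eq_zero_iff {z : ℂ} :
    Complex.sinh z = 0 ↔ ∃ n : ℤ, z = n * (Real.pi * Complex.I) := by
  have h1 : Complex.sin (z * Complex.I) = Complex.sinh z * Complex.I := Complex.sin_mul_I z
  have h2 : Complex.sinh z = 0 ↔ Complex.sin (z * Complex.I) = 0 := by
    rw [h1]; simp [Complex.I_ne_zero]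
  rw [h2, Complex.sin_eq_zero_iff]
  constructor
  · rintro ⟨k, hk⟩
    refine ⟨-k, ?_⟩
    push_cast
    linear_combination -Complex.I * hk + z * Complex.I_sq
  · rintro ⟨k, rfl⟩
    refine ⟨-k, ?_⟩
    push_cast
    linear_combination (k * Real.pi : ℂ) * Complex.I_sq

end degenerate

theorem IsWeierstrassP.isW {g₂ g₃ : ℂ} {p : ℂ → ℂ} (h : IsWeierstrassP g₂ g₃ p) :
    IsW g₂ g₃ p ∧ Lead p 0 (-2) 1 := by
  rcases h with ⟨L, rfl, rfl, rfl⟩ | ⟨d, κ, hκ, hd, rfl, rfl, rfl⟩ | ⟨rfl, rfl, rfl⟩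
  · exact ⟨isW_weierstrassP L, (lead_weierstrassP_iff L 0).2 (zero_mem _)⟩
  · exact ⟨isW_degenerateP hκ hd, lead_degenerateP hκ hd⟩
  · exact ⟨isW_inv_sq, (lead_inv_sq_iff 0).2 rfl⟩

/-! ### Every pair of invariants is attained -/

/-- A discrete subgroup that spans ℂ over ℝ is free of rank 2, and an integral basis of it is also a
real basis. -/
theorem exists_periodPair (Λ : AddSubgroup ℂ) {δ : ℝ} (hδ : 0 < δ)
    (hsep : ∀ z ∈ Λ, z ≠ 0 → δ ≤ ‖z‖) {v w : ℂ} (hv : v ∈ Λ) (hw : w ∈ Λ)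
    (hvw : LinearIndependent ℝ ![v, w]) : ∃ L : PeriodPair, ∀ z, z ∈ L.lattice ↔ z ∈ Λ := by
  set M : Submodule ℤ ℂ := AddSubgroup.toIntSubmodule Λ with hM
  have hmem : ∀ z, z ∈ M ↔ z ∈ Λ := fun z => Iff.rfl
  have hdisc : DiscreteTopology M := by
    refine discreteTopology_of_isOpen_singleton_zero ?_
    rw [Metric.isOpen_iff]
    intro x hx
    rw [Set.mem_singleton_iff] at hx
    subst hx
    refine ⟨δ, hδ, fun y hy => ?_⟩
    by_contra hne
    have h1 := hsep y.1 y.2 fun h => hne (Subtype.ext h)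
    rw [Metric.mem_ball, Subtype.dist_eq, dist_eq_norm] at hy
    simp only [ZeroMemClass.coe_zero, sub_zero] at hy
    linarith
  have hz : IsZLattice ℝ M := ⟨by
    have h1 := hvw.span_eq_top_of_card_eq_finrank (by simp)
    rw [eq_top_iff, ← h1]
    refine Submodule.span_mono ?_
    rintro _ ⟨i, rfl⟩
    fin_cases i
    · exact hv
    · exact hw⟩
  have hfin : Module.Finite ℤ M := ZLattice.module_finite ℝ M
  have hrank : Module.finrank ℤ M = 2 := by rw [ZLattice.rank ℝ M, Complex.finrank_real_complex]
  let b := Module.finBasisOfFinrankEq ℤ M hrank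
  have hli := (b.ofZLatticeBasis ℝ M).linearIndependent
  have heq : ![(b 0 : ℂ), (b 1 : ℂ)] = b.ofZLatticeBasis ℝ M := by
    funext i; fin_cases i <;> simp
  have hs : Submodule.span ℤ {(b 0 : ℂ), (b 1 : ℂ)} = M := by
    rw [← Matrix.range_cons_cons_empty, heq]
    exact b.ofZLatticeBasis_span ℝ
  refine ⟨⟨b 0, b 1, by rwa [heq]⟩, fun z => ?_⟩
  rw [← hmem, PeriodPair.lattice, hs]

/-- The poles of a global solution form a discrete subgroup Λ of ℂ, and a solution together with its
invariants is determined by its poles. Ranks 0, 1 and 2 of Λ are realised by 1/z², the coth form and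
the lattice function. -/
theorem exists_isWeierstrassP (g₂ g₃ : ℂ) : ∃ p, IsWeierstrassP g₂ g₃ p := by
  obtain ⟨p₀, hp₀, hL₀⟩ := exists_isW g₂ g₃
  obtain ⟨p, hn, hpp⟩ := exists_isNF hp₀.mero
  have h := hp₀.congr hpp
  have hL := hL₀.congr (eventually_nhdsNE_of_codiscrete hpp 0)
  clear hp₀ hL₀ hpp p₀
  obtain ⟨δ, hδ, hsep⟩ := h.isSol.separated hn
  let Λ : AddSubgroup ℂ := AddSubgroup.ofSub {q | Lead p q (-2) 1} ⟨0, hL⟩ (by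
    intro q hq r hr
    have h1 : p = fun z => p (z + r) := funext fun z => by
      have := h.isSol.periodic hn (one_pow 2) hr hL z
      rw [← this, sub_zero]
    have h2 : Lead (fun z => p (z + r)) (q + -r) (-2) 1 := Lead.comp_add (by simpa using hq)
    rwa [← h1] at h2)
  have hmem : ∀ q, Lead p q (-2) 1 ↔ q ∈ Λ := fun q => Iff.rfl
  have hΛ : ∀ z ∈ Λ, z ≠ 0 → δ ≤ ‖z‖ := by
    intro z hz hz0
    by_contra! hlt
    refine (h.not_analyticAt_iff hn).2 ((hmem z).2 hz) (hsep 0 ?_ z hz0 (by simpa using hlt))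
    exact (h.not_analyticAt_iff hn).2 hL
  by_cases h0 : ∀ z ∈ Λ, z = 0
  · obtain ⟨-, rfl, rfl⟩ := isW_inv_sq.eq_of_poles h fun q => by
      rw [lead_inv_sq_iff, hmem]
      exact ⟨fun hq => hq ▸ Λ.zero_mem, h0 q⟩
    exact ⟨_, Or.inr (Or.inr ⟨rfl, rfl, rfl⟩)⟩
  push Not at h0
  obtain ⟨v, hv, hv0⟩ := h0
  by_cases h1 : ∀ w ∈ Λ, ∃ t : ℝ, t • v = w
  · let φ : ℝ →+ ℂ := (LinearMap.toSpanSingleton ℝ ℂ v).toAddMonoidHom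
    have hφ : ∀ t : ℝ, φ t = t • v := fun t => rfl
    have hvn : 0 < ‖v‖ := norm_pos_iff.2 hv0
    obtain ⟨τ, hτ⟩ := AddSubgroup.cyclic_of_isolated_zero (H := Λ.comap φ) (a := δ / ‖v‖)
      (div_pos hδ hvn) (by
        rw [Set.disjoint_left]
        rintro t ht ⟨ht0, ht1⟩
        have h2 := hΛ (φ t) ht (by rw [hφ]; exact smul_ne_zero ht0.ne' hv0)
        rw [hφ, norm_smul, Real.norm_of_nonneg ht0.le] at h2
        rw [lt_div_iff₀ hvn] at ht1
        linarith)
    have hΛ' : ∀ w, w ∈ Λ ↔ ∃ n : ℤ, w = n * (τ * v) := by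
      intro w
      constructor
      · intro hw
        obtain ⟨t, rfl⟩ := h1 w hw
        have h2 : t ∈ Λ.comap φ := hw
        rw [hτ, AddSubgroup.mem_closure_singleton] at h2
        obtain ⟨n, rfl⟩ := h2
        exact ⟨n, by simp; ring⟩
      · rintro ⟨n, rfl⟩
        have h2 : n • τ ∈ Λ.comap φ := by
          rw [hτ, AddSubgroup.mem_closure_singleton]; exact ⟨n, rfl⟩
        have h3 : φ (n • τ) = n * (τ * v) := by rw [hφ]; simp; ring
        rw [← h3]; exact h2
    have hω : (τ : ℂ) * v ≠ 0 := by
      intro hne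
      obtain ⟨n, hn⟩ := (hΛ' v).1 hv
      rw [hne, mul_zero] at hn
      exact hv0 hn
    have hπ : (Real.pi : ℂ) * Complex.I ≠ 0 :=
      mul_ne_zero (by exact_mod_cast Real.pi_ne_zero) Complex.I_ne_zero
    -- With this κ the zeros of sinh(κz) are exactly the multiples of the generator τv of Λ.
    set κ : ℂ := Real.pi * Complex.I / (τ * v) with hκ
    have hκ0 : κ ≠ 0 := div_ne_zero hπ hω
    have hd : κ ^ 2 = 3 * (2 * κ ^ 2 / 3) / 2 := by ring
    obtain ⟨-, rfl, rfl⟩ := (isW_degenerateP hκ0 hd).eq_of_poles h fun q => by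
      rw [lead_degenerateP_iff hκ0 hd, sinh_eq_zero_iff, hmem, hΛ']
      refine exists_congr fun n => ?_
      rw [hκ]
      generalize (Real.pi : ℂ) * Complex.I = π at *
      generalize (τ : ℂ) * v = ω at *
      rw [div_mul_eq_mul_div, div_eq_iff hω]
      constructor
      · intro e; exact mul_left_cancel₀ hπ (by linear_combination e)
      · rintro rfl; ring
    exact ⟨_, Or.inr (Or.inl ⟨_, κ, hκ0, hd, rfl, rfl, rfl⟩)⟩
  · push Not at h1
    obtain ⟨w, hw, hw'⟩ := h1
    obtain ⟨L, hL⟩ := exists_periodPair Λ hδ hΛ hv hw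
      ((LinearIndependent.pair_iff' hv0).2 hw')
    obtain ⟨-, rfl, rfl⟩ := (isW_weierstrassP L).eq_of_poles h fun q => by
      rw [lead_weierstrassP_iff, hL, hmem]
    exact ⟨_, Or.inl ⟨L, rfl, rfl, rfl⟩⟩

theorem isW_iff {g₂ g₃ : ℂ} {f : ℂ → ℂ} : IsW g₂ g₃ f ↔
    ∃ p z₀, IsWeierstrassP g₂ g₃ p ∧ f =ᶠ[codiscrete ℂ] fun z => p (z - z₀) := by
  constructor
  · intro h
    obtain ⟨p, hp⟩ := exists_isWeierstrassP g₂ g₃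
    obtain ⟨z₀, hz⟩ := hp.isW.1.eq_translate hp.isW.2 h
    exact ⟨p, z₀, hp, hz⟩
  · rintro ⟨p, z₀, hp, hz⟩
    refine (hp.isW.1.comp_add (-z₀)).congr ?_
    filter_upwards [hz] with z h
    rw [h, sub_eq_add_neg]

/-! ### The discriminant -/

theorem exists_degenerate {g₂ g₃ : ℂ} (h : g₂ ^ 3 - 27 * g₃ ^ 2 = 0) (h2 : g₂ ≠ 0) :
    ∃ d κ : ℂ, κ ≠ 0 ∧ κ ^ 2 = 3 * d / 2 ∧ g₂ = 3 * d ^ 2 ∧ g₃ = -d ^ 3 := by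
  have h3 : g₃ ≠ 0 := by
    rintro rfl
    exact h2 (pow_eq_zero_iff three_ne_zero |>.1 (by linear_combination h))
  -- Dividing g₃ = -d³ by g₂ = 3d² shows that d must be -3g₃/g₂.
  obtain ⟨κ, hκ⟩ := IsAlgClosed.exists_pow_nat_eq (3 * (-3 * g₃ / g₂) / 2) two_pos
  refine ⟨-3 * g₃ / g₂, κ, ?_, hκ, ?_, ?_⟩
  · rintro rfl
    refine h3 ?_
    calc g₃ = -(2 / 9) * g₂ * (3 * (-3 * g₃ / g₂) / 2) := by field_simp; norm_num
      _ = 0 := by rw [← hκ]; simp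
  · field_simp; linear_combination h
  · field_simp; linear_combination h

theorem IsWeierstrassP.exists_periodPair {g₂ g₃ : ℂ} {p : ℂ → ℂ} (h : IsWeierstrassP g₂ g₃ p)
    (hΔ : g₂ ^ 3 - 27 * g₃ ^ 2 ≠ 0) :
    ∃ L : PeriodPair, L.g₂ = g₂ ∧ L.g₃ = g₃ ∧ p = L.weierstrassP := by
  rcases h with h | ⟨d, κ, -, -, rfl, rfl, -⟩ | ⟨rfl, rfl, -⟩
  · exact h
  · exact absurd (by ring) hΔ
  · exact absurd (by ring) hΔ

/-! ### Addition of a point of the Weierstrass curve -/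

namespace IsW

variable {g₂ g₃ : ℂ} {p : ℂ → ℂ}

theorem eventually_ne (h : IsW g₂ g₃ p) (a : ℂ) : ∀ᶠ z in codiscrete ℂ, p z ≠ a :=
  eventually_ne_of_not_isConstant h.mero h.nonconst a

theorem exists_lead (h : IsW g₂ g₃ p) : ∃ q, Lead p q (-2) 1 := by
  obtain ⟨P, hP, hpP⟩ := exists_isNF h.mero
  have hW := h.congr hpP
  obtain ⟨q, hq⟩ := hW.isSol.exists_not_analyticAt hP hW.nonconst
  exact ⟨q, (hW.lead_of_not_analyticAt hP hq).congr
    ((eventually_nhdsNE_of_codiscrete hpP q).mono fun _ e => e.symm)⟩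

theorem comp_sub (h : IsW g₂ g₃ p) (a : ℂ) : IsW g₂ g₃ fun z => p (z - a) := by
  simpa [sub_eq_add_neg] using h.comp_add (-a)

/-- This is translation by the half period with value e, written as an involution on the values of
p. -/
theorem half_period (h : IsW g₂ g₃ p) {e κ : ℂ} (he : 4 * e ^ 3 - g₂ * e - g₃ = 0)
    (hκ : κ = 3 * e ^ 2 - g₂ / 4) (hκ0 : κ ≠ 0) : IsW g₂ g₃ fun z => e + κ / (p z - e) := by
  have hm : Meromorphic fun z => e + κ / (p z - e) :=
    (Meromorphic.const e).fun_add ((Meromorphic.const κ).fun_div (h.mero.fun_sub (.const e)))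
  refine ⟨hm, ?_, ?_⟩
  · rintro ⟨a, ha⟩
    refine h.nonconst ⟨e + κ / (a - e), ?_⟩
    filter_upwards [ha, h.eventually_ne e] with z h1 h2
    have h3 := sub_ne_zero.2 h2
    rw [← h1, add_sub_cancel_left, div_div_cancel₀ hκ0]
    ring
  · filter_upwards [eventually_codiscrete_analyticAt h.mero, h.ode, h.eventually_ne e]
      with z ha ho h2
    have h3 := sub_ne_zero.2 h2
    have hd := (((ha.differentiableAt.hasDerivAt.sub_const e).fun_inv h3).const_mul κ).const_add e
    have hd' : deriv (fun z => e + κ / (p z - e)) z = κ * (-deriv p z / (p z - e) ^ 2) := by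
      simpa only [div_eq_mul_inv] using hd.deriv
    rw [hd']
    generalize deriv p z = y at *
    obtain ⟨φ, hφ⟩ : ∃ φ, φ = p z - e := ⟨_, rfl⟩
    rw [← hφ] at h3 ⊢
    have hp : p z = φ + e := by rw [hφ]; ring
    rw [hp] at ho
    have hg : g₂ = 12 * e ^ 2 - 4 * κ := by rw [hκ]; ring
    have hg3 : g₃ = 4 * e ^ 3 - g₂ * e := by linear_combination -he
    rw [hg3, hg] at ho ⊢
    field_simp
    linear_combination κ ^ 2 * ho

/-- At a pole p' has order -3. A quadratic in p has order -4 when its top coefficient is nonzero,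
and order at least -2 otherwise. -/
theorem deriv_ne_quadratic (h : IsW g₂ g₃ p) {c a₂ a₁ a₀ : ℂ} (hc : c ≠ 0) :
    ¬ ∀ᶠ z in codiscrete ℂ, c * deriv p z = a₂ * p z ^ 2 + a₁ * p z + a₀ := by
  intro hz
  obtain ⟨q, hq⟩ := h.exists_lead
  have h1 := hq.deriv.const_mul c
  have h2 := ((((hq.pow 2).const_mul a₂).cast (m := -4) (b := a₂) (by norm_num) (by ring)).add
    ((hq.const_mul a₁).weaken (by norm_num))).add ((Lead.const a₀ q).weaken (by norm_num))
  have hzq := eventually_nhdsNE_of_codiscrete hz q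
  have h3 := (h1.weaken (m := -4) (by norm_num)).unique
    (h2.congr (hzq.mono fun _ e => e.symm))
  have h5 := ((hq.const_mul a₁).weaken (m := -3) (by norm_num)).add
    ((Lead.const a₀ q).weaken (by norm_num))
  have h6 := h1.unique ((h5.congr (hzq.mono fun z e => by
    rw [e, show a₂ = 0 by linear_combination -h3]; ring)).cast (by norm_num) rfl)
  push_cast at h6
  exact hc (by linear_combination -h6 / 2)

/-- The function `p(z + a)`, where the point `(p(a), p'(a))` of the curve is `(e, -c)`. -/
theorem add_point_deriv (h : IsW g₂ g₃ p) {e c : ℂ} (hc : c ^ 2 = 4 * e ^ 3 - g₂ * e - g₃)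
    {w : ℂ → ℂ} (hw : w = fun z => -p z - e + ((deriv p z + c) / (p z - e)) ^ 2 / 4) :
    ∀ᶠ z in codiscrete ℂ, p z ≠ e ∧
      deriv w z = -((deriv p z + c) / (p z - e) * (w z - p z) + deriv p z) ∧
      deriv w z ^ 2 = 4 * w z ^ 3 - g₂ * w z - g₃ := by
  filter_upwards [eventually_codiscrete_analyticAt h.mero, h.ode, h.deriv_deriv,
    h.eventually_ne e] with z ha ho hdd hne
  have hD := sub_ne_zero.2 hne
  have d1 := ha.differentiableAt.hasDerivAt
  have d2 := ha.deriv.differentiableAt.hasDerivAt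
  rw [hdd] at d2
  have hd := (d1.fun_neg.sub_const e).fun_add
    ((((d2.add_const c).fun_div (d1.sub_const e) hD).fun_pow 2).div_const 4)
  rw [← hw] at hd
  have hwz : w z = -p z - e + ((deriv p z + c) / (p z - e)) ^ 2 / 4 := congrFun hw z
  rw [hd.deriv]
  simp only [show (2 - 1 : ℕ) = 1 from rfl, pow_one]
  push_cast
  clear hd d1 d2 hdd ha hw
  generalize deriv p z = y at *
  generalize p z = x at *
  generalize w z = v at *
  obtain ⟨m, hm⟩ : ∃ m, m = (y + c) / (x - e) := ⟨_, rfl⟩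
  rw [← hm] at hwz ⊢
  have hmD : m * (x - e) = y + c := by rw [hm, div_mul_cancel₀ _ hD]
  have hyc : y ^ 2 - c ^ 2 = (x - e) * (4 * (x ^ 2 + x * e + e ^ 2) - g₂) := by
    linear_combination ho - hc
  have hmy : 2 * m * y = 4 * (v + x + e) * (x - e) + 4 * (x ^ 2 + x * e + e ^ 2) - g₂ := by
    refine mul_left_cancel₀ hD ?_
    linear_combination (y - c - m * (x - e)) * hmD + hyc - (x - e) ^ 2 * 4 * hwz
  have hder : -y + 2 * m * (((6 * x ^ 2 - g₂ / 2) * (x - e) - (y + c) * y) / (x - e) ^ 2) / 4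
      = -(m * (v - x) + y) := by
    rw [← hmD]
    field_simp
    linear_combination -m * hmy
  refine ⟨hne, hder, ?_⟩
  rw [hder]
  linear_combination -4 * (v - x) ^ 2 * hwz + (v - x) * hmy + ho

theorem add_point (h : IsW g₂ g₃ p) {e c : ℂ} (hc0 : c ≠ 0)
    (hc : c ^ 2 = 4 * e ^ 3 - g₂ * e - g₃) :
    IsW g₂ g₃ fun z => -p z - e + ((deriv p z + c) / (p z - e)) ^ 2 / 4 := by
  have hd := h.add_point_deriv hc rfl
  have hp' : Meromorphic (deriv p) := h.mero.deriv
  refine ⟨(h.mero.fun_neg.fun_sub (.const e)).fun_add ((((hp'.fun_add (.const c)).fun_div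
    (h.mero.fun_sub (.const e))).fun_pow (n := 2)).fun_div (.const 4)), ?_, ?_⟩
  · rintro ⟨a, ha⟩
    -- If the translate were constant, clearing denominators and inserting the equation for p'²
    -- would cancel the cubic terms and make 2cp' a quadratic in p.
    refine h.deriv_ne_quadratic (c := 2 * c) (a₂ := 4 * (a - e)) (a₁ := -8 * a * e - 4 * e ^ 2 + g₂)
      (a₀ := 4 * a * e ^ 2 + 4 * e ^ 3 + g₃ - c ^ 2) (mul_ne_zero two_ne_zero hc0) ?_
    filter_upwards [ha, h.ode, h.eventually_ne e] with z h1 h2 h3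
    have hD := sub_ne_zero.2 h3
    field_simp at h1
    linear_combination h1 - h2
  · filter_upwards [hd] with z hz using hz.2.2

end IsW

/-! ### The two forms of the second family -/

section IsTwo

variable {b σ : ℂ} {y : ℂ → ℂ}

/-- Translate by the half period with value e₃. It exchanges the roots -b and e₂, so w + b becomes
(2e₃ + e₂)(p - e₂)/(p - e₃). As the translation is an involution, the same computation proves both
directions. -/
theorem isTwo_iff_even (hσ : σ ≠ 0) {e₂ e₃ : ℂ} (h23 : e₂ + e₃ = b)
    (he : 2 * e₂ * e₃ = σ - 4 * b ^ 2) (hne : e₂ ≠ e₃) :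
    IsTwo b σ y ↔ ∃ p, IsW (12 * b ^ 2 - 2 * σ) (8 * b ^ 3 - 2 * σ * b) p ∧
      y =ᶠ[codiscrete ℂ] fun z =>
        -(e₂ - e₃) * ((p z + b) ^ 2 - σ / 2) / ((p z - e₂) * (p z - e₃)) := by
  subst h23
  obtain rfl : σ = 2 * e₂ * e₃ + 4 * (e₂ + e₃) ^ 2 := by linear_combination -he
  clear he
  set κ := (2 * e₃ + e₂) * (e₃ - e₂) with hκ
  have hσ' : (2 * e₂ + e₃) * (2 * e₃ + e₂) ≠ 0 := fun h => hσ (by linear_combination 2 * h)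
  have hκ0 : κ ≠ 0 := mul_ne_zero (right_ne_zero_of_mul hσ') (sub_ne_zero.2 hne.symm)
  have key : ∀ p : ℂ → ℂ, IsW (12 * (e₂ + e₃) ^ 2 - 2 * (2 * e₂ * e₃ + 4 * (e₂ + e₃) ^ 2))
      (8 * (e₂ + e₃) ^ 3 - 2 * (2 * e₂ * e₃ + 4 * (e₂ + e₃) ^ 2) * (e₂ + e₃)) p →
      IsW (12 * (e₂ + e₃) ^ 2 - 2 * (2 * e₂ * e₃ + 4 * (e₂ + e₃) ^ 2))
        (8 * (e₂ + e₃) ^ 3 - 2 * (2 * e₂ * e₃ + 4 * (e₂ + e₃) ^ 2) * (e₂ + e₃))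
        (fun z => e₃ + κ / (p z - e₃)) ∧
      ∀ᶠ z in codiscrete ℂ, p z = e₃ + κ / (e₃ + κ / (p z - e₃) - e₃) ∧
        e₃ + κ / (p z - e₃) + (e₂ + e₃) - (2 * e₂ * e₃ + 4 * (e₂ + e₃) ^ 2) / 2 /
          (e₃ + κ / (p z - e₃) + (e₂ + e₃)) =
        -(e₂ - e₃) * ((p z + (e₂ + e₃)) ^ 2 - (2 * e₂ * e₃ + 4 * (e₂ + e₃) ^ 2) / 2)
          / ((p z - e₂) * (p z - e₃)) := by
    intro p hp
    refine ⟨hp.half_period (by ring) (by rw [hκ]; ring) hκ0, ?_⟩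
    filter_upwards [hp.eventually_ne e₂, hp.eventually_ne e₃] with z h2 h3
    have h2' := sub_ne_zero.2 h2
    have h3' := sub_ne_zero.2 h3
    refine ⟨by rw [add_sub_cancel_left, div_div_cancel₀ hκ0]; ring, ?_⟩
    have hv : e₃ + κ / (p z - e₃) + (e₂ + e₃) = (2 * e₃ + e₂) * (p z - e₂) / (p z - e₃) := by
      rw [hκ]; field_simp; ring
    have h4 := right_ne_zero_of_mul hσ'
    rw [hv]
    field_simp
    ring
  constructor
  · rintro ⟨-, w, hw, hy⟩
    obtain ⟨h1, h2⟩ := key w hw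
    obtain ⟨-, h3⟩ := key _ h1
    refine ⟨_, h1, ?_⟩
    filter_upwards [hy, h2, h3] with z e1 e2 e3
    rw [e1, ← e3.2, ← e2.1]
  · rintro ⟨p, hp, hy⟩
    obtain ⟨h1, h2⟩ := key p hp
    refine ⟨hσ, _, h1, ?_⟩
    filter_upwards [hy, h2] with z e1 e2
    rw [e1, e2.2]

/-- Let w₊ and w₋ be the translates of p by the curve points attached to c and -c. Then w₊ - w₋ =
cp'/(p - e)² and (w₊ + b)(w₋ + b) = (e + b)² = σ/2: the two translates differ by the half period
with value -b. -/
theorem isTwo_of_odd {e c : ℂ} (hc0 : c ≠ 0) (hσ : σ = 2 * (e + b) ^ 2)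
    (hc : c ^ 2 = 4 * (e + b) ^ 2 * (2 * e - b)) {p : ℂ → ℂ}
    (hp : IsW (12 * b ^ 2 - 2 * σ) (8 * b ^ 3 - 2 * σ * b) p) :
    IsW (12 * b ^ 2 - 2 * σ) (8 * b ^ 3 - 2 * σ * b)
      (fun z => -p z - e + ((deriv p z + c) / (p z - e)) ^ 2 / 4) ∧
    ∀ᶠ z in codiscrete ℂ, c * deriv p z / (p z - e) ^ 2
      = -p z - e + ((deriv p z + c) / (p z - e)) ^ 2 / 4 + b
        - σ / 2 / (-p z - e + ((deriv p z + c) / (p z - e)) ^ 2 / 4 + b) := by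
  have hc' : c ^ 2 = 4 * e ^ 3 - (12 * b ^ 2 - 2 * σ) * e - (8 * b ^ 3 - 2 * σ * b) := by
    rw [hc, hσ]; ring
  have hw := hp.add_point hc0 hc'
  refine ⟨hw, ?_⟩
  filter_upwards [hp.ode, hp.eventually_ne e, hw.eventually_ne (-b)] with z h1 h2 h3
  have hD := sub_ne_zero.2 h2
  have h4 : -p z - e + ((deriv p z + c) / (p z - e)) ^ 2 / 4 + b ≠ 0 :=
    fun h => h3 (eq_neg_of_add_eq_zero_left h)
  rw [eq_sub_iff_add_eq, ← eq_sub_iff_add_eq', div_eq_iff h4]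
  subst hσ
  generalize deriv p z = y at *
  generalize p z = x at *
  obtain ⟨D, hD'⟩ : ∃ D, D = x - e := ⟨_, rfl⟩
  obtain rfl : x = D + e := by rw [hD']; ring
  rw [add_sub_cancel_right] at hD ⊢
  clear h3 h4 hc' hw
  have h5 : y ^ 2 - c ^ 2 = D * (4 * D ^ 2 + 12 * e * D + 12 * e ^ 2
      - (12 * b ^ 2 - 4 * (e + b) ^ 2)) := by
    linear_combination h1 - hc
  have h6 : y ^ 2 + c ^ 2 = D * (4 * D ^ 2 + 12 * e * D + 12 * e ^ 2
      - (12 * b ^ 2 - 4 * (e + b) ^ 2)) + 8 * (e + b) ^ 2 * (2 * e - b) := by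
    linear_combination h1 + hc
  have h7 : (-(D + e) - e + ((y + c) / D) ^ 2 / 4 + b) * (-(D + e) - e + ((y - c) / D) ^ 2 / 4 + b)
      = (e + b) ^ 2 := by
    have : (-(D + e) - e + ((y + c) / D) ^ 2 / 4 + b) * (-(D + e) - e + ((y - c) / D) ^ 2 / 4 + b)
      = (b - D - 2 * e) ^ 2 + (b - D - 2 * e) * (y ^ 2 + c ^ 2) / (2 * D ^ 2)
        + (y ^ 2 - c ^ 2) ^ 2 / (16 * D ^ 4) := by field_simp; ring
    rw [this, h5, h6]
    field_simp
    ring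
  have h8 : -(D + e) - e + ((y + c) / D) ^ 2 / 4 + b - c * y / D ^ 2
      = -(D + e) - e + ((y - c) / D) ^ 2 / 4 + b := by field_simp; ring
  rw [h8]
  linear_combination -h7

theorem IsTwo.exists_odd {e c : ℂ} (hc0 : c ≠ 0) (hσ : σ = 2 * (e + b) ^ 2)
    (hc : c ^ 2 = 4 * (e + b) ^ 2 * (2 * e - b)) (h : IsTwo b σ y) :
    ∃ p, IsW (12 * b ^ 2 - 2 * σ) (8 * b ^ 3 - 2 * σ * b) p ∧
      y =ᶠ[codiscrete ℂ] fun z => c * deriv p z / (p z - e) ^ 2 := by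
  obtain ⟨-, w, hw, hy⟩ := h
  have hc' : (-c) ^ 2 = 4 * e ^ 3 - (12 * b ^ 2 - 2 * σ) * e - (8 * b ^ 3 - 2 * σ * b) := by
    rw [neg_sq, hc, hσ]; ring
  set p : ℂ → ℂ := fun z => -w z - e + ((deriv w z + -c) / (w z - e)) ^ 2 / 4 with hpd
  have hp : IsW (12 * b ^ 2 - 2 * σ) (8 * b ^ 3 - 2 * σ * b) p :=
    hw.add_point (neg_ne_zero.2 hc0) hc'
  have hd := hw.add_point_deriv hc' hpd
  obtain ⟨-, hy'⟩ := isTwo_of_odd hc0 hσ hc hp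
  refine ⟨p, hp, ?_⟩
  filter_upwards [hy, hd, hy', hp.eventually_ne e] with z h1 h2 h3 h4
  -- Adding the opposite point undoes the translation: the slope of the chord only changes sign.
  have h5 : -p z - e + ((deriv p z + c) / (p z - e)) ^ 2 / 4 = w z := by
    have hD := sub_ne_zero.2 h2.1
    have hD' := sub_ne_zero.2 h4
    obtain ⟨m, hm⟩ : ∃ m, m = (deriv w z + -c) / (w z - e) := ⟨_, rfl⟩
    have h6 : m * (w z - e) = deriv w z + -c := by rw [hm, div_mul_cancel₀ _ hD]
    have h7 : p z = -w z - e + m ^ 2 / 4 := by rw [hm]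
    have h8 : (deriv p z + c) / (p z - e) = -m := by
      rw [div_eq_iff hD', h2.2.1, ← hm]
      linear_combination h6
    rw [h8, h7]; ring
  rw [h3, h1, h5]

end IsTwo

/-! ### The subequation of degree four -/

/-- With v = p + b, y = v - σ/(2v) and m = v + σ/(2v) one has m² = y² + 2σ and y'² = 4m³ - 12bm².
Eliminating m gives the quartic. Conversely the quartic makes m a rational function of y and y', and
v = (m + y)/2 is recovered without choosing a square root. -/
theorem isTwo_iff_quartic {b σ : ℂ} {y : ℂ → ℂ} (hσ : σ ≠ 0) :
    IsTwo b σ y ↔ Meromorphic y ∧ ¬ IsConstant y ∧ ∀ᶠ z in codiscrete ℂ,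
      (deriv y z ^ 2 + 12 * b * (y z ^ 2 + 2 * σ)) ^ 2 = 16 * (y z ^ 2 + 2 * σ) ^ 3 := by
  constructor
  · intro h
    refine ⟨?_, h.not_isConstant, ?_⟩
    · obtain ⟨-, w, hw, hy⟩ := h
      refine Meromorphic.congr_codiscrete (f := fun z => w z + b - σ / 2 / (w z + b)) ?_ hy.symm
      exact (hw.mero.fun_add (.const b)).fun_sub
        ((Meromorphic.const (σ / 2)).fun_div (hw.mero.fun_add (.const b)))
    · obtain ⟨-, w, hw, hy⟩ := h
      filter_upwards [hy, deriv_congr_codiscrete hy, hw.eventually_ne (-b), hw.ode,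
        eventually_codiscrete_analyticAt hw.mero] with z h1 h2 h3 h4 h5
      have hv : w z + b ≠ 0 := fun h => h3 (eq_neg_of_add_eq_zero_left h)
      have d1 := h5.differentiableAt.hasDerivAt.add_const b
      have d2 : deriv (fun z => w z + b - σ / 2 / (w z + b)) z
          = deriv w z - σ / 2 * (-deriv w z / (w z + b) ^ 2) := by
        have := (d1.fun_sub ((d1.fun_inv hv).const_mul (σ / 2))).deriv
        simpa only [div_eq_mul_inv] using this
      rw [h2, h1, d2]
      generalize deriv w z = D at *
      obtain ⟨v, hv'⟩ : ∃ v, w z = v - b := ⟨w z + b, by ring⟩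
      rw [hv', sub_add_cancel] at hv ⊢
      rw [hv'] at h4
      have e1 : (v - σ / 2 / v) ^ 2 + 2 * σ = (v + σ / 2 / v) ^ 2 := by field_simp; ring
      have e2 : (D - σ / 2 * (-D / v ^ 2)) ^ 2
          = 4 * (v + σ / 2 / v) ^ 3 - 12 * b * (v + σ / 2 / v) ^ 2 := by
        field_simp
        linear_combination 2 * (2 * v ^ 2 + σ) ^ 2 * h4
      rw [e1, e2]
      ring
  · rintro ⟨hm, hnc, ho⟩
    have hm' : Meromorphic (deriv y) := hm.deriv
    obtain ⟨a, ha⟩ := IsAlgClosed.exists_pow_nat_eq (-2 * σ) two_pos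
    have hne : ∀ᶠ z in codiscrete ℂ, y z ^ 2 + 2 * σ ≠ 0 := by
      filter_upwards [eventually_ne_of_not_isConstant hm hnc a,
        eventually_ne_of_not_isConstant hm hnc (-a)] with z h1 h2 h3
      have : (y z - a) * (y z + a) = 0 := by linear_combination h3 - ha
      rcases mul_eq_zero.1 this with h | h
      · exact h1 (sub_eq_zero.1 h)
      · exact h2 (eq_neg_of_add_eq_zero_left h)
    set m : ℂ → ℂ := fun z => (deriv y z ^ 2 + 12 * b * (y z ^ 2 + 2 * σ)) / (4 * (y z ^ 2 + 2 * σ))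
      with hmd
    have hq : Meromorphic fun z => y z ^ 2 + 2 * σ := (hm.fun_pow (n := 2)).fun_add (.const _)
    have hmm : Meromorphic m :=
      ((hm'.fun_pow (n := 2)).fun_add ((Meromorphic.const (12 * b)).fun_mul hq)).fun_div
        ((Meromorphic.const 4).fun_mul hq)
    have hm2 : ∀ᶠ z in codiscrete ℂ, m z ^ 2 = y z ^ 2 + 2 * σ := by
      filter_upwards [ho, hne] with z h1 h2
      rw [hmd]
      simp only
      rw [div_pow, h1, div_eq_iff (by exact pow_ne_zero 2 (mul_ne_zero (by norm_num : (4 : ℂ) ≠ 0) h2))]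
      ring
    have hwm : Meromorphic fun z => (m z + y z) / 2 - b :=
      ((hmm.fun_add hm).fun_div (.const 2)).fun_sub (.const b)
    -- Because (m + y)(m - y) = 2σ is not zero.
    have hvne : ∀ᶠ z in codiscrete ℂ, m z + y z ≠ 0 := by
      filter_upwards [hm2] with z h1 h2
      exact hσ (by linear_combination (m z - y z) / 2 * h2 - h1 / 2)
    have hyw : y =ᶠ[codiscrete ℂ] fun z =>
        (m z + y z) / 2 - b + b - σ / 2 / ((m z + y z) / 2 - b + b) := by
      filter_upwards [hm2, hvne] with z h1 h2
      rw [sub_add_cancel]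
      field_simp
      linear_combination -h1
    refine ⟨hσ, _, ⟨hwm, ?_, ?_⟩, hyw⟩
    · rintro ⟨a, ha⟩
      exact hnc ⟨a + b - σ / 2 / (a + b), by filter_upwards [hyw, ha] with z h1 h2; rw [h1, h2]⟩
    · filter_upwards [hm2, hvne, eventually_nhds_of_codiscrete hm2, hne,
        eventually_codiscrete_analyticAt hm, eventually_codiscrete_analyticAt hmm]
        with z h1 h2 h3 h4 h5 h6
      have d1 := h5.differentiableAt.hasDerivAt
      have d2 := h6.differentiableAt.hasDerivAt
      have d3 : 2 * m z * deriv m z = 2 * y z * deriv y z := by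
        have e1 := (d2.fun_pow 2).deriv
        rw [EventuallyEq.deriv_eq h3, ((d1.fun_pow 2).add_const _).deriv] at e1
        simpa using e1.symm
      have d4 : deriv y z ^ 2 = m z ^ 2 * (4 * m z - 12 * b) := by
        have : m z * (4 * (y z ^ 2 + 2 * σ)) = deriv y z ^ 2 + 12 * b * (y z ^ 2 + 2 * σ) := by
          rw [hmd]
          exact div_mul_cancel₀ _ (mul_ne_zero (by norm_num : (4 : ℂ) ≠ 0) h4)
        linear_combination -this + (12 * b - 4 * m z) * h1
      rw [(((d2.fun_add d1).div_const 2).sub_const b).deriv]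
      have hmz : m z ≠ 0 := fun h => h4 (by rw [← h1, h]; ring)
      refine mul_left_cancel₀ (pow_ne_zero 2 hmz) ?_
      have hD : m z * (deriv m z + deriv y z) = (m z + y z) * deriv y z := by
        linear_combination d3 / 2
      generalize deriv m z = M at *
      generalize deriv y z = Y at *
      have : m z ^ 2 * ((M + Y) / 2) ^ 2 = (m z + y z) ^ 2 * Y ^ 2 / 4 := by
        rw [← mul_pow, ← mul_div_assoc, hD]; ring
      rw [this, d4]
      have hs : σ = (m z ^ 2 - y z ^ 2) / 2 := by linear_combination -h1 / 2
      rw [hs]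
      ring

/-! ### The normalised equation -/

namespace Coeffs

variable (q : Coeffs)

/-- `(s₂ - s₁²) / c²` -/
def S : ℂ := (q.s₂ - q.s₁ ^ 2) / q.c ^ 2

/-- `(s₃ - 3 s₁ s₂ + 2 s₁³) / c³` -/
def T : ℂ := (q.s₃ - 3 * q.s₁ * q.s₂ + 2 * q.s₁ ^ 3) / q.c ^ 3

/-- `σ₂ / c²` -/
def σ : ℂ := (5 * q.S + 8 * q.b ^ 2) / 3

/-- `(u - s₁) / c` -/
def normalize (u : ℂ → ℂ) (z : ℂ) : ℂ := (u z - q.s₁) / q.c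

theorem flip_S : q.flip.S = q.S := by simp [S, flip]

theorem flip_T : q.flip.T = -q.T := by
  simp only [T, flip, Odd.neg_pow (by decide : Odd 3), div_neg]

theorem flip_normalize (u : ℂ → ℂ) (z : ℂ) : q.flip.normalize u z = -q.normalize u z := by
  simp only [normalize, flip, div_neg]

variable {q} (hc : q.c ≠ 0)
include hc

theorem s₂_eq : q.s₂ = q.s₁ ^ 2 + q.S * q.c ^ 2 := by rw [S]; field_simp; ring

theorem s₃_eq : q.s₃ = q.s₁ ^ 3 + 3 * q.s₁ * q.S * q.c ^ 2 + q.T * q.c ^ 3 := by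
  rw [S, T]; field_simp; ring

theorem eq_normalize (u : ℂ → ℂ) (z : ℂ) : u z = q.s₁ + q.c * q.normalize u z := by
  rw [normalize]; field_simp; ring

theorem normalize_eq_iff {u : ℂ → ℂ} {z v : ℂ} : q.normalize u z = v ↔ u z = q.s₁ + q.c * v := by
  rw [normalize, div_eq_iff hc]
  constructor <;> intro h <;> linear_combination h

theorem eventually_normalize_iff {u v : ℂ → ℂ} :
    q.normalize u =ᶠ[codiscrete ℂ] v ↔ u =ᶠ[codiscrete ℂ] fun z => q.s₁ + q.c * v z :=
  eventually_congr (Eventually.of_forall fun _ => normalize_eq_iff hc)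

theorem meromorphic_normalize_iff {u : ℂ → ℂ} : Meromorphic (q.normalize u) ↔ Meromorphic u := by
  constructor
  · intro h
    rw [funext (eq_normalize hc u)]
    exact (Meromorphic.const _).fun_add ((Meromorphic.const _).fun_mul h)
  · intro h
    exact (h.fun_sub (.const _)).fun_div (.const _)

theorem isConstant_normalize_iff {u : ℂ → ℂ} : IsConstant (q.normalize u) ↔ IsConstant u := by
  constructor
  · rintro ⟨a, ha⟩
    exact ⟨_, (eventually_normalize_iff hc).1 ha⟩
  · rintro ⟨a, ha⟩
    exact ⟨(a - q.s₁) / q.c, by filter_upwards [ha] with z hz; rw [normalize, hz]⟩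

omit hc in
theorem deriv_normalize (u : ℂ → ℂ) (z : ℂ) : deriv (q.normalize u) z = deriv u z / q.c := by
  have : q.normalize u = fun z => (u z - q.s₁) / q.c := rfl
  rw [this, deriv_div_const, deriv_sub_const]

theorem deriv_eq (u : ℂ → ℂ) (z : ℂ) : deriv u z = q.c * deriv (q.normalize u) z := by
  rw [deriv_normalize]; field_simp

theorem isMeromorphicSolution_iff {u : ℂ → ℂ} :
    IsMeromorphicSolution q u ↔ IsSol (q.K / q.c ^ 2) q.b q.S q.T (q.normalize u) := by
  have h1 : deriv (q.normalize u) = fun z => deriv u z / q.c := funext (deriv_normalize u)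
  have h2 : deriv (deriv (q.normalize u)) = fun z => deriv (deriv u) z / q.c := by
    rw [h1]; exact funext fun z => deriv_div_const _
  have h3 : deriv (deriv (deriv (q.normalize u))) = fun z => deriv (deriv (deriv u)) z / q.c := by
    rw [h2]; exact funext fun z => deriv_div_const _
  have h4 : ∀ z, q.K = deriv u z * iteratedDeriv 3 u z - (iteratedDeriv 2 u z) ^ 2 / 2
      + 30 * q.b * (deriv u z) ^ 2
      - 30 / q.c ^ 2 * ((u z) ^ 4 - 4 * q.s₁ * (u z) ^ 3 + 6 * q.s₂ * (u z) ^ 2 - 4 * q.s₃ * u z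
          + 3 * q.s₁ ^ 4 - 6 * q.s₁ ^ 2 * q.s₂ + 4 * q.s₁ * q.s₃) ↔
      swift q.b q.S q.T (q.normalize u) z = q.K / q.c ^ 2 := by
    intro z
    simp only [iteratedDeriv_succ, iteratedDeriv_zero]
    rw [swift, h3, h2, h1, eq_div_iff (pow_ne_zero 2 hc), eq_comm, normalize, S, T]
    refine Eq.congr_left ?_
    field_simp
    ring
  constructor
  · rintro ⟨hm, ho⟩
    exact ⟨(meromorphic_normalize_iff hc).2 hm, ho.mono fun z hz => (h4 z).1 hz⟩
  · rintro ⟨hm, ho⟩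
    exact ⟨(meromorphic_normalize_iff hc).1 hm, ho.mono fun z hz => (h4 z).2 hz⟩

/-! ### The first family -/

theorem g₂One_eq : g₂One q = -20 * (q.S + q.b ^ 2) := by rw [g₂One, S]; field_simp; ring

theorem g₃One_eq : g₃One q = 10 * (q.T + 2 * q.b * q.S + 4 * q.b ^ 3) := by
  rw [g₃One, S, T]; field_simp; ring

theorem constraintOne_iff : ConstraintOne q ↔ q.K / q.c ^ 2
    = 10 * (-128 * q.b ^ 4 - 88 * q.b ^ 2 * q.S - 5 * q.S ^ 2 - 18 * q.b * q.T) := by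
  rw [ConstraintOne, div_eq_iff (pow_ne_zero 2 hc), s₃_eq hc, s₂_eq hc]
  constructor
  · intro h
    refine mul_left_cancel₀ (pow_ne_zero 2 hc) ?_
    linear_combination h
  · intro h
    linear_combination q.c ^ 2 * h

theorem isEllipticOne_iff {u : ℂ → ℂ} : IsEllipticOne q u ↔
    ConstraintOne q ∧ IsW (g₂One q) (g₃One q) fun z => q.normalize u z - q.b := by
  rw [IsEllipticOne, isW_iff]
  refine and_congr_right fun _ => exists_congr fun p => exists_congr fun z₀ => and_congr_right
    fun _ => eventually_congr (Eventually.of_forall fun z => ?_)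
  rw [sub_eq_iff_eq_add, normalize_eq_iff hc, mul_add]
  constructor <;> intro h <;> rw [h] <;> ring

theorem isEllipticOne_flip_iff {u : ℂ → ℂ} : IsEllipticOne q.flip u ↔
    q.K / q.c ^ 2 = 10 * (-128 * q.b ^ 4 - 88 * q.b ^ 2 * q.S - 5 * q.S ^ 2 + 18 * q.b * q.T) ∧
    IsW (-20 * (q.S + q.b ^ 2)) (10 * (-q.T + 2 * q.b * q.S + 4 * q.b ^ 3))
      fun z => -q.normalize u z - q.b := by
  have hc' : q.flip.c ≠ 0 := neg_ne_zero.2 hc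
  rw [isEllipticOne_iff hc', constraintOne_iff hc', g₂One_eq hc', g₃One_eq hc', flip_S, flip_T]
  simp only [flip_normalize]
  simp only [flip, neg_sq, mul_neg, sub_neg_eq_add]

theorem satisfiesFirstOrder_of_isEllipticOne {u : ℂ → ℂ} (h : IsEllipticOne q u) :
    SatisfiesFirstOrder (F₂ q) u := by
  obtain ⟨-, hw⟩ := (isEllipticOne_iff hc).1 h
  filter_upwards [hw.ode] with z hz
  rw [deriv_sub_const, g₂One_eq hc, g₃One_eq hc] at hz
  simp only [F₂, evalEval, eval_add, eval_sub, eval_mul, eval_pow, eval_C, eval_X, eval_ofNat]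
  rw [deriv_eq hc, eq_normalize hc u z, s₃_eq hc, s₂_eq hc]
  linear_combination q.c ^ 3 * hz

/-- Shifting the argument of coth by πi/2 turns it into tanh. So the formula is the degenerate
Weierstrass function with d = 2k²/3, and the constraints express g₂ = 3d², g₃ = -d³ and the
condition on K through k. -/
theorem isTrigoOne_iff {u : ℂ → ℂ} : IsTrigoOne q u ↔
    IsEllipticOne q u ∧ discOne q = 0 ∧ g₂One q ≠ 0 := by
  have hform : ∀ {k z₀ z : ℂ}, k ≠ 0 → degenerateP (2 * k ^ 2 / 3) k
      (z - (z₀ - Real.pi * Complex.I / 2 / k))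
        = k ^ 2 * Complex.tanh (k * (z - z₀)) ^ 2 - 2 / 3 * k ^ 2 := by
    intro k z₀ z hk
    have h1 : k * (z - (z₀ - Real.pi * Complex.I / 2 / k))
        = k * (z - z₀) + Real.pi / 2 * Complex.I := by field_simp; ring
    have h2 : Complex.cosh (k * (z - z₀) + Real.pi / 2 * Complex.I)
        = Complex.sinh (k * (z - z₀)) * Complex.I := by
      rw [Complex.cosh_add, Complex.cosh_mul_I, Complex.sinh_mul_I, Complex.cos_pi_div_two,
        Complex.sin_pi_div_two]; ring
    have h3 : Complex.sinh (k * (z - z₀) + Real.pi / 2 * Complex.I)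
        = Complex.cosh (k * (z - z₀)) * Complex.I := by
      rw [Complex.sinh_add, Complex.cosh_mul_I, Complex.sinh_mul_I, Complex.cos_pi_div_two,
        Complex.sin_pi_div_two]; ring
    rw [degenerateP, h1, h2, h3, mul_div_mul_right _ _ Complex.I_ne_zero,
      Complex.tanh_eq_sinh_div_cosh]
    ring
  rw [isEllipticOne_iff hc, constraintOne_iff hc, discOne, g₂One_eq hc, g₃One_eq hc]
  constructor
  · rintro ⟨k, z₀, hk, hk4, hs3, hK, hu⟩
    have hS : q.S = -(q.b ^ 2) - k ^ 4 / 15 := by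
      rw [S, hk4]; field_simp; ring
    have hT : q.T = -(2 / 3 * k ^ 2) ^ 3 / 10 - 2 * q.b * q.S - 4 * q.b ^ 3 := by
      rw [T, div_eq_iff (pow_ne_zero 3 hc), hs3, s₂_eq hc, hS]
      ring
    have e2 : -20 * (q.S + q.b ^ 2) = 3 * (2 * k ^ 2 / 3) ^ 2 := by rw [hS]; ring
    have e3 : 10 * (q.T + 2 * q.b * q.S + 4 * q.b ^ 3) = -(2 * k ^ 2 / 3) ^ 3 := by rw [hT]; ring
    refine ⟨⟨?_, ?_⟩, ?_, ?_⟩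
    · rw [hK, hT, hS]; field_simp; ring
    · rw [e2, e3]
      refine ((isW_degenerateP hk (by ring)).comp_sub
        (z₀ - Real.pi * Complex.I / 2 / k)).congr ?_
      filter_upwards [hu] with z hz
      rw [hform hk, normalize, hz]
      field_simp
      ring
    · rw [e2, e3]; ring
    · rw [e2]
      have : k ^ 2 ≠ 0 := pow_ne_zero 2 hk
      exact mul_ne_zero three_ne_zero (pow_ne_zero 2 (by simpa using this))
  · rintro ⟨⟨hK, hw⟩, hΔ, h2⟩
    obtain ⟨d, k, hk, hd, e2, e3⟩ := exists_degenerate hΔ h2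
    obtain rfl : d = 2 * k ^ 2 / 3 := by rw [hd]; ring
    have hS : q.S = -(q.b ^ 2) - k ^ 4 / 15 := by linear_combination -e2 / 20
    have hT : q.T = -(2 / 3 * k ^ 2) ^ 3 / 10 - 2 * q.b * q.S - 4 * q.b ^ 3 := by
      linear_combination e3 / 10
    rw [e2, e3] at hw
    obtain ⟨z₀, hz⟩ := (isW_degenerateP hk hd).eq_translate (lead_degenerateP hk hd) hw
    refine ⟨k, z₀ + Real.pi * Complex.I / 2 / k, hk, ?_, ?_, ?_, ?_⟩
    · rw [s₂_eq hc, hS]; field_simp; ring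
    · rw [s₃_eq hc, hT, hS]; field_simp; ring
    · rw [div_eq_iff (pow_ne_zero 2 hc)] at hK
      rw [hK, hT, hS]; ring
    · filter_upwards [hz] with z h1
      rw [← hform hk, add_sub_cancel_right, ← h1, eq_normalize hc u z]
      ring

/-! ### The second family -/

theorem g₂Two_eq : g₂Two q = 12 * q.b ^ 2 - 2 * q.σ := by rw [g₂Two, σ, S]; field_simp; ring

theorem g₃Two_eq : g₃Two q = 8 * q.b ^ 3 - 2 * q.σ * q.b := by
  rw [g₃Two, σ, S]; field_simp; ring

theorem σ₂_eq : σ₂ q = q.c ^ 2 * q.σ := by rw [σ₂, σ, S]; field_simp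

theorem σ₂_ne_zero_iff : σ₂ q ≠ 0 ↔ q.σ ≠ 0 := by
  rw [σ₂_eq hc, mul_ne_zero_iff, and_iff_right (pow_ne_zero 2 hc)]

theorem discTwo_eq : discTwo q = 4 * q.σ ^ 2 * (9 * q.b ^ 2 - 2 * q.σ) := by
  rw [discTwo, g₂Two_eq hc, g₃Two_eq hc]; ring

theorem constraintTwo_iff : ConstraintTwo q ↔ q.T = 0 ∧
    q.K / q.c ^ 2 = -(16 / 3) * (8 * q.b ^ 2 + 5 * q.S) * (11 * q.b ^ 2 - 10 * q.S) := by
  rw [ConstraintTwo, div_eq_iff (pow_ne_zero 2 hc), s₃_eq hc, s₂_eq hc]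
  refine and_congr ⟨fun h => ?_, fun h => by rw [h]; ring⟩ ⟨fun h => ?_, fun h => ?_⟩
  · exact (mul_eq_zero.1 (by linear_combination h : q.T * q.c ^ 3 = 0)).resolve_right
      (pow_ne_zero 3 hc)
  · refine mul_left_cancel₀ (pow_ne_zero 2 hc) ?_
    linear_combination h
  · linear_combination q.c ^ 2 * h

theorem isEllipticTwo_iff {u : ℂ → ℂ} : IsEllipticTwo q u ↔
    ConstraintTwo q ∧ discTwo q ≠ 0 ∧ IsTwo q.b q.σ (q.normalize u) := by
  rw [IsEllipticTwo]
  refine and_congr_right fun _ => and_congr_right fun hΔ => ?_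
  rw [discTwo_eq hc] at hΔ
  have hσ : q.σ ≠ 0 := fun h => hΔ (by rw [h]; ring)
  have h92 : 9 * q.b ^ 2 - 2 * q.σ ≠ 0 := fun h => hΔ (by rw [h]; ring)
  have hdiff : (11 * q.b ^ 2 * q.c ^ 2 + 10 * (q.s₁ ^ 2 - q.s₂)) / (3 * q.c ^ 2)
      = 9 * q.b ^ 2 - 2 * q.σ := by rw [σ, S]; field_simp; ring
  rw [hdiff, g₂Two_eq hc, g₃Two_eq hc]
  have hpt : ∀ {e₂ e₃ x v : ℂ}, e₂ + e₃ = q.b → 2 * e₂ * e₃ = q.σ - 4 * q.b ^ 2 →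
      (v = q.s₁ - q.c * (e₂ - e₃) * ((x + q.b) ^ 2 + (12 * q.b ^ 2 - 2 * q.σ) / 4 - 3 * q.b ^ 2)
        / (x ^ 2 - q.b * x - (12 * q.b ^ 2 - 2 * q.σ) / 4 + q.b ^ 2) ↔
      v = q.s₁ + q.c * (-(e₂ - e₃) * ((x + q.b) ^ 2 - q.σ / 2) / ((x - e₂) * (x - e₃)))) := by
    intro e₂ e₃ x v h1 h2
    rw [show x ^ 2 - q.b * x - (12 * q.b ^ 2 - 2 * q.σ) / 4 + q.b ^ 2 = (x - e₂) * (x - e₃) by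
      linear_combination x * h1 - h2 / 2]
    refine Eq.congr_right ?_
    ring
  constructor
  · rintro ⟨p, z₀, e₁, e₂, e₃, hp, rfl, h1, h2, h3, h4, hu⟩
    have h1' : e₂ + e₃ = q.b := by linear_combination h1
    have h23 : 2 * e₂ * e₃ = q.σ - 4 * q.b ^ 2 := by
      linear_combination -h4 / 2 + (e₂ + e₃ + q.b) / 2 * h1'
    refine (isTwo_iff_even hσ h1' h23 ?_).2 ⟨_, hp.isW.1.comp_sub z₀, ?_⟩
    · rintro rfl
      exact h92 (by rw [← h4]; ring)
    · refine (eventually_normalize_iff hc).2 ?_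
      filter_upwards [hu] with z hz
      exact (hpt h1' h23).1 hz
  · intro h
    -- δ is the difference e₂ - e₃. With e₂ + e₃ = b this gives e₂ and e₃ as (b ± δ)/2, distinct
    -- because the discriminant is nonzero.
    obtain ⟨δ, hδ⟩ := IsAlgClosed.exists_pow_nat_eq (9 * q.b ^ 2 - 2 * q.σ) two_pos
    have hδ0 : δ ≠ 0 := by
      rintro rfl
      exact h92 (by rw [← hδ]; ring)
    have h1 : (q.b + δ) / 2 + (q.b - δ) / 2 = q.b := by ring
    have h2 : 2 * ((q.b + δ) / 2) * ((q.b - δ) / 2) = q.σ - 4 * q.b ^ 2 := by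
      linear_combination -hδ / 2
    obtain ⟨w, hw, hy⟩ := (isTwo_iff_even hσ h1 h2
      fun h => hδ0 (by linear_combination h)).1 h
    obtain ⟨p, z₀, hp, hz⟩ := isW_iff.1 hw
    refine ⟨p, z₀, -q.b, (q.b + δ) / 2, (q.b - δ) / 2, hp, rfl, by ring, ?_, ?_, ?_, ?_⟩
    · linear_combination -hδ
    · linear_combination -q.b * hδ
    · linear_combination hδ
    · filter_upwards [(eventually_normalize_iff hc).1 hy, hz] with z e1 e2
      refine (hpt h1 h2).2 ?_
      rw [e1, e2]

theorem isOddTwo_iff {u : ℂ → ℂ} : IsOddTwo q u ↔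
    ConstraintTwo q ∧ IsTwo q.b q.σ (q.normalize u) := by
  rw [IsOddTwo]
  refine and_congr_right fun _ => ?_
  rw [g₂Two_eq hc, g₃Two_eq hc, σ₂_eq hc]
  have hd : ∀ {p : ℂ → ℂ} {e c₁ z₁ : ℂ}, IsW (12 * q.b ^ 2 - 2 * q.σ)
      (8 * q.b ^ 3 - 2 * q.σ * q.b) (fun z => p (z - z₁)) → ∀ᶠ z in codiscrete ℂ,
      q.s₁ - deriv (fun w => c₁ * q.c / (p (w - z₁) - e)) z = q.s₁
        + q.c * (c₁ * deriv (fun z => p (z - z₁)) z / (p (z - z₁) - e) ^ 2) := by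
    intro p e c₁ z₁ hp
    filter_upwards [eventually_codiscrete_analyticAt hp.mero, hp.eventually_ne e] with z ha hne
    have hD := sub_ne_zero.2 hne
    have h1 := ((ha.differentiableAt.hasDerivAt.sub_const e).fun_inv hD).const_mul (c₁ * q.c)
    have h2 : deriv (fun w => c₁ * q.c / (p (w - z₁) - e)) z
        = c₁ * q.c * (-deriv (fun z => p (z - z₁)) z / (p (z - z₁) - e) ^ 2) := by
      simpa only [div_eq_mul_inv] using h1.deriv
    rw [h2]
    ring
  constructor
  · rintro ⟨p, z₁, e, c₁, hp, hc₁, h1, h2, hu⟩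
    have hσ : q.σ = 2 * (e + q.b) ^ 2 :=
      mul_left_cancel₀ (pow_ne_zero 2 hc) (by linear_combination h2)
    have hw := hp.isW.1.comp_sub z₁
    obtain ⟨h3, h4⟩ := isTwo_of_odd hc₁ hσ h1 hw
    refine ⟨?_, _, h3, ?_⟩
    · rintro h0
      rw [h0] at hσ
      exact hc₁ (pow_eq_zero_iff two_ne_zero |>.1 (by rw [h1]; linear_combination -2 * (2 * e - q.b) * hσ))
    · refine EventuallyEq.trans ((eventually_normalize_iff hc).2 ?_) h4
      filter_upwards [hu, hd hw] with z e1 e2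
      rw [e1, e2]
  · intro h
    obtain ⟨τ, hτ⟩ := IsAlgClosed.exists_pow_nat_eq (q.σ / 2) two_pos
    have hτ0 : τ ≠ 0 := by
      rintro rfl
      exact h.1 (by linear_combination -2 * hτ)
    -- Both e = τ - b and e = -τ - b satisfy the condition on σ. At most one of them has 2e = b,
    -- which would make c₁ zero, since τ ≠ 0.
    obtain ⟨e, he, hne⟩ : ∃ e, q.σ = 2 * (e + q.b) ^ 2 ∧ 2 * e - q.b ≠ 0 := by
      by_cases h0 : 2 * (τ - q.b) - q.b = 0
      · refine ⟨-τ - q.b, by linear_combination -2 * hτ, fun h' => hτ0 ?_⟩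
        linear_combination (h0 - h') / 4
      · exact ⟨τ - q.b, by linear_combination -2 * hτ, h0⟩
    obtain ⟨c₁, h1⟩ := IsAlgClosed.exists_pow_nat_eq (4 * (e + q.b) ^ 2 * (2 * e - q.b)) two_pos
    have hc₁ : c₁ ≠ 0 := by
      rintro rfl
      rw [zero_pow two_ne_zero, eq_comm, mul_eq_zero, or_iff_left hne] at h1
      exact h.1 (by linear_combination he + h1 / 2)
    obtain ⟨w, hw, hy⟩ := h.exists_odd hc₁ he h1
    obtain ⟨p, z₁, hp, hz⟩ := isW_iff.1 hw
    refine ⟨p, z₁, e, c₁, hp, hc₁, h1, by rw [he]; ring, ?_⟩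
    filter_upwards [(eventually_normalize_iff hc).1 hy, hz, deriv_congr_codiscrete hz,
      hd (e := e) (c₁ := c₁) (hp.isW.1.comp_sub z₁)] with z e1 e2 e3 e4
    rw [e4, e1, e2, e3]

/-- For σ ≠ 0 the discriminant vanishes exactly when σ = 9b²/2; the invariants are then 3b² and -b³.
The solution is the odd form with p degenerate, d = b and e₀ = -5b/2. The other root e₀ = b/2 would
give c₁ = 0. -/
theorem isTrigoTwo_iff {u : ℂ → ℂ} : IsTrigoTwo q u ↔
    ConstraintTwo q ∧ discTwo q = 0 ∧ IsTwo q.b q.σ (q.normalize u) := by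
  have hform : ∀ {k c₁ : ℂ} (z₀ : ℂ), k ≠ 0 → k ^ 2 = 3 * q.b / 2 → q.b ≠ 0 →
      ∀ᶠ z in codiscrete ℂ,
      c₁ * deriv (fun z => degenerateP q.b k (z - z₀)) z
        / (degenerateP q.b k (z - z₀) - -(5 * q.b / 2)) ^ 2
      = -(4 * c₁ * k / (3 * q.b)
        * ((1 - Complex.tanh (k * (z - z₀)) ^ 2) * Complex.tanh (k * (z - z₀)))
        / (1 + Complex.tanh (k * (z - z₀)) ^ 2) ^ 2) := by
    intro k c₁ z₀ hk hk2 hb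
    have hw := isW_degenerateP hk hk2
    have h1 := eventually_add_right (eventually_sinh_ne_zero hk) (-z₀)
    have h2 := eventually_add_right (eventually_sinh_ne_zero hk)
      (-z₀ + Real.pi * Complex.I / 2 / k)
    filter_upwards [h1, h2, (hw.comp_sub z₀).eventually_ne (-(5 * q.b / 2))] with z h1 h2 h5
    have h3 : k * (z + (-z₀ + Real.pi * Complex.I / 2 / k))
        = k * (z - z₀) + Real.pi / 2 * Complex.I := by field_simp; ring
    rw [h3, Complex.sinh_add, Complex.cosh_mul_I, Complex.sinh_mul_I, Complex.cos_pi_div_two,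
      Complex.sin_pi_div_two, mul_zero, zero_add, one_mul, mul_ne_zero_iff] at h2
    rw [← sub_eq_add_neg] at h1
    have hd := (hasDerivAt_degenerateP (d := q.b) h1).comp_sub_const z z₀
    rw [hd.deriv]
    rw [degenerateP, Complex.tanh_eq_sinh_div_cosh]
    have h4 := sub_ne_zero.2 h5
    rw [degenerateP] at h4
    generalize Complex.sinh (k * (z - z₀)) = s at *
    generalize Complex.cosh (k * (z - z₀)) = C at *
    have hC := h2.1
    have h6 : C ^ 2 + s ^ 2 ≠ 0 := by
      intro h0
      apply h4
      field_simp
      linear_combination 3 * q.b * h0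
    have h7 : -q.b + 3 * q.b / 2 * (C / s) ^ 2 - -(5 * q.b / 2)
        = 3 * q.b / 2 * (C ^ 2 + s ^ 2) / s ^ 2 := by field_simp; ring
    have h8 : 1 + (s / C) ^ 2 = (C ^ 2 + s ^ 2) / C ^ 2 := by field_simp
    rw [h7, h8]
    field_simp
    ring
  rw [constraintTwo_iff hc, discTwo_eq hc]
  constructor
  · rintro ⟨hb, hK, hs2, hs3, k, c₁, z₀, hk, hc₁, hu⟩
    have hS : q.S = 11 / 10 * q.b ^ 2 := by rw [S, hs2]; field_simp; ring
    have hT : q.T = 0 := by rw [T, hs3, hs2]; ring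
    have hσ : q.σ = 9 / 2 * q.b ^ 2 := by rw [σ, hS]; ring
    have hk0 : k ≠ 0 := by
      rintro rfl
      exact hb (by linear_combination -2 / 3 * hk)
    have hc0 : c₁ ≠ 0 := by
      rintro rfl
      exact pow_ne_zero 3 hb (by linear_combination hc₁ / 54)
    have hw := (isW_degenerateP hk0 hk).comp_sub z₀
    have e2 : 3 * q.b ^ 2 = 12 * q.b ^ 2 - 2 * q.σ := by rw [hσ]; ring
    have e3 : -q.b ^ 3 = 8 * q.b ^ 3 - 2 * q.σ * q.b := by rw [hσ]; ring
    rw [e2, e3] at hw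
    obtain ⟨h3, h4⟩ := isTwo_of_odd (e := -(5 * q.b / 2)) hc0 (by rw [hσ]; ring)
      (by rw [hc₁]; ring) hw
    refine ⟨⟨hT, by rw [hK, hS]; ring⟩, by rw [hσ]; ring, ?_, _, h3, ?_⟩
    · rw [hσ]
      exact mul_ne_zero (by norm_num) (pow_ne_zero 2 hb)
    · refine EventuallyEq.trans ((eventually_normalize_iff hc).2 ?_) h4
      filter_upwards [hu, hform (c₁ := c₁) z₀ hk0 hk hb] with z f1 f2
      rw [f1, f2]
      ring
  · rintro ⟨⟨hT, hK⟩, hΔ, h⟩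
    have hσ : q.σ = 9 / 2 * q.b ^ 2 := by
      have := (mul_eq_zero.1 hΔ).resolve_left (mul_ne_zero (by norm_num) (pow_ne_zero 2 h.1))
      linear_combination -this / 2
    have hb : q.b ≠ 0 := fun h0 => h.1 (by rw [hσ, h0]; ring)
    have hS : q.S = 11 / 10 * q.b ^ 2 := by
      rw [σ] at hσ; linear_combination 3 / 5 * hσ
    obtain ⟨c₁, hc₁⟩ := IsAlgClosed.exists_pow_nat_eq (-54 * q.b ^ 3) two_pos
    obtain ⟨k, hk⟩ := IsAlgClosed.exists_pow_nat_eq (3 * q.b / 2) two_pos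
    have hk0 : k ≠ 0 := by
      rintro rfl
      exact hb (by linear_combination -2 / 3 * hk)
    have hc0 : c₁ ≠ 0 := by
      rintro rfl
      exact pow_ne_zero 3 hb (by linear_combination hc₁ / 54)
    obtain ⟨w, hw, hy⟩ := h.exists_odd (e := -(5 * q.b / 2)) hc0 (by rw [hσ]; ring)
      (by rw [hc₁]; ring)
    have e2 : 3 * q.b ^ 2 = 12 * q.b ^ 2 - 2 * q.σ := by rw [hσ]; ring
    have e3 : -q.b ^ 3 = 8 * q.b ^ 3 - 2 * q.σ * q.b := by rw [hσ]; ring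
    rw [← e2, ← e3] at hw
    obtain ⟨z₀, hz⟩ := (isW_degenerateP hk0 hk).eq_translate (lead_degenerateP hk0 hk) hw
    refine ⟨hb, ?_, ?_, ?_, k, c₁, z₀, hk, hc₁, ?_⟩
    · rw [hS, div_eq_iff (pow_ne_zero 2 hc)] at hK
      rw [hK]; ring
    · rw [s₂_eq hc, hS]; ring
    · rw [s₃_eq hc, hT, hS]; ring
    · filter_upwards [(eventually_normalize_iff hc).1 hy, hz, deriv_congr_codiscrete hz,
        hform (c₁ := c₁) z₀ hk0 hk hb] with z f1 f2 f3 f4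
      rw [f1, f2, f3, f4]
      ring

omit hc in
theorem equispaced (h : ConstraintTwo q) : Equispaced q := by
  obtain ⟨d, hd⟩ := IsAlgClosed.exists_pow_nat_eq (3 * (q.s₁ ^ 2 - q.s₂)) two_pos
  -- The first constraint says that s₁ is a root. The other two are s₁ ± d with d² = 3(s₁² - s₂).
  refine ⟨q.s₁, d, fun x => ?_⟩
  linear_combination -h.1 + (x - q.s₁) * hd

theorem satisfiesFirstOrder_F₄_iff {u : ℂ → ℂ} : SatisfiesFirstOrder (F₄ q) u ↔
    ∀ᶠ z in codiscrete ℂ, (deriv (q.normalize u) z ^ 2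
      + 12 * q.b * (q.normalize u z ^ 2 + 2 * q.σ)) ^ 2
        = 16 * (q.normalize u z ^ 2 + 2 * q.σ) ^ 3 := by
  refine eventually_congr (Eventually.of_forall fun z => ?_)
  simp only [F₄, evalEval, eval_add, eval_sub, eval_mul, eval_pow, eval_C, eval_X, eval_ofNat]
  rw [deriv_eq hc, eq_normalize hc u z, σ₂_eq hc, ← sub_eq_zero (b := 16 * _)]
  refine Iff.trans (Eq.congr_left ?_) ((mul_eq_zero (a := q.c ^ 6)).trans
    (or_iff_right (pow_ne_zero 6 hc)))
  ring

theorem isSolution_iff_families {u : ℂ → ℂ} :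
    (IsMeromorphicSolution q u ∧ ¬ IsConstant u) ↔
      (IsEllipticOne q u ∨ IsEllipticOne q.flip u) ∨
        ConstraintTwo q ∧ IsTwo q.b q.σ (q.normalize u) := by
  rw [isMeromorphicSolution_iff hc, ← isConstant_normalize_iff hc, isEllipticOne_flip_iff hc,
    isEllipticOne_iff hc, constraintOne_iff hc, constraintTwo_iff hc, g₂One_eq hc, g₃One_eq hc]
  constructor
  · rintro ⟨h1, h2⟩
    rcases h1.classification h2 with ⟨e1, e2⟩ | ⟨e1, e2⟩ | ⟨e1, e2, e3⟩
    · exact Or.inl (Or.inl ⟨e2, e1⟩)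
    · exact Or.inl (Or.inr ⟨e2, e1⟩)
    · exact Or.inr ⟨⟨e1, e2⟩, e3⟩
  · rintro ((⟨e2, e1⟩ | ⟨e2, e1⟩) | ⟨⟨e1, e2⟩, e3⟩)
    · refine ⟨?_, fun h => e1.nonconst ?_⟩
      · have := e1.isSol_add_const (k := q.K / q.c ^ 2) (b := q.b) (S := q.S) (T := q.T) rfl rfl e2
        simpa using this
      · obtain ⟨a, ha⟩ := h
        exact ⟨a - q.b, by filter_upwards [ha] with z hz; rw [hz]⟩
    · refine ⟨?_, fun h => e1.nonconst ?_⟩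
      · have := (e1.isSol_add_const (k := q.K / q.c ^ 2) (b := q.b) (S := q.S) (T := -q.T) rfl rfl
          (by rw [e2]; ring)).neg
        simpa using this
      · obtain ⟨a, ha⟩ := h
        exact ⟨-a - q.b, by filter_upwards [ha] with z hz; rw [hz]⟩
    · refine ⟨?_, e3.not_isConstant⟩
      rw [e1, e2]
      exact e3.isSol

end Coeffs

/-! ### Elliptic orders -/

section lattice

variable (L : PeriodPair) {z z₀ : ℂ}

theorem lead_shift (h : z - z₀ ∈ L.lattice) :
    Lead (fun w => L.weierstrassP (w - z₀)) z (-2) 1 := by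
  have : Lead (fun w => L.weierstrassP (w + -z₀)) z (-2) 1 :=
    Lead.comp_add ((lead_weierstrassP_iff L _).2 h)
  simpa only [sub_eq_add_neg] using this

theorem exists_lead_shift (h : z - z₀ ∉ L.lattice) :
    ∃ a, Lead (fun w => L.weierstrassP (w - z₀)) z 0 a := by
  have h1 : AnalyticAt ℂ L.weierstrassP (z + -z₀) := by
    rw [← sub_eq_add_neg]
    exact L.analyticOnNhd_weierstrassP _ h
  have h2 : Lead (fun w => L.weierstrassP (w + -z₀)) z 0 _ := Lead.comp_add (.of_analyticAt h1)
  exact ⟨_, by simpa only [sub_eq_add_neg] using h2⟩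

/-- The multiplicity of `z` as a pole of `f`. -/
def poleOrder (f : ℂ → ℂ) (z : ℂ) : ℕ := (-(meromorphicOrderAt f z).untop₀).toNat

theorem Lead.poleOrder_eq {f : ℂ → ℂ} {a : ℂ} (h : Lead f z (-2) a) (ha : a ≠ 0) :
    poleOrder f z = 2 := by
  rw [poleOrder, h.order_eq ha]
  rfl

theorem Lead.poleOrder_eq_zero {f : ℂ → ℂ} {a : ℂ} (h : Lead f z 0 a) : poleOrder f z = 0 := by
  have h1 := h.order_nonneg
  rw [poleOrder, Int.toNat_eq_zero, neg_nonpos]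
  cases hx : meromorphicOrderAt f z with
  | top => simp
  | coe n => rw [hx] at h1; exact WithTop.coe_le_coe.1 h1

/-- Each coset of the lattice meets the fundamental parallelogram in exactly one point, so a class
of double poles contributes 2 to the elliptic order. -/
theorem mem_fundamentalDomain_iff (h : z ∈ ZSpan.fundamentalDomain L.basis) :
    z - z₀ ∈ L.lattice ↔ z = ZSpan.fract L.basis z₀ := by
  have h1 := ZSpan.fract_eq_self.2 h
  rw [L.lattice_eq_span_range_basis, ← neg_mem_iff, neg_sub, ← neg_add_eq_sub,
    ← ZSpan.fract_eq_fract, h1]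

open Classical in
theorem finsum_fundamentalDomain (z₀ : ℂ) :
    (∑ᶠ z ∈ ZSpan.fundamentalDomain L.basis, if z - z₀ ∈ L.lattice then 2 else 0) = 2 ∧
    (ZSpan.fundamentalDomain L.basis ∩
      Function.support fun z => if z - z₀ ∈ L.lattice then 2 else 0).Finite := by
  have h1 : ZSpan.fundamentalDomain L.basis ∩
      (Function.support fun z => if z - z₀ ∈ L.lattice then 2 else 0)
        = {ZSpan.fract L.basis z₀} := by
    ext z
    simp only [Set.mem_inter_iff, Function.mem_support, Set.mem_singleton_iff]
    constructor
    · rintro ⟨h2, h3⟩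
      refine (mem_fundamentalDomain_iff L h2).1 ?_
      by_contra h4
      exact h3 (if_neg h4)
    · rintro rfl
      have h2 := ZSpan.fract_mem_fundamentalDomain L.basis z₀
      refine ⟨h2, ?_⟩
      rw [if_pos ((mem_fundamentalDomain_iff L h2).2 rfl)]
      exact two_ne_zero
  refine ⟨?_, by rw [h1]; exact Set.finite_singleton _⟩
  rw [← finsum_mem_inter_support, h1, finsum_mem_singleton, if_pos]
  exact (mem_fundamentalDomain_iff L (ZSpan.fract_mem_fundamentalDomain L.basis z₀)).2 rfl

theorem isEllipticOfOrder_two {u : ℂ → ℂ} {s c : ℂ} (hc : c ≠ 0)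
    (hu : u =ᶠ[codiscrete ℂ] fun z => s + c * L.weierstrassP (z - z₀)) :
    IsEllipticOfOrder u 2 := by
  have hm : Meromorphic u := by
    refine Meromorphic.congr_codiscrete (f := fun z => s + c * L.weierstrassP (z - z₀)) ?_ hu.symm
    exact (Meromorphic.const s).fun_add ((Meromorphic.const c).fun_mul
      ((isW_weierstrassP L).comp_sub z₀).mero)
  have hpole : ∀ z, z - z₀ ∈ L.lattice → Lead u z (-2) c := fun z hz =>
    ((((Lead.const s z).weaken (by norm_num)).add ((lead_shift L hz).const_mul c)).cast rfl
      (by ring)).congr ((eventually_nhdsNE_of_codiscrete hu z).mono fun _ e => e.symm)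
  have hreg : ∀ z, z - z₀ ∉ L.lattice → ∃ a, Lead u z 0 a := fun z hz => by
    obtain ⟨a, ha⟩ := exists_lead_shift L hz
    exact ⟨_, ((Lead.const s z).add (ha.const_mul c)).congr
      ((eventually_nhdsNE_of_codiscrete hu z).mono fun _ e => e.symm)⟩
  refine ⟨hm, L, fun ω => ⟨fun h => ?_, fun h => ?_⟩, ?_⟩
  · by_contra hω
    obtain ⟨a, ha⟩ := hreg (z₀ + ω) (by rwa [add_sub_cancel_left])
    have h1 : Lead (fun z => u (z + ω)) z₀ 0 a := Lead.comp_add ha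
    have h2 := h1.congr (eventually_nhdsNE_of_codiscrete h z₀)
    exact hc ((hpole z₀ (by rw [sub_self]; exact zero_mem _)).unique (h2.weaken (by norm_num)))
  · filter_upwards [hu, eventually_add_right hu ω] with z h1 h2
    rw [h1, h2, add_sub_right_comm, L.weierstrassP_add_coe _ ⟨ω, h⟩]
  · classical
    refine Eq.trans (finsum_mem_congr rfl fun z _ => ?_) (finsum_fundamentalDomain L z₀).1
    by_cases h : z - z₀ ∈ L.lattice
    · rw [if_pos h]; exact (hpole z h).poleOrder_eq hc
    · rw [if_neg h]
      obtain ⟨a, ha⟩ := hreg z h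
      exact ha.poleOrder_eq_zero

theorem isEllipticOfOrder_four {u : ℂ → ℂ} {s c z₁ z₂ : ℂ} (hc : c ≠ 0) (h12 : z₁ - z₂ ∉ L.lattice)
    (hu : u =ᶠ[codiscrete ℂ] fun z =>
      s + c * (L.weierstrassP (z - z₁) - L.weierstrassP (z - z₂))) :
    IsEllipticOfOrder u 4 := by
  have hm : Meromorphic u := by
    refine Meromorphic.congr_codiscrete (f := fun z =>
      s + c * (L.weierstrassP (z - z₁) - L.weierstrassP (z - z₂))) ?_ hu.symm
    exact (Meromorphic.const s).fun_add ((Meromorphic.const c).fun_mul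
      (((isW_weierstrassP L).comp_sub z₁).mero.fun_sub ((isW_weierstrassP L).comp_sub z₂).mero))
  have hu' : ∀ z, ∀ᶠ w in 𝓝[≠] z,
      s + c * (L.weierstrassP (w - z₁) - L.weierstrassP (w - z₂)) = u w := fun z =>
    (eventually_nhdsNE_of_codiscrete hu z).mono fun _ e => e.symm
  have hex : ∀ z, z - z₁ ∈ L.lattice → z - z₂ ∉ L.lattice := fun z h1 h2 =>
    h12 (by simpa using sub_mem h2 h1)
  have hpole₁ : ∀ z, z - z₁ ∈ L.lattice → Lead u z (-2) c := fun z hz => by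
    obtain ⟨a, ha⟩ := exists_lead_shift L (hex z hz)
    exact ((((Lead.const s z).weaken (by norm_num)).add (((lead_shift L hz).sub
      (ha.weaken (by norm_num))).const_mul c)).cast rfl (by ring)).congr (hu' z)
  have hpole₂ : ∀ z, z - z₂ ∈ L.lattice → Lead u z (-2) (-c) := fun z hz => by
    obtain ⟨a, ha⟩ := exists_lead_shift L fun h => hex z h hz
    exact ((((Lead.const s z).weaken (by norm_num)).add (((ha.weaken (by norm_num)).sub
      (lead_shift L hz)).const_mul c)).cast rfl (by ring)).congr (hu' z)
  have hreg : ∀ z, z - z₁ ∉ L.lattice → z - z₂ ∉ L.lattice → ∃ a, Lead u z 0 a := fun z h1 h2 => by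
    obtain ⟨a, ha⟩ := exists_lead_shift L h1
    obtain ⟨b, hb⟩ := exists_lead_shift L h2
    exact ⟨_, ((Lead.const s z).add ((ha.sub hb).const_mul c)).congr (hu' z)⟩
  refine ⟨hm, L, fun ω => ⟨fun h => ?_, fun h => ?_⟩, ?_⟩
  · by_contra hω
    -- A period carries the pole `z₁` to a pole with the same leading coefficient c. The poles
    -- congruent to `z₂` have coefficient -c, so the period lies in the lattice.
    have h0 := hpole₁ z₁ (by rw [sub_self]; exact zero_mem _)
    have htrans : ∀ {n : ℤ} {a : ℂ}, Lead u (z₁ + ω) n a → Lead u z₁ n a := fun ha =>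
      (Lead.comp_add ha).congr (eventually_nhdsNE_of_codiscrete h z₁)
    by_cases h2 : z₁ + ω - z₂ ∈ L.lattice
    · have h3 := h0.unique (htrans (hpole₂ _ h2))
      exact hc (by linear_combination h3 / 2)
    · obtain ⟨a, ha⟩ := hreg (z₁ + ω) (by rwa [add_sub_cancel_left]) h2
      exact hc (h0.unique ((htrans ha).weaken (by norm_num)))
  · filter_upwards [hu, eventually_add_right hu ω] with z h1 h2
    rw [h1, h2, add_sub_right_comm, add_sub_right_comm, L.weierstrassP_add_coe _ ⟨ω, h⟩,
      L.weierstrassP_add_coe _ ⟨ω, h⟩]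
  · classical
    obtain ⟨e1, f1⟩ := finsum_fundamentalDomain L z₁
    obtain ⟨e2, f2⟩ := finsum_fundamentalDomain L z₂
    have hsum := finsum_mem_add_distrib' f1 f2
    rw [e1, e2] at hsum
    refine Eq.trans (finsum_mem_congr rfl fun z _ => ?_) hsum
    by_cases h1 : z - z₁ ∈ L.lattice
    · rw [if_pos h1, if_neg (hex z h1)]
      exact (hpole₁ z h1).poleOrder_eq hc
    · by_cases h2 : z - z₂ ∈ L.lattice
      · rw [if_neg h1, if_pos h2]
        exact (hpole₂ z h2).poleOrder_eq (neg_ne_zero.2 hc)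
      · rw [if_neg h1, if_neg h2]
        obtain ⟨a, ha⟩ := hreg z h1 h2
        exact ha.poleOrder_eq_zero

end lattice

namespace Coeffs

variable {q : Coeffs} (hc : q.c ≠ 0)
include hc

theorem isEllipticOfOrder_of_isEllipticOne {u : ℂ → ℂ} (h : IsEllipticOne q u)
    (hΔ : discOne q ≠ 0) : IsEllipticOfOrder u 2 := by
  obtain ⟨-, p, z₀, hp, hu⟩ := h
  obtain ⟨L, -, -, rfl⟩ := hp.exists_periodPair hΔ
  exact isEllipticOfOrder_two L hc hu

/-- The term σ/2/(w + b) is b plus the translate of w by the half period with value -b. Thus y is a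
difference of two translates of ℘, with two distinct classes of double poles because y is not
constant. -/
theorem isEllipticOfOrder_of_isEllipticTwo {u : ℂ → ℂ} (h : IsEllipticTwo q u) :
    IsEllipticOfOrder u 4 := by
  obtain ⟨-, hΔ, hy⟩ := (isEllipticTwo_iff hc).1 h
  have hnc := hy.not_isConstant
  obtain ⟨hσ, w, hw, hyw⟩ := hy
  have hw₂ : IsW (12 * q.b ^ 2 - 2 * q.σ) (8 * q.b ^ 3 - 2 * q.σ * q.b)
      fun z => -q.b + q.σ / 2 / (w z - -q.b) :=
    hw.half_period (by ring) (by ring) (div_ne_zero hσ two_ne_zero)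
  obtain ⟨p, hp⟩ := exists_isWeierstrassP (12 * q.b ^ 2 - 2 * q.σ) (8 * q.b ^ 3 - 2 * q.σ * q.b)
  obtain ⟨z₁, h1⟩ := hp.isW.1.eq_translate hp.isW.2 hw
  obtain ⟨z₂, h2⟩ := hp.isW.1.eq_translate hp.isW.2 hw₂
  rw [discTwo, g₂Two_eq hc, g₃Two_eq hc] at hΔ
  obtain ⟨L, -, -, rfl⟩ := hp.exists_periodPair hΔ
  have hyL : q.normalize u =ᶠ[codiscrete ℂ] fun z =>
      L.weierstrassP (z - z₁) - L.weierstrassP (z - z₂) := by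
    filter_upwards [hyw, h1, h2] with z f1 f2 f3
    rw [f1, ← f2, ← f3]
    ring
  refine isEllipticOfOrder_four L hc (fun h12 => hnc ⟨0, ?_⟩) ((eventually_normalize_iff hc).1 hyL)
  filter_upwards [hyL] with z hz
  have : z - z₂ = z - z₁ + (⟨z₁ - z₂, h12⟩ : L.lattice) := by simp
  rw [hz, this, L.weierstrassP_add_coe, sub_self]

end Coeffs

/-! ### Irreducibility of the quartic subequation -/

/-- The quadratic has two distinct roots, so its cube has roots of odd multiplicity 3. -/
theorem sq_ne_const_mul_cube {s τ κ : ℂ} (hτ : τ ≠ 0) (hκ : κ ≠ 0) (f : ℂ[X]) :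
    f ^ 2 ≠ C κ * ((X - C s) ^ 2 + C τ) ^ 3 := by
  intro h
  obtain ⟨t, ht⟩ := IsAlgClosed.exists_pow_nat_eq (-τ) two_pos
  have ht0 : t ≠ 0 := by
    rintro rfl
    exact hτ (by linear_combination ht)
  have hq : (X - C s) ^ 2 + C τ = (X - C (s + t)) * (X - C (s - t)) := by
    have : (C τ : ℂ[X]) = -(C t) ^ 2 := by rw [← C_pow, ht, C_neg, neg_neg]
    rw [this, C_add, C_sub]; ring
  rw [hq] at h
  have hX : (X - C (s + t) : ℂ[X]) ≠ 0 := X_sub_C_ne_zero _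
  have h1 : IsRoot f (s + t) := by
    have := congrArg (eval (s + t)) h
    simpa using this
  obtain ⟨g, rfl⟩ := dvd_iff_isRoot.2 h1
  have h2 : g ^ 2 = C κ * ((X - C (s + t)) * (X - C (s - t)) ^ 3) :=
    mul_left_cancel₀ (pow_ne_zero 2 hX) (by linear_combination h)
  have h3 : IsRoot g (s + t) := by
    have := congrArg (eval (s + t)) h2
    simpa using this
  obtain ⟨k, rfl⟩ := dvd_iff_isRoot.2 h3
  have h4 : (X - C (s + t)) * k ^ 2 = C κ * (X - C (s - t)) ^ 3 :=
    mul_left_cancel₀ hX (by linear_combination h2)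
  have h5 := congrArg (eval (s + t)) h4
  simp only [eval_mul, eval_sub, eval_X, eval_C, sub_self, zero_mul, eval_pow,
    add_sub_sub_cancel] at h5
  refine mul_ne_zero hκ (pow_ne_zero 3 ?_) h5.symm
  rw [← two_mul]
  exact mul_ne_zero two_ne_zero ht0

theorem cubic_coeffs {R : Type*} [CommRing R] {a b c d : R}
    (h : (C a * X ^ 3 + C b * X ^ 2 + C c * X + C d : R[X]) = 0) :
    a = 0 ∧ b = 0 ∧ c = 0 ∧ d = 0 := by
  have h1 : (⟨a, b, c, d⟩ : Cubic R) = 0 :=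
    (Cubic.toPoly_injective _ _).1 (by rw [Cubic.zero]; exact h)
  exact ⟨congrArg Cubic.a h1, congrArg Cubic.b h1, congrArg Cubic.c h1, congrArg Cubic.d h1⟩

theorem Monic.eq_linear {R : Type*} [CommRing R] {f : R[X]} (hf : f.Monic) (h : f.natDegree = 1) :
    f = X + C (f.coeff 0) := by
  conv_lhs => rw [hf.as_sum, h]
  simp

theorem Monic.eq_quadratic {R : Type*} [CommRing R] {f : R[X]} (hf : f.Monic)
    (h : f.natDegree = 2) : f = X ^ 2 + C (f.coeff 1) * X + C (f.coeff 0) := by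
  conv_lhs => rw [hf.as_sum, h]
  simp only [Finset.sum_range_succ, Finset.sum_range_zero]
  ring

/-- The biquadratic polynomial `(Y² + A)² - B`. -/
theorem irreducible_biquadratic {s τ β κ : ℂ} (hτ : τ ≠ 0) (hκ : κ ≠ 0) :
    Irreducible ((X ^ 2 + C (C β * ((X - C s) ^ 2 + C τ))) ^ 2
      - C (C κ * ((X - C s) ^ 2 + C τ) ^ 3) : ℂ[X][X]) := by
  obtain ⟨Q, hQ⟩ : ∃ Q : ℂ[X], Q = (X - C s) ^ 2 + C τ := ⟨_, rfl⟩
  have hQdeg : Q.natDegree = 2 := by rw [hQ]; compute_degree!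
  have hQ0 : Q ≠ 0 := fun h => by rw [h] at hQdeg; simp at hQdeg
  have hsq : ∀ {κ' : ℂ} (f : ℂ[X]), κ' ≠ 0 → f ^ 2 ≠ C κ' * Q ^ 3 := fun f h => by
    rw [hQ]; exact sq_ne_const_mul_cube hτ h f
  rw [← hQ]
  have hexp : (X ^ 2 + C (C β * Q)) ^ 2 - C (C κ * Q ^ 3)
      = X ^ 4 + C (2 * (C β * Q)) * X ^ 2 + C (C β ^ 2 * Q ^ 2 - C κ * Q ^ 3) := by
    simp only [map_mul, map_sub, map_pow, map_ofNat]; ring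
  have hdeg : ((X ^ 2 + C (C β * Q)) ^ 2 - C (C κ * Q ^ 3) : ℂ[X][X]).natDegree = 4 := by
    rw [hexp]; compute_degree!
  have hmonic : ((X ^ 2 + C (C β * Q)) ^ 2 - C (C κ * Q ^ 3) : ℂ[X][X]).Monic := by
    rw [hexp]; monicity!
  have hne1 : ((X ^ 2 + C (C β * Q)) ^ 2 - C (C κ * Q ^ 3) : ℂ[X][X]) ≠ 1 := fun h => by
    rw [h] at hdeg; simp at hdeg
  rw [hmonic.irreducible_iff_lt_natDegree_lt hne1, hdeg]
  rintro g hg hgd ⟨h, hgh⟩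
  rw [Finset.mem_Ioc] at hgd
  have hh : h.Monic := hg.of_mul_monic_left (hgh ▸ hmonic)
  have hdeg2 : g.natDegree + h.natDegree = 4 := by
    rw [← hg.natDegree_mul hh, ← hgh, hdeg]
  -- A linear factor has a root f with (f² + βQ)² = κQ³, contradicting `hsq`.
  rcases (by omega : g.natDegree = 1 ∨ g.natDegree = 2) with h1 | h2
  · have hg1 := Monic.eq_linear hg h1
    have := congrArg (eval (-g.coeff 0)) hgh
    rw [hg1] at this
    simp only [eval_mul, eval_sub, eval_add, eval_pow, eval_X, eval_C, coeff_add, coeff_X_zero,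
      coeff_C_zero, zero_add, neg_add_cancel, zero_mul] at this
    exact hsq _ hκ (sub_eq_zero.1 this)
  · have hg2 := Monic.eq_quadratic hg h2
    have hh2 := Monic.eq_quadratic hh (by omega)
    generalize g.coeff 1 = a at *
    generalize g.coeff 0 = e at *
    generalize h.coeff 1 = a' at *
    generalize h.coeff 0 = e' at *
    rw [hexp, hg2, hh2] at hgh
    obtain ⟨c3, c2, c1, c0⟩ := cubic_coeffs (a := -(a + a')) (b := 2 * (C β * Q) - (e + e' + a * a'))
      (c := -(a * e' + a' * e)) (d := C β ^ 2 * Q ^ 2 - C κ * Q ^ 3 - e * e') (by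
        simp only [map_neg, map_add, map_mul, map_sub, map_pow, map_ofNat] at hgh ⊢
        linear_combination hgh)
    obtain rfl : a' = -a := by linear_combination -c3
    have h3 : a * (e - e') = 0 := by linear_combination c1
    -- For factors X² + aX + e and X² - aX + e': if a = 0, then (e - e')² = 4κQ³. If e = e', the
    -- relation for e² forces e to have degree 3, and a² = 2e - 2βQ has odd degree.
    rcases mul_eq_zero.1 h3 with rfl | h4
    · refine hsq (κ' := 4 * κ) (e - e') (mul_ne_zero (by norm_num) hκ) ?_
      rw [map_mul, map_ofNat]
      linear_combination 4 * c0 - (e + e' + 2 * (C β * Q)) * c2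
    · obtain rfl : e = e' := sub_eq_zero.1 h4
      have h5 : a ^ 2 = 2 * e - 2 * (C β * Q) := by linear_combination c2
      have h6 : e ^ 2 = Q ^ 2 * (C β ^ 2 - C κ * Q) := by linear_combination -c0
      have h7 : (C β ^ 2 - C κ * Q).natDegree = 2 := by
        have e1 : (C κ * Q).natDegree = 2 := by rw [natDegree_C_mul hκ, hQdeg]
        rw [natDegree_sub_eq_right_of_natDegree_lt, e1]
        rw [e1, ← C_pow, natDegree_C]
        exact two_pos
      have h8 : e.natDegree = 3 := by
        have := congrArg natDegree h6
        rw [natDegree_pow, natDegree_mul (pow_ne_zero 2 hQ0)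
          (fun h => by rw [h] at h7; simp at h7), natDegree_pow, hQdeg, h7] at this
        omega
      have h9 : (2 * e - 2 * (C β * Q)).natDegree = 3 := by
        have e1 : (2 * e).natDegree = 3 := by
          rw [← h8, ← map_ofNat C 2]
          exact natDegree_C_mul two_ne_zero
        rw [natDegree_sub_eq_left_of_natDegree_lt, e1]
        rw [e1]
        have e2 : (2 * (C β * Q)).natDegree ≤ 2 := by
          rw [← map_ofNat C 2, ← mul_assoc, ← C_mul]
          exact (natDegree_C_mul_le _ _).trans hQdeg.le
        omega
      have := congrArg natDegree h5
      rw [natDegree_pow, h9] at this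
      omega

theorem F₄_eq {q : Coeffs} (hc : q.c ≠ 0) : F₄ q = C (C (q.c ^ 2))
    * ((X ^ 2 + C (C (12 * q.b) * ((X - C q.s₁) ^ 2 + C (2 * σ₂ q)))) ^ 2
      - C (C (16 / q.c ^ 2) * ((X - C q.s₁) ^ 2 + C (2 * σ₂ q)) ^ 3)) := by
  have h : (16 : ℂ[X][X]) = C (C (q.c ^ 2)) * C (C (16 / q.c ^ 2)) := by
    rw [← C_mul, ← C_mul, mul_div_cancel₀ _ (pow_ne_zero 2 hc)]
    simp only [map_ofNat]
  rw [F₄, h]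
  simp only [map_mul, map_pow]
  ring

theorem isUnit_C_C {a : ℂ} (ha : a ≠ 0) : IsUnit (C (C a) : ℂ[X][X]) :=
  (ha.isUnit.map C).map C

theorem irreducible_F₄ {q : Coeffs} (hc : q.c ≠ 0) (hσ : σ₂ q ≠ 0) : Irreducible (F₄ q) := by
  rw [F₄_eq hc, irreducible_isUnit_mul (isUnit_C_C (pow_ne_zero 2 hc))]
  exact irreducible_biquadratic (mul_ne_zero two_ne_zero hσ)
    (div_ne_zero (by norm_num) (pow_ne_zero 2 hc))

theorem finite_adjoinRoot_F₄ {q : Coeffs} (hc : q.c ≠ 0) :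
    Module.Finite ℂ[X] (AdjoinRoot (F₄ q)) := by
  obtain ⟨P, hP, hF⟩ : ∃ P : ℂ[X][X], P.Monic ∧ F₄ q = C (C (q.c ^ 2)) * P :=
    ⟨_, by
      simp only [map_mul, map_pow, map_add, map_sub]
      monicity!, F₄_eq hc⟩
  have := hP.finite_adjoinRoot
  have hspan : Ideal.span {F₄ q} = Ideal.span {P} := by
    rw [hF]
    exact Ideal.span_singleton_mul_left_unit (isUnit_C_C (pow_ne_zero 2 hc)) P
  change Module.Finite ℂ[X] (ℂ[X][X] ⧸ Ideal.span {F₄ q})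
  rw [hspan]
  exact this

/-! ### The genus of the quartic subequation -/

theorem exists_algebraMap_eq_of_isAlgebraic {K : Type*} [Field K] [Algebra ℂ K] {x : K}
    (hx : IsAlgebraic ℂ x) : ∃ a : ℂ, algebraMap ℂ K a = x :=
  minpoly.mem_range_of_degree_eq_one ℂ x
    (IsAlgClosed.degree_eq_one_of_irreducible ℂ (minpoly.irreducible hx.isIntegral))

/-- A nonzero ideal in a domain that is integral over ℂ[X] meets ℂ[X] nontrivially. So a kernel is
excluded as soon as the image of X is transcendental. -/
theorem injective_of_transcendental {F : ℂ[X][X]} {K : Type*} [Field K] [Algebra ℂ K]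
    (hF : IsDomain (AdjoinRoot F)) (hfin : Module.Finite ℂ[X] (AdjoinRoot F))
    (φ : AdjoinRoot F →ₐ[ℂ] K)
    (hx : Transcendental ℂ (φ (algebraMap ℂ[X] (AdjoinRoot F) X))) : Function.Injective φ := by
  have h1 : RingHom.ker φ.toRingHom = ⊥ := by
    refine Ideal.eq_bot_of_comap_eq_bot (R := ℂ[X]) ?_
    rw [eq_bot_iff]
    intro P hP
    rw [Ideal.mem_comap, RingHom.mem_ker] at hP
    have h2 : aeval (φ (algebraMap ℂ[X] (AdjoinRoot F) X)) P = 0 := by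
      have h3 : φ.comp (IsScalarTower.toAlgHom ℂ ℂ[X] (AdjoinRoot F))
          = aeval (φ (algebraMap ℂ[X] (AdjoinRoot F) X)) := by
        refine algHom_ext ?_
        simp
      rw [← h3]
      exact hP
    by_contra hne
    exact hx ⟨P, hne, h2⟩
  exact (RingHom.injective_iff_ker_eq_bot φ.toRingHom).2 h1

/-- The nonsingular cubic `t² = v³ - 3 b v² + (σ / 2) v`. -/
def cubicCurve (b σ : ℂ) : WeierstrassCurve.Affine ℂ := ⟨0, -3 * b, 0, σ / 2, 0⟩

section cubicCurve

variable (b σ : ℂ)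

theorem isElliptic_cubicCurve (h : σ ^ 2 * (9 * b ^ 2 - 2 * σ) ≠ 0) :
    (cubicCurve b σ).IsElliptic := by
  rw [WeierstrassCurve.isElliptic_iff, isUnit_iff_ne_zero]
  have : (cubicCurve b σ).Δ = 4 * (σ ^ 2 * (9 * b ^ 2 - 2 * σ)) := by
    simp only [WeierstrassCurve.Δ, WeierstrassCurve.b₂, WeierstrassCurve.b₄, WeierstrassCurve.b₆,
      WeierstrassCurve.b₈, cubicCurve]
    ring
  rw [this]
  exact mul_ne_zero (by norm_num) h

/-- The first coordinate function of the cubic. -/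
def coordV : (cubicCurve b σ).FunctionField :=
  algebraMap (cubicCurve b σ).CoordinateRing _
    (algebraMap ℂ[X] (cubicCurve b σ).CoordinateRing X)

/-- The second coordinate function of the cubic. -/
def coordT : (cubicCurve b σ).FunctionField :=
  algebraMap (cubicCurve b σ).CoordinateRing _
    (WeierstrassCurve.Affine.CoordinateRing.mk (cubicCurve b σ) X)

theorem aeval_coordV (P : ℂ[X]) : aeval (coordV b σ) P =
    algebraMap (cubicCurve b σ).CoordinateRing (cubicCurve b σ).FunctionField
      (algebraMap ℂ[X] (cubicCurve b σ).CoordinateRing P) := by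
  have h : aeval (coordV b σ) = (IsScalarTower.toAlgHom ℂ (cubicCurve b σ).CoordinateRing
      (cubicCurve b σ).FunctionField).comp
      (IsScalarTower.toAlgHom ℂ ℂ[X] (cubicCurve b σ).CoordinateRing) := by
    refine algHom_ext ?_
    simp [coordV]
  rw [h]
  rfl

theorem transcendental_coordV : Transcendental ℂ (coordV b σ) := by
  rw [transcendental_iff]
  intro P hP
  rw [aeval_coordV] at hP
  have h1 := (IsFractionRing.injective (cubicCurve b σ).CoordinateRing
    (cubicCurve b σ).FunctionField) (hP.trans (map_zero _).symm)
  exact FaithfulSMul.algebraMap_injective ℂ[X] (cubicCurve b σ).CoordinateRing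
    (h1.trans (map_zero _).symm)

theorem coordT_sq : coordT b σ ^ 2 = coordV b σ ^ 3
    - 3 * algebraMap ℂ _ b * coordV b σ ^ 2 + algebraMap ℂ _ (σ / 2) * coordV b σ := by
  have h1 : WeierstrassCurve.Affine.CoordinateRing.mk (cubicCurve b σ)
      (cubicCurve b σ).polynomial = 0 := AdjoinRoot.mk_self
  have h2 : (cubicCurve b σ).polynomial
      = X ^ 2 - C (X ^ 3 - 3 * C b * X ^ 2 + C (σ / 2) * X) := by
    have h3 : (C (-3 * b) : ℂ[X]) = -3 * C b := by rw [C_mul, C_neg, map_ofNat]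
    simp only [WeierstrassCurve.Affine.polynomial, cubicCurve, h3, C_0, zero_mul,
      add_zero]
    congr 3
    ring
  replace h1 := (congrArg (WeierstrassCurve.Affine.CoordinateRing.mk (cubicCurve b σ))
    h2).symm.trans h1
  rw [map_sub, map_pow] at h1
  have h3 : WeierstrassCurve.Affine.CoordinateRing.mk (cubicCurve b σ)
      (C (X ^ 3 - 3 * C b * X ^ 2 + C (σ / 2) * X)) =
      algebraMap ℂ[X] (cubicCurve b σ).CoordinateRing (X ^ 3 - 3 * C b * X ^ 2 + C (σ / 2) * X) :=
    rfl
  rw [h3] at h1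
  have h4 := congrArg (algebraMap (cubicCurve b σ).CoordinateRing
    (cubicCurve b σ).FunctionField) h1
  rw [map_sub, map_pow, map_zero, ← aeval_coordV] at h4
  simp only [map_add, map_sub, map_mul, map_pow, aeval_X, aeval_C, map_ofNat] at h4
  rw [coordT]
  linear_combination h4

theorem eq_top_of_coord_mem (M : IntermediateField ℂ (cubicCurve b σ).FunctionField)
    (hv : coordV b σ ∈ M) (ht : coordT b σ ∈ M) : M = ⊤ := by
  rw [eq_top_iff]
  have hmem : ∀ x : (cubicCurve b σ).CoordinateRing,
      algebraMap _ (cubicCurve b σ).FunctionField x ∈ M := by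
    intro x
    obtain ⟨P, Q, rfl⟩ := WeierstrassCurve.Affine.CoordinateRing.exists_smul_basis_eq x
    have hP : ∀ R : ℂ[X], algebraMap (cubicCurve b σ).CoordinateRing (cubicCurve b σ).FunctionField
        (algebraMap ℂ[X] (cubicCurve b σ).CoordinateRing R) ∈ M := fun R => by
      rw [← aeval_coordV]
      rw [aeval_eq_sum_range]
      exact sum_mem fun i _ => M.smul_mem (pow_mem hv i)
    rw [map_add, Algebra.smul_def, Algebra.smul_def, mul_one, map_mul]
    exact M.add_mem (hP P) (M.mul_mem (hP Q) ht)
  intro z _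
  obtain ⟨x, y, -, rfl⟩ := IsFractionRing.div_surjective (cubicCurve b σ).CoordinateRing z
  exact M.div_mem (hmem x) (hmem y)

end cubicCurve

/-- The relations between v, m, y and y' are carried out in the function field of the cubic, with 2t
in the role of v'. They give an embedding of the function field of the quartic, and it is onto
because v and t are rational in y and y'. -/
theorem hasGenusOne_F₄ {q : Coeffs} (hc : q.c ≠ 0) (hΔ : discTwo q ≠ 0) : HasGenusOne (F₄ q) := by
  rw [Coeffs.discTwo_eq hc] at hΔ
  have hσ : q.σ ≠ 0 := fun h => hΔ (by rw [h]; ring)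
  have hirr := irreducible_F₄ hc ((Coeffs.σ₂_ne_zero_iff hc).2 hσ)
  have hdom : IsDomain (AdjoinRoot (F₄ q)) := AdjoinRoot.isDomain_of_prime hirr.prime
  refine ⟨cubicCurve q.b q.σ, isElliptic_cubicCurve _ _ fun h => hΔ (by linear_combination 4 * h), ?_⟩
  set E := (cubicCurve q.b q.σ).FunctionField with hE
  set v := coordV q.b q.σ with hv
  set t := coordT q.b q.σ with ht
  set ι := algebraMap ℂ E with hι
  have hchar : CharZero (cubicCurve q.b q.σ).FunctionField :=
    charZero_of_injective_algebraMap (algebraMap ℂ _).injective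
  have hv_tr : Transcendental ℂ v := transcendental_coordV _ _
  have hne : ∀ a : ℂ, v ≠ ι a := fun a h => hv_tr (h ▸ isAlgebraic_algebraMap a)
  have hv0 : v ≠ 0 := fun h => hne 0 (by rw [h, map_zero])
  have hinj : ∀ a : ℂ, a ≠ 0 → ι a ≠ 0 := fun a ha => by
    rw [hι, Ne, map_eq_zero_iff _ (algebraMap ℂ E).injective]; exact ha
  have hcι := hinj _ hc
  have htsq : t ^ 2 = v ^ 3 - 3 * ι q.b * v ^ 2 + ι q.σ / 2 * v := by
    have := coordT_sq q.b q.σ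
    rw [map_div₀, map_ofNat] at this
    exact this
  set m := v + ι q.σ / 2 / v with hm
  set y := v - ι q.σ / 2 / v with hy
  set y' := 2 * t * m / v with hy'
  have hmsq : m ^ 2 = y ^ 2 + 2 * ι q.σ := by
    rw [hm, hy]; field_simp; ring
  have hy'sq : y' ^ 2 + 12 * ι q.b * m ^ 2 = 4 * m ^ 3 := by
    rw [hy', div_pow, mul_pow, mul_pow, htsq, hm]; field_simp; ring
  have hm0 : m ≠ 0 := by
    intro h
    have h1 : v ^ 2 = -(ι q.σ / 2) := by
      rw [hm] at h; field_simp at h; linear_combination h / 2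
    obtain ⟨a, ha⟩ := IsAlgClosed.exists_pow_nat_eq (-(q.σ / 2)) two_pos
    have h2 : (v - ι a) * (v + ι a) = 0 := by
      have : ι a ^ 2 = -(ι q.σ / 2) := by
        rw [← map_pow, ha, map_neg, map_div₀, map_ofNat]
      linear_combination h1 - this
    rcases mul_eq_zero.1 h2 with h3 | h3
    · exact hne a (sub_eq_zero.1 h3)
    · exact hne (-a) (by rw [map_neg]; exact eq_neg_of_add_eq_zero_left h3)
  set x := ι q.s₁ + ι q.c * y with hx
  have hx_tr : Transcendental ℂ x := by
    intro halg
    obtain ⟨a, ha⟩ := exists_algebraMap_eq_of_isAlgebraic halg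
    -- Since v² - yv - σ/2 = 0, a constant value of y would make v algebraic.
    refine hv_tr ⟨X ^ 2 - C ((a - q.s₁) / q.c) * X - C (q.σ / 2), ?_, ?_⟩
    · intro h0
      have := congrArg (fun P => coeff P 2) h0
      simp at this
    · have h1 : y = (ι a - ι q.s₁) / ι q.c := by
        rw [eq_div_iff hcι, hι, ha, hx]; ring
      simp only [map_sub, map_mul, map_pow, aeval_X, aeval_C, map_div₀, map_ofNat]
      rw [← hι, ← h1, hy]
      field_simp
      ring
  have hroot : eval₂ (aeval (R := ℂ) x : ℂ[X] →+* E) (ι q.c * y') (F₄ q) = 0 := by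
    simp only [F₄, eval₂_add, eval₂_sub, eval₂_mul, eval₂_pow, eval₂_C, eval₂_X, eval₂_ofNat,
      RingHom.coe_coe, map_add, map_sub, map_mul, map_pow, aeval_X, aeval_C, map_ofNat]
    rw [← hι, Coeffs.σ₂_eq hc, hx]
    simp only [map_mul, map_pow]
    have h1 : (y' ^ 2 + 12 * ι q.b * (y ^ 2 + 2 * ι q.σ)) ^ 2 = 16 * (y ^ 2 + 2 * ι q.σ) ^ 3 := by
      rw [← hmsq, hy'sq]; ring
    linear_combination ι q.c ^ 6 * h1
  let φ : AdjoinRoot (F₄ q) →ₐ[ℂ] E := AdjoinRoot.liftAlgHom (F₄ q) (aeval x) (ι q.c * y') hroot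
  have hφX : φ (algebraMap ℂ[X] (AdjoinRoot (F₄ q)) X) = x := by
    have := AdjoinRoot.liftAlgHom_mk (F₄ q) (aeval x) (ι q.c * y') hroot (C X)
    rw [eval₂_C, RingHom.coe_coe, aeval_X] at this
    exact this
  have hφY : φ (AdjoinRoot.root (F₄ q)) = ι q.c * y' := by
    have := AdjoinRoot.liftAlgHom_mk (F₄ q) (aeval x) (ι q.c * y') hroot X
    rw [eval₂_X] at this
    exact this
  have hφ : Function.Injective φ :=
    injective_of_transcendental hdom (finite_adjoinRoot_F₄ hc) φ (by rwa [hφX])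
  let Φ : FractionRing (AdjoinRoot (F₄ q)) →ₐ[ℂ] E := IsFractionRing.liftAlgHom hφ
  have hΦ : ∀ a, Φ (algebraMap _ _ a) = φ a := fun a => by
    rw [IsFractionRing.liftAlgHom_apply]
    exact IsFractionRing.lift_algebraMap hφ a
  have hmemι : ∀ a : ℂ, ι a ∈ Φ.fieldRange := fun a => Φ.fieldRange.algebraMap_mem a
  have hmem2 : ∀ n : ℕ, (n : E) ∈ Φ.fieldRange := fun n => natCast_mem _ n
  have hxmem : x ∈ Φ.fieldRange := ⟨_, (hΦ _).trans hφX⟩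
  have hymem : y ∈ Φ.fieldRange := by
    have : y = (x - ι q.s₁) / ι q.c := by rw [hx]; field_simp; ring
    rw [this]
    exact div_mem (sub_mem hxmem (hmemι _)) (hmemι _)
  have hy'mem : y' ∈ Φ.fieldRange := by
    have h1 : ι q.c * y' ∈ Φ.fieldRange := ⟨_, (hΦ _).trans hφY⟩
    have : y' = ι q.c * y' / ι q.c := by field_simp
    rw [this]
    exact div_mem h1 (hmemι _)
  have hmmem : m ∈ Φ.fieldRange := by
    have h1 : m = (y' ^ 2 + 12 * ι q.b * (y ^ 2 + 2 * ι q.σ)) / (4 * (y ^ 2 + 2 * ι q.σ)) := by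
      rw [← hmsq, hy'sq]; field_simp
    have h2 : y ^ 2 + 2 * ι q.σ ∈ Φ.fieldRange :=
      add_mem (pow_mem hymem 2) (mul_mem (hmem2 2) (hmemι _))
    rw [h1]
    exact div_mem (add_mem (pow_mem hy'mem 2) (mul_mem (mul_mem (hmem2 12) (hmemι _)) h2))
      (mul_mem (hmem2 4) h2)
  have hvmem : v ∈ Φ.fieldRange := by
    have : v = (m + y) / 2 := by rw [hm, hy]; ring
    rw [this]
    exact div_mem (add_mem hmmem hymem) (hmem2 2)
  have htmem : t ∈ Φ.fieldRange := by
    have : t = y' * v / (2 * m) := by rw [hy']; field_simp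
    rw [this]
    exact div_mem (mul_mem hy'mem hvmem) (mul_mem (hmem2 2) hmmem)
  have htop := eq_top_of_coord_mem _ _ Φ.fieldRange hvmem htmem
  refine ⟨AlgEquiv.ofBijective Φ ⟨Φ.toRingHom.injective, fun z => ?_⟩⟩
  have : z ∈ Φ.fieldRange := by rw [htop]; trivial
  exact this

end SwiftHohenberg

end

/-! ### Assembly of the classification -/

open SwiftHohenberg.Coeffs in
theorem mainTheorem2 (q : SwiftHohenberg.Coeffs) (hc : q.c ≠ 0) :
    -- the nonconstant meromorphic solutions are exactly the members of the four families
    (∀ u : ℂ → ℂ,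
      (SwiftHohenberg.IsMeromorphicSolution q u ∧ ¬ SwiftHohenberg.IsConstant u) ↔
        ((SwiftHohenberg.IsEllipticOne q u ∨ SwiftHohenberg.IsEllipticOne q.flip u) ∨
         (SwiftHohenberg.IsTrigoOne q u ∨ SwiftHohenberg.IsTrigoOne q.flip u) ∨
         SwiftHohenberg.IsEllipticTwo q u ∨
         SwiftHohenberg.IsTrigoTwo q u)) ∧
    -- the first elliptic family: existence, order, first order equation, degeneration
    (SwiftHohenberg.ConstraintOne q → ∃ u, SwiftHohenberg.IsEllipticOne q u) ∧
    (∀ u, SwiftHohenberg.IsEllipticOne q u →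
      SwiftHohenberg.SatisfiesFirstOrder (SwiftHohenberg.F₂ q) u ∧
      (SwiftHohenberg.discOne q ≠ 0 → SwiftHohenberg.IsEllipticOfOrder u 2)) ∧
    (∀ u, SwiftHohenberg.IsTrigoOne q u ↔
      (SwiftHohenberg.IsEllipticOne q u ∧ SwiftHohenberg.discOne q = 0 ∧
        SwiftHohenberg.g₂One q ≠ 0)) ∧
    -- the second elliptic family: existence, order, equispaced fixed points, degeneration
    (SwiftHohenberg.ConstraintTwo q → SwiftHohenberg.discTwo q ≠ 0 →
      ∃ u, SwiftHohenberg.IsEllipticTwo q u) ∧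
    (∀ u, SwiftHohenberg.IsEllipticTwo q u → SwiftHohenberg.IsEllipticOfOrder u 4) ∧
    (∀ u, (SwiftHohenberg.IsEllipticTwo q u ∨ SwiftHohenberg.IsTrigoTwo q u) →
      SwiftHohenberg.Equispaced q) ∧
    (∀ u, SwiftHohenberg.IsEllipticTwo q u ↔
      (SwiftHohenberg.IsOddTwo q u ∧ SwiftHohenberg.discTwo q ≠ 0)) ∧
    (∀ u, SwiftHohenberg.IsTrigoTwo q u ↔
      (SwiftHohenberg.IsOddTwo q u ∧ SwiftHohenberg.discTwo q = 0)) ∧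
    SwiftHohenberg.discTwo q = 4 / (27 * q.c ^ 6)
      * (11 * q.b ^ 2 * q.c ^ 2 + 10 * (q.s₁ ^ 2 - q.s₂))
      * (8 * q.b ^ 2 * q.c ^ 2 - 5 * (q.s₁ ^ 2 - q.s₂)) ^ 2 ∧
    -- the last two families are the solutions of the irreducible subequation of degree four
    (∀ u, (SwiftHohenberg.IsEllipticTwo q u ∨ SwiftHohenberg.IsTrigoTwo q u) ↔
      (SwiftHohenberg.ConstraintTwo q ∧ SwiftHohenberg.σ₂ q ≠ 0 ∧ Meromorphic u ∧
        ¬ SwiftHohenberg.IsConstant u ∧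
        SwiftHohenberg.SatisfiesFirstOrder (SwiftHohenberg.F₄ q) u)) ∧
    (SwiftHohenberg.σ₂ q ≠ 0 → Irreducible (SwiftHohenberg.F₄ q)) ∧
    (SwiftHohenberg.discTwo q ≠ 0 → SwiftHohenberg.HasGenusOne (SwiftHohenberg.F₄ q)) := by
  have hc' : q.flip.c ≠ 0 := neg_ne_zero.2 hc
  -- Both families are `IsTwo` under the same constraints and are told apart only by whether the
  -- discriminant vanishes.
  have hII : ∀ u, (SwiftHohenberg.IsEllipticTwo q u ∨ SwiftHohenberg.IsTrigoTwo q u) ↔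
      SwiftHohenberg.IsOddTwo q u := fun u => by
    rw [isEllipticTwo_iff hc, isTrigoTwo_iff hc, isOddTwo_iff hc]
    tauto
  refine ⟨fun u => ?_, fun h => ?_, fun u h => ⟨satisfiesFirstOrder_of_isEllipticOne hc h,
    isEllipticOfOrder_of_isEllipticOne hc h⟩, fun u => isTrigoOne_iff hc, fun h hΔ => ?_,
    fun u => isEllipticOfOrder_of_isEllipticTwo hc, fun u h => equispaced ((hII u).1 h).1,
    fun u => ?_, fun u => ?_, ?_, fun u => ?_, SwiftHohenberg.irreducible_F₄ hc,
    SwiftHohenberg.hasGenusOne_F₄ hc⟩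
  -- The trigonometric family is contained in the first elliptic family, for c and for -c, so
  -- listing it separately does not change the union.
  · have h1 := @isTrigoOne_iff q hc u
    have h2 := @isTrigoOne_iff q.flip hc' u
    rw [isSolution_iff_families hc, ← isOddTwo_iff hc, ← hII]
    tauto
  · obtain ⟨p, hp⟩ := SwiftHohenberg.exists_isWeierstrassP (SwiftHohenberg.g₂One q)
      (SwiftHohenberg.g₃One q)
    exact ⟨_, h, p, 0, hp, Filter.EventuallyEq.rfl⟩
  · obtain ⟨p, hp⟩ := SwiftHohenberg.exists_isWeierstrassP (12 * q.b ^ 2 - 2 * q.σ)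
      (8 * q.b ^ 3 - 2 * q.σ * q.b)
    have hσ : q.σ ≠ 0 := fun h0 => hΔ (by rw [discTwo_eq hc, h0]; ring)
    exact ⟨_, (isEllipticTwo_iff hc).2 ⟨h, hΔ, hσ, p, hp.isW.1,
      (eventually_normalize_iff hc).2 Filter.EventuallyEq.rfl⟩⟩
  · rw [isEllipticTwo_iff hc, isOddTwo_iff hc]
    tauto
  · rw [isTrigoTwo_iff hc, isOddTwo_iff hc]
    tauto
  · simp only [SwiftHohenberg.discTwo, SwiftHohenberg.g₂Two, SwiftHohenberg.g₃Two]
    field_simp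
    ring
  · rw [hII, isOddTwo_iff hc, σ₂_ne_zero_iff hc, satisfiesFirstOrder_F₄_iff hc,
      ← meromorphic_normalize_iff hc, ← isConstant_normalize_iff hc]
    refine and_congr_right fun _ => ⟨fun h => ⟨h.1, ?_⟩, fun h => ?_⟩
    · exact (SwiftHohenberg.isTwo_iff_quartic h.1).1 h
    · exact (SwiftHohenberg.isTwo_iff_quartic h.1).2 h.2
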